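/- **Proposition.** Let $k$ be a field, let $A$ and $B$ be (associative, unital) $k$-algebras and let $\phi:A\to B$ be a morphism of $k$-algebras such that $B\otimes_A B\cong B$ as $B$-bimodules. Write $A^e=A\otimes_k A^{\mathrm{op}}$, $B^e=B\otimes_k B^{\mathrm{op}}$, $\phi^e=\phi\otimes\phi^{\mathrm{op}}:A^e\to B^e$, and identify bimodules with left modules over the enveloping algebra. A ring morphism $f:R\to S$ is called a *homological epimorphism* if the functor $D^b(S\text{-}\mathrm{Mod})\to D^b(R\text{-}\mathrm{Mod})$ between bounded derived categories induced by restriction of scalars along $f$ is full and faithful. The following statements are equivalent: (a) $\phi:A\to B$ is a homological epimorphism; (b) $\operatorname{Tor}^A_n(B,M)=0$ for all $n>0$ and all left $B$-modules $M$; (c) $\operatorname{Tor}^A_n(B,B)=0$ for all $n>0$; (d) $\phi^e:A^e\to B^e$ is a homological epimorphism. For a $k$-algebra $\Lambda$ and a $\Lambda$-bimodule $M$ let $H^n(\Lambda,M)=\operatorname{Ext}^n_{\Lambda^e}(\Lambda,M)$ be Hochschild cohomology. When (a)–(d) hold, the canonical maps $\eta^n_M:H^n(B,M)\to H^n(A,M)$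 (restrict along $\phi^e$ to get a class in $\operatorname{Ext}^n_{A^e}(B,M)$, then pull back along the bimodule map $\phi:A\to B$) are $k$-linear isomorphisms for all $n\ge 0$ and all $B$-bimodules $M$, and they are natural in the $B$-bimodule $M$. Moreover, for $M=B$ the maps $\eta^n_B$ form an isomorphism of graded algebras $HH^*(B)=H^*(B,B)\to H^*(A,B)$, where both sides carry the cup product: $\eta^0_B$ sends the unit (the class of $\mathrm{id}_B$) to the unit (the class of $\phi$), and $\eta_B(\alpha\smile\beta)=\eta_B(\alpha)\smile\eta_B(\beta)$ for all homogeneous classes $\alpha,\beta$. -/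

import Mathlib

open CategoryTheory
open scoped TensorProduct
universe v u

namespace HomEpi

/-! ### Homological epimorphisms -/

section Derived

variable {R S : Type u} [Ring R] [Ring S]

lemma restrictScalars_exact (f : R →+* S) :
    Limits.PreservesFiniteLimits (ModuleCat.restrictScalars.{u} f) ∧
      Limits.PreservesFiniteColimits (ModuleCat.restrictScalars.{u} f) :=
  ((Functor.exact_tfae (ModuleCat.restrictScalars.{u} f)).out 1 3).mp fun T hT => by
    rw [ShortComplex.ShortExact.moduleCat_exact_iff_function_exact] at hT ⊢
    exact hT

instance (f : R →+* S) : Limits.PreservesFiniteLimits (ModuleCat.restrictScalars.{u} f) :=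
  (restrictScalars_exact f).1

instance (f : R →+* S) : Limits.PreservesFiniteColimits (ModuleCat.restrictScalars.{u} f) :=
  (restrictScalars_exact f).2

attribute [local instance] HasDerivedCategory.standard

lemma bounded_mapDerivedCategory (f : R →+* S)
    (X : DerivedCategory.Bounded (ModuleCat.{u} S)) :
    (DerivedCategory.TStructure.t (C := ModuleCat.{u} R)).bounded
      ((ModuleCat.restrictScalars.{u} f).mapDerivedCategory.obj X.obj) := by
  obtain ⟨X, ⟨a, ha⟩, ⟨b, hb⟩⟩ := X
  obtain ⟨K, e, hK⟩ := ha.ge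
  obtain ⟨L, e', hL⟩ := hb.le
  let F := ModuleCat.restrictScalars.{u} f
  refine ⟨⟨a, ⟨⟨(F.mapHomologicalComplex (.up ℤ)).obj K,
    F.mapDerivedCategory.mapIso e ≪≫ F.mapDerivedCategoryFactors.app K, ?_⟩⟩⟩,
    ⟨b, ⟨⟨(F.mapHomologicalComplex (.up ℤ)).obj L,
    F.mapDerivedCategory.mapIso e' ≪≫ F.mapDerivedCategoryFactors.app L, ?_⟩⟩⟩⟩
  · exact (CochainComplex.isStrictlyGE_mapHomologicalComplex_obj_iff _ _ _).2 hK
  · exact (CochainComplex.isStrictlyLE_mapHomologicalComplex_obj_iff _ _ _).2 hL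

/-- The functor `D^b(f^*) : D^b(S-Mod) ⥤ D^b(R-Mod)` induced by restriction of scalars
along a ring homomorphism `f : R → S`. -/
noncomputable def boundedDerivedRestrict (f : R →+* S) :
    DerivedCategory.Bounded (ModuleCat.{u} S) ⥤ DerivedCategory.Bounded (ModuleCat.{u} R) :=
  ObjectProperty.lift _
    (DerivedCategory.Bounded.ι ⋙ (ModuleCat.restrictScalars.{u} f).mapDerivedCategory)
    (bounded_mapDerivedCategory f)

/-- `f : R → S` is a homological epimorphism if `D^b(f^*) : D^b(S-Mod) ⥤ D^b(R-Mod)`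
is full and faithful. -/
def IsHomologicalEpi (f : R →+* S) : Prop :=
  (boundedDerivedRestrict f).Full ∧ (boundedDerivedRestrict f).Faithful

end Derived

/-! ### Tensor product over a noncommutative ring and `Tor` -/

section Tor

variable {R : Type u} [Ring R]

/-- The relations `n a ⊗ m = n ⊗ a m` in `N ⊗_ℤ M`. -/
def balancing (N : ModuleCat.{u} Rᵐᵒᵖ) (M : ModuleCat.{u} R) : AddSubgroup (N ⊗[ℤ] M) :=
  AddSubgroup.closure
    {t | ∃ (n : N) (a : R) (m : M), t = (MulOpposite.op a • n) ⊗ₜ[ℤ] m - n ⊗ₜ[ℤ] (a • m)}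

/-- `N ⊗_R M` for a right `R`-module `N` and a left `R`-module `M`. -/
abbrev Tens (N : ModuleCat.{u} Rᵐᵒᵖ) (M : ModuleCat.{u} R) : Type u :=
  (N ⊗[ℤ] M) ⧸ balancing N M

/-- Functoriality of `N ⊗_R M` in both variables: `n ⊗ m ↦ f n ⊗ g m`. -/
def Tens.map {N N' : ModuleCat.{u} Rᵐᵒᵖ} {M M' : ModuleCat.{u} R} (f : N ⟶ N') (g : M ⟶ M') :
    Tens N M →+ Tens N' M' :=
  QuotientAddGroup.map _ _
    (TensorProduct.map f.hom.toAddMonoidHom.toIntLinearMap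
      g.hom.toAddMonoidHom.toIntLinearMap).toAddMonoidHom <| by
    rw [balancing, AddSubgroup.closure_le]
    rintro _ ⟨n, a, m, rfl⟩
    exact AddSubgroup.subset_closure ⟨f n, a, g m, by simp⟩

lemma Tens.induction {N : ModuleCat.{u} Rᵐᵒᵖ} {M : ModuleCat.{u} R} {X : Type*} [AddCommGroup X]
    {f g : Tens N M →+ X}
    (h : ∀ n m, f (QuotientAddGroup.mk (n ⊗ₜ[ℤ] m)) = g (QuotientAddGroup.mk (n ⊗ₜ[ℤ] m))) :
    f = g := by
  ext t
  induction t using TensorProduct.induction_on with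
  | zero => simp
  | tmul n m => exact h n m
  | add x y hx hy =>
    simp only [AddMonoidHom.comp_apply, map_add] at hx hy ⊢
    rw [hx, hy]

/-- The functor `N ⊗_R - : R-Mod ⥤ Ab`. -/
def tensFunctor (N : ModuleCat.{u} Rᵐᵒᵖ) : ModuleCat.{u} R ⥤ AddCommGrpCat.{u} where
  obj M := AddCommGrpCat.of (Tens N M)
  map g := AddCommGrpCat.ofHom (Tens.map (𝟙 N) g)
  map_id M := by
    ext1; exact Tens.induction fun _ _ => rfl
  map_comp f g := by
    ext1; exact Tens.induction fun _ _ => rfl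

instance (N : ModuleCat.{u} Rᵐᵒᵖ) : (tensFunctor N).Additive where
  map_add {X Y f g} := by
    ext1
    refine Tens.induction fun n m => ?_
    change QuotientAddGroup.mk (n ⊗ₜ[ℤ] (f m + g m)) =
      (QuotientAddGroup.mk (n ⊗ₜ[ℤ] f m) + QuotientAddGroup.mk (n ⊗ₜ[ℤ] g m) : Tens N Y)
    rw [TensorProduct.tmul_add]; rfl

/-- `Tor_n^R(N, M)`, the `n`-th left derived functor of `N ⊗_R -` evaluated at `M`. -/
noncomputable def Tor (n : ℕ) (N : ModuleCat.{u} Rᵐᵒᵖ) (M : ModuleCat.{u} R) :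
    AddCommGrpCat.{u} :=
  ((tensFunctor N).leftDerived n).obj M

end Tor

section Restrict

variable {A B : Type u} [Ring A] [Ring B]

/-- `B` as a right `A`-module along `φ : A → B`. -/
noncomputable def rightMod (φ : A →+* B) : ModuleCat.{u} Aᵐᵒᵖ :=
  (ModuleCat.restrictScalars φ.op).obj (ModuleCat.of Bᵐᵒᵖ B)

/-- A left `B`-module as a left `A`-module along `φ : A → B`. -/
noncomputable abbrev leftMod (φ : A →+* B) (M : ModuleCat.{u} B) : ModuleCat.{u} A :=
  (ModuleCat.restrictScalars φ).obj M

/-- Left multiplication by `b` as an endomorphism of the right `A`-module `B`. -/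
noncomputable def lmulHom (φ : A →+* B) (b : B) : rightMod φ ⟶ rightMod φ :=
  (ModuleCat.restrictScalars φ.op).map (ModuleCat.ofHom (Module.toModuleEnd Bᵐᵒᵖ B b))

/-- Right multiplication by `b` as an endomorphism of the left `A`-module `B`. -/
noncomputable def rmulHom (φ : A →+* B) (b : B) :
    leftMod φ (ModuleCat.of B B) ⟶ leftMod φ (ModuleCat.of B B) :=
  (ModuleCat.restrictScalars φ).map
    (ModuleCat.ofHom (Module.toModuleEnd B B (MulOpposite.op b)))

/-- `B ⊗_A B ≅ B` as `B`-bimodules: there is an additive bijection `e` such that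
`e (b t) = b e(t)` and `e (t b) = e(t) b`. -/
def TensorSquareIso (φ : A →+* B) : Prop :=
  ∃ e : Tens (rightMod φ) (leftMod φ (ModuleCat.of B B)) ≃+ B,
    (∀ b t, e (Tens.map (lmulHom φ b) (𝟙 _) t) = b * e t) ∧
    (∀ b t, e (Tens.map (𝟙 _) (rmulHom φ b) t) = e t * b)

end Restrict

/-! ### Enveloping algebra and bimodules -/

section Hochschild

open MulOpposite

/-- The enveloping algebra `A^e = A ⊗_k A^op`; left `A^e`-modules are `A`-bimodules. -/
abbrev Env (k : Type v) (A : Type u) [Field k] [Ring A] [Algebra k A] : Type u := A ⊗[k] Aᵐᵒᵖ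

variable {k : Type v} [Field k] {A B : Type u} [Ring A] [Algebra k A] [Ring B] [Algebra k B]

/-- `φ^e = φ ⊗ φ^op : A^e → B^e`. -/
noncomputable def envMap (φ : A →ₐ[k] B) : Env k A →ₐ[k] Env k B :=
  Algebra.TensorProduct.map φ (AlgHom.op φ)

/-- The left action `m ↦ a m` on a bimodule. -/
def lact (k : Type v) {A : Type u} [Field k] [Ring A] [Algebra k A] {M : Type*} [AddCommGroup M] [Module (Env k A) M] (a : A) (m : M) : M :=
  (a ⊗ₜ[k] (1 : Aᵐᵒᵖ) : Env k A) • m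

/-- The right action `m ↦ m a` on a bimodule. -/
def ract (k : Type v) {A : Type u} [Field k] [Ring A] [Algebra k A] {M : Type*} [AddCommGroup M] [Module (Env k A) M] (m : M) (a : A) : M :=
  ((1 : A) ⊗ₜ[k] op a : Env k A) • m

/-! ### The bar resolution -/

/-- The bimodule structure `a (x ⊗ y) b = a x ⊗ y b` on `A ⊗ X`, for a bimodule `X`. -/
noncomputable def stepAct {X : Type u} [AddCommGroup X] [Module k X]
    (ρ : Env k A →ₐ[k] Module.End k X) : Env k A →ₐ[k] Module.End k (A ⊗[k] X) :=
  Algebra.TensorProduct.lift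
    ((Module.End.rTensorAlgHom k A X).comp (Algebra.lmul k A))
    ((Module.End.lTensorAlgHom k X A).comp (ρ.comp Algebra.TensorProduct.includeRight))
    (fun _ _ => TensorProduct.ext' fun _ _ => rfl)

lemma stepAct_tmul {X : Type u} [AddCommGroup X] [Module k X]
    (ρ : Env k A →ₐ[k] Module.End k X) (a : A) (b : Aᵐᵒᵖ) (x : A) (y : X) :
    stepAct ρ (a ⊗ₜ b) (x ⊗ₜ y) = (a * x) ⊗ₜ ρ (1 ⊗ₜ b) y := by
  rfl

variable (k A)

/-- `Bar n = A ⊗ A ⊗ ⋯ ⊗ A` (`n + 1` factors, tensor products over `k`). -/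
noncomputable def Bar : ℕ → ModuleCat.{u} k
  | 0 => ModuleCat.of k A
  | n + 1 => ModuleCat.of k (A ⊗[k] Bar n)

/-- The `A`-bimodule structure of `Bar n`: on the left through the first factor, on the right
through the last one. -/
noncomputable def barAct : ∀ n, Env k A →ₐ[k] Module.End k (Bar k A n)
  | 0 => AlgHom.mulLeftRight k A
  | n + 1 => stepAct (barAct n)

noncomputable instance (n : ℕ) : Module (Env k A) (Bar k A n) :=
  Module.compHom _ (barAct k A n).toRingHom

lemma bar_smul_def (n : ℕ) (e : Env k A) (x : Bar k A n) : e • x = barAct k A n e x := rfl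

instance (n : ℕ) : IsScalarTower k (Env k A) (Bar k A n) where
  smul_assoc c e x := by simp [bar_smul_def]

/-- The map `(a, x) ↦ a ⊗ x` from `A × Bar n` to `Bar (n + 1)`. -/
noncomputable def barCons (n : ℕ) : A →ₗ[k] Bar k A n →ₗ[k] Bar k A (n + 1) :=
  TensorProduct.mk k A (Bar k A n)

variable {k A}

/-- The universal property of `Bar (n + 1) = A ⊗ Bar n`. -/
noncomputable def barLift {n : ℕ} {M : Type*} [AddCommGroup M] [Module k M]
    (f : A →ₗ[k] Bar k A n →ₗ[k] M) : Bar k A (n + 1) →ₗ[k] M :=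
  TensorProduct.lift f

@[simp] lemma barLift_cons {n : ℕ} {M : Type*} [AddCommGroup M] [Module k M]
    (f : A →ₗ[k] Bar k A n →ₗ[k] M) (a : A) (x : Bar k A n) :
    barLift f (barCons k A n a x) = f a x := TensorProduct.lift.tmul a x

lemma bar_induction {n : ℕ} {p : Bar k A (n + 1) → Prop} (z : Bar k A (n + 1)) (h0 : p 0)
    (h1 : ∀ a x, p (barCons k A n a x)) (h2 : ∀ x y, p x → p y → p (x + y)) : p z :=
  TensorProduct.induction_on z h0 h1 h2

lemma bar_ext {n : ℕ} {M : Type*} [AddCommGroup M] [Module k M] {f g : Bar k A (n + 1) →ₗ[k] M}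
    (h : ∀ a x, f (barCons k A n a x) = g (barCons k A n a x)) : f = g :=
  TensorProduct.ext' h

section act

variable {M : Type*} [AddCommGroup M] [Module (Env k A) M]

lemma env_smul_eq (a : A) (b : Aᵐᵒᵖ) (m : M) :
    (a ⊗ₜ[k] b : Env k A) • m = lact k a (ract k m b.unop) := by
  rw [lact, ract, ← mul_smul]; simp

lemma lact_lact (a b : A) (m : M) : lact k a (lact k b m) = lact k (a * b) m := by
  simp only [lact, ← mul_smul]; simp

lemma lact_ract (a b : A) (m : M) :
    lact k a (ract k m b) = ract k (lact k a m) b := by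
  simp only [lact, ract, ← mul_smul]; simp

lemma ract_ract (m : M) (a b : A) : ract k (ract k m a) b = ract k m (a * b) := by
  simp only [ract, ← mul_smul]; simp

lemma lact_one (m : M) : lact k (1 : A) m = m := by
  rw [lact, ← Algebra.TensorProduct.one_def, one_smul]

/-- A map commuting with both one-sided actions commutes with the action of `A^e`. -/
lemma env_linear {N : Type*} [AddCommGroup N] [Module (Env k A) N] (f : M →+ N)
    (hl : ∀ (a : A) m, f (lact k a m) = lact k a (f m))
    (hr : ∀ m (a : A), f (ract k m a) = ract k (f m) a) (e : Env k A) (m : M) :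
    f (e • m) = e • f m := by
  induction e using TensorProduct.induction_on with
  | zero =>
    have h := zero_smul (Env k A) m
    have h' := zero_smul (Env k A) (f m)
    exact (congrArg f h).trans ((map_zero f).trans h'.symm)
  | tmul a b => rw [env_smul_eq, hl, hr, ← env_smul_eq]
  | add x y hx hy => simp only [add_smul, map_add, hx, hy]

/-- The left action as a bilinear map. -/
noncomputable def lactₗ (k : Type v) (A : Type u) [Field k] [Ring A] [Algebra k A]
    (M : Type*) [AddCommGroup M] [Module k M] [Module (Env k A) M] [IsScalarTower k (Env k A) M] :
    A →ₗ[k] M →ₗ[k] M :=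
  LinearMap.mk₂ k (fun a m => lact k a m)
    (fun a b m => by simp [lact, TensorProduct.add_tmul, add_smul])
    (fun c a m => by simp only [lact, ← TensorProduct.smul_tmul', smul_assoc])
    (fun a m m' => by simp [lact])
    (fun c a m => by simp only [lact]; rw [smul_algebra_smul_comm])

@[simp] lemma lactₗ_apply [Module k M] [IsScalarTower k (Env k A) M] (a : A) (m : M) :
    lactₗ k A M a m = lact k a m := rfl

end act

lemma bar_lact (n : ℕ) (a b : A) (x : Bar k A n) :
    lact k a (barCons k A n b x) = barCons k A n (a * b) x := by
  refine (stepAct_tmul (barAct k A n) a 1 b x).trans ?_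
  rw [← Algebra.TensorProduct.one_def, map_one]; rfl

lemma bar_ract (n : ℕ) (a b : A) (x : Bar k A n) :
    ract k (barCons k A n b x) a = barCons k A n b (ract k x a) := by
  refine (stepAct_tmul (barAct k A n) 1 (op a) b x).trans ?_
  rw [one_mul]; rfl

variable (k A) in
/-- `Bar 0` is `A`. -/
noncomputable def barZero : A ≃ₗ[k] Bar k A 0 := LinearEquiv.refl k A

lemma barZero_smul (a : A) (b : Aᵐᵒᵖ) (x : A) :
    (a ⊗ₜ[k] b : Env k A) • barZero k A x = barZero k A (a * x * b.unop) :=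
  AlgHom.mulLeftRight_apply k A a b x

lemma barZero_lact (a x : A) : lact k a (barZero k A x) = barZero k A (a * x) := by
  rw [lact, barZero_smul]; simp

lemma barZero_ract (x a : A) : ract k (barZero k A x) a = barZero k A (x * a) := by
  rw [ract, barZero_smul]; simp

variable (k A)

/-- The bar differential `Bar (n + 1) → Bar n`, `d (a ⊗ x) = a x - a ⊗ d x`, that is
`d (a₀ ⊗ ⋯ ⊗ a_{n+1}) = ∑ᵢ (-1)ⁱ a₀ ⊗ ⋯ ⊗ aᵢ aᵢ₊₁ ⊗ ⋯ ⊗ a_{n+1}`. -/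
noncomputable def barD : ∀ n, Bar k A (n + 1) →ₗ[k] Bar k A n
  | 0 => barLift (lactₗ k A (Bar k A 0))
  | n + 1 => barLift (lactₗ k A (Bar k A (n + 1)) - (barCons k A n).compl₂ (barD n))

variable {k A}

lemma barD_cons_zero (a : A) (x : Bar k A 0) :
    barD k A 0 (barCons k A 0 a x) = lact k a x := barLift_cons _ _ _

lemma barD_cons_succ {n : ℕ} (a : A) (x : Bar k A (n + 1)) :
    barD k A (n + 1) (barCons k A (n + 1) a x) =
      lact k a x - barCons k A n a (barD k A n x) := barLift_cons _ _ _

lemma lact_add {M : Type*} [AddCommGroup M] [Module (Env k A) M] (a : A) (m m' : M) :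
    lact k a (m + m') = lact k a m + lact k a m' := smul_add _ _ _

lemma lact_sub {M : Type*} [AddCommGroup M] [Module (Env k A) M] (a : A) (m m' : M) :
    lact k a (m - m') = lact k a m - lact k a m' := smul_sub _ _ _

lemma ract_add {M : Type*} [AddCommGroup M] [Module (Env k A) M] (m m' : M) (a : A) :
    ract k (m + m') a = ract k m a + ract k m' a := smul_add _ _ _

lemma ract_sub {M : Type*} [AddCommGroup M] [Module (Env k A) M] (m m' : M) (a : A) :
    ract k (m - m') a = ract k m a - ract k m' a := smul_sub _ _ _

lemma ract_zero {M : Type*} [AddCommGroup M] [Module (Env k A) M] (a : A) :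
    ract k (0 : M) a = 0 := smul_zero _

lemma barD_lact (n : ℕ) (a : A) (x : Bar k A (n + 1)) :
    barD k A n (lact k a x) = lact k a (barD k A n x) := by
  induction x using bar_induction with
  | h0 => simp [lact]
  | h2 x y hx hy => simp only [map_add, lact_add, hx, hy]
  | h1 b x =>
    rw [bar_lact]
    cases n with
    | zero => rw [barD_cons_zero, barD_cons_zero, lact_lact]
    | succ n =>
      rw [barD_cons_succ, barD_cons_succ, lact_sub, bar_lact, lact_lact]

lemma barD_ract (n : ℕ) (x : Bar k A (n + 1)) (a : A) :
    barD k A n (ract k x a) = ract k (barD k A n x) a := by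
  induction n with
  | zero =>
    induction x using bar_induction with
    | h0 => simp [ract_zero]
    | h2 x y hx hy => simp only [map_add, ract_add, hx, hy]
    | h1 b x => rw [bar_ract, barD_cons_zero, barD_cons_zero, lact_ract]
  | succ n ih =>
    induction x using bar_induction with
    | h0 => simp [ract_zero]
    | h2 x y hx hy => simp only [map_add, ract_add, hx, hy]
    | h1 b x => rw [bar_ract, barD_cons_succ, barD_cons_succ, ih, ract_sub, lact_ract, bar_ract]

lemma barD_barD (n : ℕ) (x : Bar k A (n + 2)) : barD k A n (barD k A (n + 1) x) = 0 := by
  induction n with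
  | zero =>
    induction x using bar_induction with
    | h0 => simp
    | h2 x y hx hy => simp only [map_add, hx, hy, add_zero]
    | h1 b x => rw [barD_cons_succ, map_sub, barD_lact, barD_cons_zero, sub_self]
  | succ n ih =>
    induction x using bar_induction with
    | h0 => simp
    | h2 x y hx hy => simp only [map_add, hx, hy, add_zero]
    | h1 b x => rw [barD_cons_succ, map_sub, barD_lact, barD_cons_succ b, ih]; simp

lemma barD_exact (n : ℕ) (x : Bar k A (n + 1)) (hx : barD k A n x = 0) :
    barD k A (n + 1) (barCons k A (n + 1) 1 x) = x := by
  rw [barD_cons_succ, hx, lact_one]; simp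

lemma barD_surj (x : Bar k A 0) : barD k A 0 (barCons k A 0 1 x) = x := by
  rw [barD_cons_zero, lact_one]

/-! ### Bimodules, the bar resolution and Hochschild cohomology -/

/-- `Bar n` as an `A^e`-module. -/
noncomputable abbrev barMod (k : Type v) (A : Type u) [Field k] [Ring A] [Algebra k A] (n : ℕ) :
    ModuleCat.{u} (Env k A) := ModuleCat.of (Env k A) (Bar k A n)

/-- The regular `A`-bimodule `A`, with `(a ⊗ b) x = a x b`. -/
noncomputable def regular (k : Type v) (A : Type u) [Field k] [Ring A] [Algebra k A] :
    ModuleCat.{u} (Env k A) :=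
  letI : Module (Env k A) A := Module.compHom A (AlgHom.mulLeftRight k A).toRingHom
  ModuleCat.of (Env k A) A

/-- The element `x` of `A` as an element of the regular bimodule. -/
def regularEquiv (k : Type v) (A : Type u) [Field k] [Ring A] [Algebra k A] :
    A ≃+ regular k A := AddEquiv.refl A

lemma regular_smul (a : A) (b : Aᵐᵒᵖ) (x : A) :
    (a ⊗ₜ[k] b : Env k A) • regularEquiv k A x = regularEquiv k A (a * x * b.unop) :=
  AlgHom.mulLeftRight_apply k A a b x

lemma regular_lact (a x : A) :
    lact k a (regularEquiv k A x) = regularEquiv k A (a * x) := by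
  rw [lact, regular_smul]; simp

lemma regular_ract (a x : A) :
    ract k (regularEquiv k A x) a = regularEquiv k A (x * a) := by
  rw [ract, regular_smul]; simp

/-- The bar differential as a map of bimodules. -/
noncomputable def barDHom (k : Type v) (A : Type u) [Field k] [Ring A] [Algebra k A] (n : ℕ) :
    barMod k A (n + 1) ⟶ barMod k A n :=
  ModuleCat.ofHom
    { toFun := barD k A n
      map_add' := map_add _
      map_smul' := env_linear (barD k A n).toAddMonoidHom (barD_lact n) (barD_ract n) }

/-- `Bar 0` is the regular bimodule. -/
noncomputable def barZeroIso (k : Type v) (A : Type u) [Field k] [Ring A] [Algebra k A] :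
    barMod k A 0 ≅ regular k A := Iso.refl (barMod k A 0)

/-- A map `Bar n → M` is right linear if it commutes with the right actions of `A`. -/
def IsRightLinear {n : ℕ} {M : Type*} [AddCommGroup M] [Module (Env k A) M] (f : Bar k A n → M) :
    Prop := ∀ x (a : A), f (ract k x a) = ract k (f x) a

section extend

variable {n : ℕ} {M : Type*} [AddCommGroup M] [Module k M] [Module (Env k A) M]
  [IsScalarTower k (Env k A) M]

/-- The map `a ⊗ x ↦ a f(x)`. -/
noncomputable def extendLeft (f : Bar k A n →ₗ[k] M) : Bar k A (n + 1) →ₗ[k] M :=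
  barLift ((lactₗ k A M).compl₂ f)

@[simp] lemma extendLeft_cons (f : Bar k A n →ₗ[k] M) (a : A) (x : Bar k A n) :
    extendLeft f (barCons k A n a x) = lact k a (f x) := barLift_cons _ _ _

lemma extendLeft_lact (f : Bar k A n →ₗ[k] M) (a : A) (x : Bar k A (n + 1)) :
    extendLeft f (lact k a x) = lact k a (extendLeft f x) := by
  induction x using bar_induction with
  | h0 => simp [lact]
  | h2 x y hx hy => simp only [map_add, lact_add, hx, hy]
  | h1 b x => rw [bar_lact, extendLeft_cons, extendLeft_cons, lact_lact]

lemma extendLeft_ract (f : Bar k A n →ₗ[k] M) (hf : IsRightLinear f)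
    (x : Bar k A (n + 1)) (a : A) :
    extendLeft f (ract k x a) = ract k (extendLeft f x) a := by
  induction x using bar_induction with
  | h0 => simp [ract]
  | h2 x y hx hy => simp only [map_add, ract_add, hx, hy]
  | h1 b x => rw [bar_ract, extendLeft_cons, extendLeft_cons, hf, lact_ract]

/-- `extendLeft f` as an `A^e`-linear map, when `f` is right linear. -/
noncomputable def extendHom (f : Bar k A n →ₗ[k] M) (hf : IsRightLinear f) :
    Bar k A (n + 1) →ₗ[Env k A] M where
  toFun := extendLeft f
  map_add' := map_add _
  map_smul' := env_linear (extendLeft f).toAddMonoidHom (extendLeft_lact f) (extendLeft_ract f hf)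

/-- The restriction `x ↦ f (1 ⊗ x)` of an `A^e`-linear map. -/
noncomputable def restrictOne (f : Bar k A (n + 1) →ₗ[Env k A] M) : Bar k A n →ₗ[k] M :=
  (f.restrictScalars k) ∘ₗ barCons k A n 1

lemma restrictOne_right (f : Bar k A (n + 1) →ₗ[Env k A] M) :
    IsRightLinear (restrictOne f) := fun x a => by
  change f (barCons k A n 1 (ract k x a)) = ract k (f (barCons k A n 1 x)) a
  rw [← bar_ract]; exact f.map_smul _ _

lemma extendLeft_restrictOne (f : Bar k A (n + 1) →ₗ[Env k A] M) (x : Bar k A (n + 1)) :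
    extendLeft (restrictOne f) x = f x := by
  induction x using bar_induction with
  | h0 => simp
  | h2 x y hx hy => simp only [map_add, hx, hy]
  | h1 b x =>
    rw [extendLeft_cons]
    refine (f.map_smul _ _).symm.trans ?_
    change f (lact k b (barCons k A n 1 x)) = _
    rw [bar_lact, mul_one]

end extend

section projective

variable {M N : Type*} [AddCommGroup M] [Module k M] [Module (Env k A) M]
  [IsScalarTower k (Env k A) M] [AddCommGroup N] [Module k N] [Module (Env k A) N]
  [IsScalarTower k (Env k A) N]

lemma exists_right_lift (g : M →ₗ[Env k A] N) (hg : Function.Surjective g) :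
    ∀ (n : ℕ) (f : Bar k A n →ₗ[k] N), IsRightLinear f →
      ∃ f' : Bar k A n →ₗ[k] M, IsRightLinear f' ∧ ∀ x, g (f' x) = f x := by
  intro n
  induction n with
  | zero =>
    intro f hf
    obtain ⟨m, hm⟩ := hg (f (barZero k A 1))
    let r : A →ₗ[k] M :=
      { toFun := fun x => ract k m x
        map_add' := fun x y => by simp [ract, TensorProduct.tmul_add, add_smul]
        map_smul' := fun c x => by
          simp only [ract, op_smul, TensorProduct.tmul_smul, smul_assoc, RingHom.id_apply] }
    have hr : ∀ x, (r ∘ₗ (barZero k A).symm.toLinearMap) (barZero k A x) = ract k m x := fun _ => rfl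
    refine ⟨r ∘ₗ (barZero k A).symm.toLinearMap, fun x a => ?_, fun x => ?_⟩
    · obtain ⟨x, rfl⟩ := (barZero k A).surjective x
      rw [barZero_ract, hr, hr, ract_ract]
    · obtain ⟨x, rfl⟩ := (barZero k A).surjective x
      rw [hr]
      refine (g.map_smul _ _).trans ?_
      rw [hm]
      refine (hf (barZero k A 1) x).symm.trans ?_
      rw [barZero_ract, one_mul]
  | succ n ih =>
    intro f hf
    let b := Module.Basis.ofVectorSpace k A
    have h1 : ∀ a : A, IsRightLinear (f ∘ₗ barCons k A n a) := fun a x c => by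
      change f (barCons k A n a (ract k x c)) = _
      rw [← bar_ract, hf]; rfl
    choose F hF hF' using fun i => ih (f ∘ₗ barCons k A n (b i)) (h1 _)
    let L : A →ₗ[k] Bar k A n →ₗ[k] M := b.constr k F
    have hL : ∀ a, IsRightLinear (L a) := fun a => by
      have ha : a ∈ Submodule.span k (Set.range b) := by rw [b.span_eq]; trivial
      induction ha using Submodule.span_induction with
      | mem a ha =>
        obtain ⟨i, rfl⟩ := ha
        rw [b.constr_basis]; exact hF i
      | zero => intro x c; simp [ract]
      | add a a' _ _ h h' =>
        intro x c
        rw [map_add, LinearMap.add_apply, LinearMap.add_apply, h, h', ract_add]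
      | smul r a _ h =>
        intro x c
        rw [map_smul, LinearMap.smul_apply, LinearMap.smul_apply, h, ract, ract,
          smul_algebra_smul_comm]
    have hg' : L.compr₂ (g.restrictScalars k) = (barCons k A n).compr₂ f := by
      refine b.ext fun i => LinearMap.ext fun x => ?_
      rw [LinearMap.compr₂_apply, b.constr_basis]
      exact hF' i x
    refine ⟨barLift L, fun x a => ?_, fun x => ?_⟩
    · induction x using bar_induction with
      | h0 => simp [ract]
      | h2 x y hx hy => simp only [map_add, ract_add, hx, hy]
      | h1 b x => rw [bar_ract, barLift_cons, barLift_cons, hL]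
    · induction x using bar_induction with
      | h0 => simp
      | h2 x y hx hy => simp only [map_add, hx, hy]
      | h1 b x =>
        rw [barLift_cons]
        exact LinearMap.congr_fun (LinearMap.congr_fun hg' b) x

end projective

attribute [local instance] ModuleCat.moduleOfAlgebraModule ModuleCat.isScalarTower_of_algebra_moduleCat

instance barMod_projective (n : ℕ) : Projective (barMod k A (n + 1)) where
  factors {X Y} f e he := by
    rw [ModuleCat.epi_iff_surjective] at he
    obtain ⟨f', hf', h⟩ := exists_right_lift e.hom he n (restrictOne f.hom) (restrictOne_right _)
    refine ⟨ModuleCat.ofHom (extendHom f' hf'), ?_⟩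
    ext x
    change e.hom (extendLeft f' x) = f.hom x
    rw [← extendLeft_restrictOne]
    induction x using bar_induction with
    | h0 => simp
    | h2 x y hx hy => simp only [map_add, hx, hy]
    | h1 b x =>
      rw [extendLeft_cons, extendLeft_cons, ← h]
      exact e.hom.map_smul _ _

/-- The bar complex `⋯ → A ⊗ A ⊗ A → A ⊗ A`. -/
noncomputable def barComplex (k : Type v) (A : Type u) [Field k] [Ring A] [Algebra k A] :
    ChainComplex (ModuleCat.{u} (Env k A)) ℕ :=
  ChainComplex.of (fun n => barMod k A (n + 1)) (fun n => barDHom k A (n + 1)) fun n => by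
    ext x; exact barD_barD (n + 1) x

lemma barComplex_d (n : ℕ) : (barComplex k A).d (n + 1) n = barDHom k A (n + 1) :=
  ChainComplex.of_d (fun n => barMod k A (n + 1)) (fun n => barDHom k A (n + 1)) n

/-- The augmentation `A ⊗ A → A`, `a ⊗ b ↦ a b`. -/
noncomputable def barAug (k : Type v) (A : Type u) [Field k] [Ring A] [Algebra k A] :
    barMod k A 1 ⟶ regular k A := barDHom k A 0 ≫ (barZeroIso k A).hom

lemma barComplex_d_aug : (barComplex k A).d 1 0 ≫ barAug k A = 0 := by
  rw [barComplex_d, barAug]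
  ext x
  exact barD_barD 0 x

lemma barAug_epi : Epi (barAug k A) := by
  rw [ModuleCat.epi_iff_surjective]
  exact fun x => ⟨barCons k A 0 1 x, barD_surj (k := k) x⟩

lemma barAug_exact : (ShortComplex.mk _ _ (barComplex_d_aug (k := k) (A := A))).Exact := by
  rw [ShortComplex.moduleCat_exact_iff]
  intro x hx
  refine ⟨barCons k A 1 1 x, ?_⟩
  change (barComplex k A).d 1 0 _ = x
  rw [barComplex_d]
  exact barD_exact 0 x hx

lemma barComplex_exactAt (n : ℕ) : (barComplex k A).ExactAt (n + 1) := by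
  rw [HomologicalComplex.exactAt_iff' _ (n + 2) (n + 1) n (by simp) (by simp),
    ShortComplex.moduleCat_exact_iff]
  intro x hx
  change (barComplex k A).d (n + 1) n x = 0 at hx
  rw [barComplex_d] at hx
  refine ⟨barCons k A (n + 2) 1 x, ?_⟩
  change (barComplex k A).d (n + 2) (n + 1) _ = x
  rw [barComplex_d]
  exact barD_exact (n + 1) x hx

/-- The bar resolution of the regular bimodule. -/
noncomputable def barResolution (k : Type v) (A : Type u) [Field k] [Ring A] [Algebra k A] :
    ProjectiveResolution (regular k A) where
  complex := barComplex k A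
  projective n := barMod_projective n
  π := (ChainComplex.toSingle₀Equiv _ _).symm ⟨barAug k A, barComplex_d_aug⟩
  quasiIso := ⟨fun n => by
    cases n with
    | zero =>
      rw [ChainComplex.quasiIsoAt₀_iff, ShortComplex.quasiIso_iff_of_zeros']
      · refine (ShortComplex.exact_and_epi_g_iff_of_iso ?_).2 ⟨barAug_exact, barAug_epi⟩
        exact ShortComplex.isoMk (Iso.refl _) (Iso.refl _) (Iso.refl _)
          ((Category.id_comp _).trans (Category.comp_id _).symm)
          ((Category.id_comp _).trans (Category.comp_id _).symm)
      all_goals rfl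
    | succ n =>
      rw [quasiIsoAt_iff_exactAt']
      · exact barComplex_exactAt n
      · apply ChainComplex.exactAt_succ_single_obj⟩


/-! ### Cup product -/

/-- A bimodule pairing `M ⊗_A N → L`: a biadditive map `(m, n) ↦ m n` with `(a m) n = a (m n)`,
`(m a) n = m (a n)` and `m (n a) = (m n) a`. -/
structure Pairing (k : Type v) (A : Type u) [Field k] [Ring A] [Algebra k A]
    (M N L : ModuleCat.{u} (Env k A)) where
  /-- the underlying biadditive map -/
  toFun : M →+ N →+ L
  left : ∀ (a : A) m n, toFun (lact k a m) n = lact k a (toFun m n)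
  mid : ∀ m (a : A) n, toFun (ract k m a) n = toFun m (lact k a n)
  right : ∀ m n (a : A), toFun m (ract k n a) = ract k (toFun m n) a

lemma smul_eq_lact {M : Type*} [AddCommGroup M] [Module k M] [Module (Env k A) M]
    [IsScalarTower k (Env k A) M] (c : k) (m : M) : c • m = lact k (algebraMap k A c) m := by
  rw [lact, Algebra.algebraMap_eq_smul_one, ← TensorProduct.smul_tmul', smul_assoc,
    ← Algebra.TensorProduct.one_def, one_smul]

lemma smul_eq_ract {M : Type*} [AddCommGroup M] [Module k M] [Module (Env k A) M]
    [IsScalarTower k (Env k A) M] (c : k) (m : M) : c • m = ract k m (algebraMap k A c) := by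
  rw [ract, Algebra.algebraMap_eq_smul_one, op_smul, TensorProduct.tmul_smul, smul_assoc, op_one,
    ← Algebra.TensorProduct.one_def, one_smul]

section cup

variable {M N L : ModuleCat.{u} (Env k A)} (μ : Pairing k A M N L)

/-- A pairing as a `k`-bilinear map. -/
noncomputable def Pairing.bilin : M →ₗ[k] N →ₗ[k] L :=
  LinearMap.mk₂ k (fun m n => μ.toFun m n) (fun _ _ _ => by simp)
    (fun c m n => by rw [smul_eq_lact (A := A), μ.left, smul_eq_lact (A := A)])
    (fun _ _ _ => by simp)
    (fun c m n => by
      rw [smul_eq_ract (A := A) c n, μ.right, smul_eq_ract (A := A)])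

lemma Pairing.bilin_apply (m : M) (n : N) : μ.bilin m n = μ.toFun m n := rfl

/-- The cup product of cochains
`(φ ⌣ γ) (a₁ ⊗ ⋯ ⊗ a_p ⊗ y) = φ (a₁ ⊗ ⋯ ⊗ a_p ⊗ 1) γ (y)` for `y` in `Bar q`. -/
noncomputable def cochainCup {q : ℕ} (γ : Bar k A q →ₗ[k] N) :
    ∀ p : ℕ, (Bar k A p →ₗ[k] M) →ₗ[k] (Bar k A (q + p) →ₗ[k] L)
  | 0 => (LinearMap.lcomp k L γ) ∘ₗ μ.bilin ∘ₗ LinearMap.applyₗ (barZero k A 1)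
  | p + 1 =>
    { toFun := fun φ => barLift (cochainCup γ p ∘ₗ (barCons k A p).compr₂ φ)
      map_add' := fun φ ψ => bar_ext fun a x => by
        rw [LinearMap.add_apply, barLift_cons, barLift_cons, barLift_cons]
        exact LinearMap.congr_fun (map_add (cochainCup γ p) ((barCons k A p).compr₂ φ a)
          ((barCons k A p).compr₂ ψ a)) x
      map_smul' := fun c φ => bar_ext fun a x => by
        rw [RingHom.id_apply, LinearMap.smul_apply, barLift_cons, barLift_cons]
        exact LinearMap.congr_fun (map_smul (cochainCup γ p) c
          ((barCons k A p).compr₂ φ a)) x }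

lemma cochainCup_zero {q : ℕ} (γ : Bar k A q →ₗ[k] N) (φ : Bar k A 0 →ₗ[k] M) (y : Bar k A q) :
    cochainCup μ γ 0 φ y = μ.toFun (φ (barZero k A 1)) (γ y) := rfl

lemma cochainCup_cons {p q : ℕ} (γ : Bar k A q →ₗ[k] N) (φ : Bar k A (p + 1) →ₗ[k] M) (a : A)
    (x : Bar k A (q + p)) :
    cochainCup μ γ (p + 1) φ (barCons k A (q + p) a x) =
      cochainCup μ γ p (φ ∘ₗ barCons k A p a) x := barLift_cons _ _ _

lemma cochainCup_right {p q : ℕ} (γ : Bar k A q →ₗ[k] N) (hγ : IsRightLinear γ)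
    (φ : Bar k A p →ₗ[k] M) : IsRightLinear (cochainCup μ γ p φ) := by
  induction p with
  | zero =>
    intro x a
    have h := cochainCup_zero μ γ φ (ract k x a)
    rw [hγ, μ.right] at h
    exact h
  | succ p ih =>
    intro x a
    induction x using bar_induction with
    | h0 => simp [ract]
    | h2 x y hx hy => rw [ract_add, map_add, hx, hy, map_add, ract_add]
    | h1 b x =>
      have h := ih (φ ∘ₗ barCons k A p b) x a
      rw [← cochainCup_cons, ← cochainCup_cons, ← bar_ract] at h
      exact h

/-- The Hochschild differential on cochains:
`(∂ φ) (a ⊗ x) = a φ(x) - φ (d (a ⊗ x))`. -/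
noncomputable def cochainD {p : ℕ} {M : Type*} [AddCommGroup M] [Module k M] [Module (Env k A) M]
    [IsScalarTower k (Env k A) M] (φ : Bar k A p →ₗ[k] M) : Bar k A (p + 1) →ₗ[k] M :=
  extendLeft φ - φ ∘ₗ barD k A p

lemma cochainD_cons {p : ℕ} {M : Type*} [AddCommGroup M] [Module k M] [Module (Env k A) M]
    [IsScalarTower k (Env k A) M] (φ : Bar k A p →ₗ[k] M) (a : A) (x : Bar k A p) :
    cochainD φ (barCons k A p a x) = lact k a (φ x) - φ (barD k A p (barCons k A p a x)) := by
  simp [cochainD]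

lemma extendLeft_barD {p : ℕ} {M : Type*} [AddCommGroup M] [Module k M] [Module (Env k A) M]
    [IsScalarTower k (Env k A) M] (φ : Bar k A p →ₗ[k] M) (a : A) (x : Bar k A (p + 1)) :
    extendLeft φ (barD k A (p + 1) (barCons k A (p + 1) a x)) = lact k a (cochainD φ x) := by
  rw [barD_cons_succ, map_sub, extendLeft_lact, extendLeft_cons, ← lact_sub]; rfl

lemma cochainCup_lact {p q : ℕ} (γ : Bar k A q →ₗ[k] N) (φ : Bar k A p →ₗ[k] M) (a : A)
    (x : Bar k A (q + p)) :
    cochainCup μ γ p (lactₗ k A M a ∘ₗ φ) x = lact k a (cochainCup μ γ p φ x) := by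
  induction p with
  | zero => exact μ.left _ _ _
  | succ p ih =>
    induction x using bar_induction with
    | h0 => simp [lact]
    | h2 x y hx hy => rw [map_add, hx, hy, map_add, lact_add]
    | h1 b x =>
      have h := ih (φ ∘ₗ barCons k A p b) x
      rw [← cochainCup_cons, ← LinearMap.comp_assoc, ← cochainCup_cons] at h
      exact h

lemma cochainD_cup {p q : ℕ} (γ : Bar k A q →ₗ[k] N) (hγ : cochainD γ = 0)
    (φ : Bar k A p →ₗ[k] M) (hφ : IsRightLinear φ) :
    cochainD (cochainCup μ γ p φ) = cochainCup μ γ (p + 1) (cochainD φ) := by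
  induction p with
  | zero =>
    refine bar_ext fun a y => ?_
    refine (cochainD_cons (cochainCup μ γ 0 φ) a y).trans
      (Eq.trans ?_ (cochainCup_cons μ γ (cochainD φ) a y).symm)
    have h1 := LinearMap.congr_fun hγ (barCons k A q a y)
    rw [cochainD_cons, LinearMap.zero_apply, sub_eq_zero] at h1
    have h2 : cochainCup μ γ 0 φ (barD k A q (barCons k A q a y)) =
        μ.toFun (φ (barZero k A a)) (γ y) := by
      rw [cochainCup_zero, ← h1, ← μ.mid, ← hφ, barZero_ract, one_mul]
    have h3 : cochainCup μ γ 0 (cochainD φ ∘ₗ barCons k A 0 a) y =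
        lact k a (μ.toFun (φ (barZero k A 1)) (γ y)) - μ.toFun (φ (barZero k A a)) (γ y) := by
      rw [cochainCup_zero, LinearMap.comp_apply, cochainD_cons, barD_cons_zero, barZero_lact,
        mul_one, map_sub, AddMonoidHom.sub_apply, μ.left]
    rw [h3, ← h2]; rfl
  | succ p ih =>
    refine bar_ext fun a z => ?_
    induction z using bar_induction with
    | h0 => simp
    | h2 x y hx hy => rw [map_add, map_add, hx, hy, map_add]
    | h1 b x =>
      have hr : IsRightLinear (φ ∘ₗ barCons k A p a) := fun x c => by
        rw [LinearMap.comp_apply, ← bar_ract, hφ]; rfl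
      have h := LinearMap.congr_fun (ih (φ ∘ₗ barCons k A p a) hr)
        (barCons k A (q + p) b x)
      rw [cochainD_cons, cochainCup_cons] at h
      have key : (cochainD φ ∘ₗ barCons k A (p + 1) a) ∘ₗ barCons k A p b =
          lactₗ k A M a ∘ₗ (φ ∘ₗ barCons k A p b) - φ ∘ₗ barCons k A p (a * b) +
            lactₗ k A M b ∘ₗ (φ ∘ₗ barCons k A p a) -
              cochainD (φ ∘ₗ barCons k A p a) ∘ₗ barCons k A p b := by
        ext y
        simp only [LinearMap.comp_apply, LinearMap.sub_apply, LinearMap.add_apply, cochainD_cons,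
          barD_cons_succ, lactₗ_apply, bar_lact, map_sub]
        abel
      have e1 : cochainCup μ γ (p + 1 + 1) (cochainD φ)
          (barCons k A (q + (p + 1)) a (barCons k A (q + p) b x)) =
          cochainCup μ γ p ((cochainD φ ∘ₗ barCons k A (p + 1) a) ∘ₗ barCons k A p b) x := by
        rw [cochainCup_cons]; exact cochainCup_cons _ _ _ _ _
      have e2 : cochainD (cochainCup μ γ (p + 1) φ)
          (barCons k A (q + (p + 1)) a (barCons k A (q + p) b x)) =
          lact k a (cochainCup μ γ p (φ ∘ₗ barCons k A p b) x) -
            (cochainCup μ γ p (φ ∘ₗ barCons k A p (a * b)) x -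
              cochainCup μ γ p (φ ∘ₗ barCons k A p a)
                (barD k A (q + p) (barCons k A (q + p) b x))) := by
        refine (cochainD_cons (cochainCup μ γ (p + 1) φ) a (barCons k A (q + p) b x)).trans ?_
        have := barD_cons_succ a (barCons k A (q + p) b x)
        rw [bar_lact] at this
        refine congrArg₂ _ (congrArg _ (cochainCup_cons _ _ _ _ _)) ?_
        refine (congrArg (cochainCup μ γ (p + 1) φ) this).trans ?_
        rw [map_sub]
        exact congrArg₂ _ (cochainCup_cons _ _ _ _ _) (cochainCup_cons _ _ _ _ _)
      refine e2.trans (Eq.trans ?_ e1.symm)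
      rw [key]
      simp only [map_sub, map_add, LinearMap.sub_apply, LinearMap.add_apply, cochainCup_lact]
      rw [← h]
      abel

/-- The cup product of `f : Bar (p + 1) → M` and `g : Bar (q + 1) → N`:
`(f ⌣ g) (a₀ ⊗ ⋯ ⊗ a_{p+q+1}) = f (a₀ ⊗ ⋯ ⊗ a_p ⊗ 1) g (1 ⊗ a_{p+1} ⊗ ⋯ ⊗ a_{p+q+1})`. -/
noncomputable def cupHom {p q : ℕ} (f : barMod k A (p + 1) ⟶ M) (g : barMod k A (q + 1) ⟶ N) :
    barMod k A (q + p + 1) ⟶ L :=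
  ModuleCat.ofHom (extendHom (cochainCup μ (restrictOne g.hom) p (restrictOne f.hom))
    (cochainCup_right μ _ (restrictOne_right _) _))

lemma cochainD_restrictOne {p : ℕ} (f : barMod k A (p + 1) ⟶ M)
    (hf : (barComplex k A).d (p + 1) p ≫ f = 0) : cochainD (restrictOne f.hom) = 0 := by
  ext x
  have h := extendLeft_barD (restrictOne f.hom) (1 : A) x
  rw [lact_one, extendLeft_restrictOne] at h
  rw [← h]
  rw [barComplex_d] at hf
  exact ConcreteCategory.congr_hom hf (barCons k A (p + 1) 1 x)

lemma cupHom_cocycle {p q : ℕ} (f : barMod k A (p + 1) ⟶ M) (g : barMod k A (q + 1) ⟶ N)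
    (hf : (barComplex k A).d (p + 1) p ≫ f = 0) (hg : (barComplex k A).d (q + 1) q ≫ g = 0) :
    (barComplex k A).d (q + p + 1) (q + p) ≫ cupHom μ f g = 0 := by
  rw [barComplex_d]
  ext x
  change extendLeft (cochainCup μ (restrictOne g.hom) p (restrictOne f.hom))
    (barD k A (q + p + 1) x) = 0
  induction x using bar_induction with
  | h0 => simp
  | h2 x y hx hy => rw [map_add, map_add, hx, hy, add_zero]
  | h1 a x =>
    rw [extendLeft_barD, cochainD_cup μ _ (cochainD_restrictOne g hg) _ (restrictOne_right _),
      cochainD_restrictOne f hf, map_zero]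
    exact smul_zero _

end cup

/-! ### Hochschild cohomology -/

/-- Hochschild cohomology `H^n(A, M) = Ext^n_{A^e}(A, M)` of an `A`-bimodule `M`. -/
abbrev HH (k : Type v) (A : Type u) [Field k] [Ring A] [Algebra k A]
    (M : ModuleCat.{u} (Env k A)) (n : ℕ) : Type u :=
  Abelian.Ext.{u} (regular k A) M n

/-- The class in `H^n(A, M)` of a Hochschild cocycle `f : Bar (n + 1) → M`. -/
noncomputable def cocycleClass {M : ModuleCat.{u} (Env k A)} {n : ℕ} (f : barMod k A (n + 1) ⟶ M)
    (hf : (barComplex k A).d (n + 1) n ≫ f = 0) : HH k A M n :=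
  (barResolution k A).extMk f (n + 1) rfl hf

lemma exists_cocycle {M : ModuleCat.{u} (Env k A)} {n : ℕ} (α : HH k A M n) :
    ∃ (f : barMod k A (n + 1) ⟶ M) (hf : (barComplex k A).d (n + 1) n ≫ f = 0),
      cocycleClass f hf = α :=
  (barResolution k A).extMk_surjective α (n + 1) rfl

/-- The cup product `H^p(A, M) × H^q(A, N) → H^{p+q}(A, L)` induced by a pairing
`M ⊗_A N → L`, computed on Hochschild cocycles. -/
noncomputable def cup {M N L : ModuleCat.{u} (Env k A)} (μ : Pairing k A M N L) {p q : ℕ}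
    (α : HH k A M p) (β : HH k A N q) : HH k A L (q + p) :=
  cocycleClass (cupHom μ (exists_cocycle α).choose (exists_cocycle β).choose)
    (cupHom_cocycle μ _ _ (exists_cocycle α).choose_spec.choose
      (exists_cocycle β).choose_spec.choose)

/-- The multiplication of `A` as a pairing on the regular bimodule. -/
noncomputable def mulPairing (k : Type v) (A : Type u) [Field k] [Ring A] [Algebra k A] :
    Pairing k A (regular k A) (regular k A) (regular k A) where
  toFun := (((AddMonoidHom.mul : A →+ A →+ A).compr₂ (regularEquiv k A).toAddMonoidHom).compl₂
    (regularEquiv k A).symm.toAddMonoidHom).comp (regularEquiv k A).symm.toAddMonoidHom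
  left a x y := by
    obtain ⟨x, rfl⟩ := (regularEquiv k A).surjective x
    obtain ⟨y, rfl⟩ := (regularEquiv k A).surjective y
    simp [regular_lact, mul_assoc]
  mid x a y := by
    obtain ⟨x, rfl⟩ := (regularEquiv k A).surjective x
    obtain ⟨y, rfl⟩ := (regularEquiv k A).surjective y
    simp [regular_lact, regular_ract, mul_assoc]
  right x y a := by
    obtain ⟨x, rfl⟩ := (regularEquiv k A).surjective x
    obtain ⟨y, rfl⟩ := (regularEquiv k A).surjective y
    simp [regular_ract, mul_assoc]

/-- A `B`-bimodule as an `A`-bimodule along `φ : A → B`. -/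
noncomputable abbrev resBimod (φ : A →ₐ[k] B) (M : ModuleCat.{u} (Env k B)) :
    ModuleCat.{u} (Env k A) := (ModuleCat.restrictScalars (envMap φ).toRingHom).obj M

lemma res_lact (φ : A →ₐ[k] B) (M : ModuleCat.{u} (Env k B)) (a : A) (m : M) :
    lact k a (M := resBimod φ M) m = lact k (φ a) m := by
  change envMap φ (a ⊗ₜ[k] (1 : Aᵐᵒᵖ)) • m = _
  rw [envMap, Algebra.TensorProduct.map_tmul, map_one]; rfl

lemma res_ract (φ : A →ₐ[k] B) (M : ModuleCat.{u} (Env k B)) (a : A) (m : M) :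
    ract k (M := resBimod φ M) m a = ract k m (φ a) := by
  change envMap φ ((1 : A) ⊗ₜ[k] op a) • m = _
  rw [envMap, Algebra.TensorProduct.map_tmul, map_one]; rfl

/-- A pairing of `B`-bimodules is a pairing of `A`-bimodules along `φ : A → B`. -/
noncomputable def Pairing.res (φ : A →ₐ[k] B) {M N L : ModuleCat.{u} (Env k B)}
    (μ : Pairing k B M N L) : Pairing k A (resBimod φ M) (resBimod φ N) (resBimod φ L) where
  toFun := μ.toFun
  left a m n := (congrArg (fun t => μ.toFun t n) (res_lact φ M a m)).trans
    ((μ.left _ _ _).trans (res_lact φ L a _).symm)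
  mid m a n := (congrArg (fun t => μ.toFun t n) (res_ract φ M a m)).trans
    ((μ.mid _ _ _).trans (congrArg (μ.toFun m) (res_lact φ N a n)).symm)
  right m n a := (congrArg (μ.toFun m) (res_ract φ N a n)).trans
    ((μ.right _ _ _).trans (res_ract φ L a _).symm)

/-- `φ : A → B` as a map of `A`-bimodules. -/
noncomputable def regularHom (φ : A →ₐ[k] B) : regular k A ⟶ resBimod φ (regular k B) :=
  ModuleCat.ofHom (X := regular k A) (Y := resBimod φ (regular k B))
    { toFun := fun a => regularEquiv k B (φ ((regularEquiv k A).symm a))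
      map_add' := fun x y => by rw [map_add, map_add, map_add]; rfl
      map_smul' := env_linear (M := regular k A) (N := resBimod φ (regular k B))
        (((regularEquiv k B).toAddMonoidHom.comp (φ : A →+ B)).comp
          (regularEquiv k A).symm.toAddMonoidHom)
        (fun a x => by
          obtain ⟨x, rfl⟩ := (regularEquiv k A).surjective x
          refine Eq.trans ?_ (res_lact φ (regular k B) a (regularEquiv k B (φ x))).symm
          rw [regular_lact, regular_lact, ← map_mul]; rfl)
        (fun x a => by
          obtain ⟨x, rfl⟩ := (regularEquiv k A).surjective x
          refine Eq.trans ?_ (res_ract φ (regular k B) a (regularEquiv k B (φ x))).symm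
          rw [regular_ract, regular_ract, ← map_mul]; rfl) }

end Hochschild
end HomEpi

/-!
Full faithfulness of `D^b(f^*)` is first turned into a condition on modules. By dévissage along
truncations it amounts to the bijectivity of restriction of scalars on all groups `Extⁿ` between
`S`-modules (`DerivedCategory.homBijective_of_bounded`), and this in turn to `IsExtAcyclicEpi f`:
every `R`-linear map between `S`-modules is `S`-linear, and `Extⁿ_R(S, Y) = 0` for all `n > 0` and
all `S`-modules `Y`. Vanishing on `S` gives vanishing on free modules, a presentation by a free
module then gives `Extⁿ_R(M, I) = 0` for every injective `S`-module `I`, and embedding the second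
variable into injective modules compares the two `Ext` groups by the five lemma
(`extComparison_bijective`). The result is `isHomologicalEpi_iff_isExtAcyclicEpi`.

An isomorphism `B ⊗_A B ≅ B` of bimodules makes the multiplication `B ⊗_A B → B` injective, whence
`b ⊗ 1 = 1 ⊗ b`; so `A`-linear maps between left or right `B`-modules are `B`-linear, and elements
of bimodules commuting with `A` commute with `B`. What remains of (a)–(c) is the relation of `Tor`
to `Ext`: `Tor_n^A(B, M)` vanishes if and only if `Extⁿ_A(M, Hom_ℤ(B, D))` does for all injective
groups `D` (`isZero_tor_iff`). The modules `Hom_ℤ(B, D)` are injective over `B` and every `B`-module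
embeds into one of them, which gives both directions.

For the enveloping algebra, acyclicity passes from `A → B` to `Aᵐᵒᵖ → Bᵐᵒᵖ` since `Tor` is balanced
(`IsExtAcyclicEpi.op`), to `A ⊗ C → B ⊗ C` by adjunction (`IsExtAcyclicEpi.tensor`), and to
compositions; `A^e → B^e` is the composition of `A ⊗ Aᵐᵒᵖ → B ⊗ Aᵐᵒᵖ → B ⊗ Bᵐᵒᵖ`. Conversely, an
element of `Extⁿ_A(B, N)` is a retract of its tensor product over `k` with the right `A`-module
`B`, which lies in a vanishing group of extensions of `B^e`-modules over `A^e`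
(`IsExtAcyclicEpi.of_envMap`).

For Hochschild cohomology, every `B`-bimodule embeds into an injective one of the form
`Hom_k(B, V)`, where `V` is an injective right `B`-module. Its cohomology over `A` is controlled by
the groups `Extⁿ` of right `A`-modules from `B` to `V`, and so it vanishes in positive degree; the
comparison map is therefore bijective in all degrees once it is so in degree zero
(`IsExtAcyclicEpi.hochschild_bijective`). On bar cocycles the comparison map is composition with
`φ ⊗ ⋯ ⊗ φ` (`extComparison_cocycleClass`), which commutes with the cup product of cocycles, and
the cup product of classes may be computed on arbitrary representing cocycles by the Leibniz rule
(`cup_cocycleClass`).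
-/

open Limits Abelian Pretriangulated

/-! ### Comparison maps on `Ext` induced by exact functors -/

namespace CategoryTheory

section ExtComparison

universe w w' v₁ v₂ u₁ u₂

variable {C : Type u₁} [Category.{v₁} C] [Abelian C] [HasExt.{w} C]
variable {D : Type u₂} [Category.{v₂} D] [Abelian D] [HasExt.{w'} D]
variable (G : C ⥤ D) [G.Additive] [PreservesFiniteLimits G] [PreservesFiniteColimits G]

/-- The map `Extⁿ(X', Y) → Extⁿ(X, G Y)` induced by an exact functor `G` and `u : X ⟶ G X'`. -/
noncomputable def extComparison {X : D} {X' : C} (u : X ⟶ G.obj X') (Y : C) (n : ℕ) :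
    Ext.{w} X' Y n →+ Ext.{w'} X (G.obj Y) n :=
  ((Ext.mk₀ u).precomp (G.obj Y) (zero_add n)).comp (G.mapExtAddHom X' Y n)

lemma extComparison_apply {X : D} {X' : C} (u : X ⟶ G.obj X') {Y : C} {n : ℕ}
    (x : Ext.{w} X' Y n) :
    extComparison G u Y n x = (Ext.mk₀ u).comp (x.mapExactFunctor G) (zero_add n) := rfl

lemma extComparison_comp {X : D} {X' : C} (u : X ⟶ G.obj X') {Y Z : C} {n m p : ℕ}
    (x : Ext.{w} X' Y n) (y : Ext.{w} Y Z m) (h : n + m = p) :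
    extComparison G u Z p (x.comp y h) =
      (extComparison G u Y n x).comp (y.mapExactFunctor G) h := by
  simp only [extComparison_apply, Ext.mapExactFunctor_comp]
  rw [Ext.comp_assoc _ _ _ _ _ (by lia)]

attribute [local simp] extComparison_comp Ext.mapExactFunctor_mk₀ Ext.mapExactFunctor_extClass

attribute [local instance] Ext.subsingleton_of_injective in
/-- The comparison map is bijective in all degrees as soon as it is so in degree zero and every
object embeds into an injective object `J` such that `G J` has no higher extensions by `X`. -/
theorem extComparison_bijective {X : D} {X' : C} (u : X ⟶ G.obj X')
    (hu : ∀ Y, Function.Bijective (fun h : X' ⟶ Y => u ≫ G.map h))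
    (hJ : ∀ Y : C, ∃ (J : C) (i : Y ⟶ J), Mono i ∧ Injective J ∧
      ∀ n, Subsingleton (Ext.{w'} X (G.obj J) (n + 1)))
    (Y : C) (n : ℕ) : Function.Bijective (extComparison.{w, w'} G u Y n) := by
  induction n generalizing Y with
  | zero =>
    have : (extComparison.{w, w'} G u Y 0 : Ext.{w} X' Y 0 → _) =
        Ext.homEquiv₀.symm ∘ (fun h => u ≫ G.map h) ∘ Ext.homEquiv₀ := by
      ext x
      obtain ⟨x, rfl⟩ := (Ext.mk₀_bijective X' Y).2 x
      simp [extComparison_apply, Ext.homEquiv₀]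
    rw [this]
    exact (Ext.homEquiv₀.symm.bijective.comp (hu Y)).comp Ext.homEquiv₀.bijective
  | succ n hn =>
    obtain ⟨J, i, hi, hJi, hsub⟩ := hJ Y
    let S := ShortComplex.mk _ _ (cokernel.condition i)
    have hS : S.ShortExact := { exact := ShortComplex.exact_cokernel i }
    have : Injective S.X₂ := hJi
    have h2 : Subsingleton (Ext.{w'} X (S.map G).X₂ (n + 1)) := hsub n
    -- the five lemma for the long exact sequences of `S` and `S.map G`
    exact AddMonoidHom.bijective_of_surjective_of_bijective_of_right_exact _ _ _ _
      (extComparison G u S.X₂ n) (extComparison G u S.X₃ n) (extComparison G u S.X₁ (n + 1))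
      (by cat_disch) (by cat_disch)
      ((ShortComplex.ab_exact_iff_function_exact _).mp
        (Ext.covariant_sequence_exact₃' X' hS n (n + 1) rfl))
      ((ShortComplex.ab_exact_iff_function_exact _).mp
        (Ext.covariant_sequence_exact₃' X (hS.map_of_exact G) n (n + 1) rfl))
      (hn _).surjective (hn _)
      (fun x₁ ↦ Ext.covariant_sequence_exact₁ _ hS x₁ (by subsingleton) rfl)
      (fun y₁ ↦ Ext.covariant_sequence_exact₁ _ (hS.map_of_exact G) y₁ (by subsingleton) rfl)

end ExtComparison

end CategoryTheory

/-! ### Full faithfulness on bounded objects of the derived category -/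

namespace CategoryTheory

section HomBijective

universe v₁ v₂ u₁ u₂

variable {T : Type u₁} [Category.{v₁} T] {T' : Type u₂} [Category.{v₂} T'] (F : T ⥤ T')

/-- The functor `F` is bijective on morphisms from `X` to `Y`. -/
def Functor.HomBijective (X Y : T) : Prop :=
  Function.Bijective (fun f : X ⟶ Y => F.map f)

namespace Functor.HomBijective

variable {F} {X X' Y Y' : T}

lemma inj (h : F.HomBijective X Y) {f g : X ⟶ Y} (hfg : F.map f = F.map g) : f = g := h.1 hfg

lemma surj (h : F.HomBijective X Y) (f : F.obj X ⟶ F.obj Y) : ∃ g, F.map g = f := h.2 f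

lemma of_iso (h : F.HomBijective X Y) (e : X ≅ X') (e' : Y ≅ Y') : F.HomBijective X' Y' := by
  refine ⟨fun f g hfg => ?_, fun f => ?_⟩
  · have : F.map (e.hom ≫ f ≫ e'.inv) = F.map (e.hom ≫ g ≫ e'.inv) := by
      simp only [F.map_comp]
      exact congrArg (fun t => F.map e.hom ≫ t ≫ F.map e'.inv) hfg
    simpa using h.inj this
  · obtain ⟨g, hg⟩ := h.surj (F.map e.hom ≫ f ≫ F.map e'.inv)
    refine ⟨e.inv ≫ g ≫ e'.hom, ?_⟩
    simp [hg, ← F.map_comp, ← F.map_comp_assoc]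

section shift

variable [HasShift T ℤ] [HasShift T' ℤ] [F.CommShift ℤ]

lemma shift (h : F.HomBijective X Y) (n : ℤ) : F.HomBijective (X⟦n⟧) (Y⟦n⟧) := by
  refine ⟨fun f g hfg => ?_, fun f => ?_⟩
  · obtain ⟨f, rfl⟩ := (shiftFunctor T n).map_surjective f
    obtain ⟨g, rfl⟩ := (shiftFunctor T n).map_surjective g
    congr 1
    refine h.inj ((shiftFunctor T' n).map_injective ?_)
    rw [← cancel_epi ((F.commShiftIso n).hom.app X)]
    exact ((F.commShiftIso n).hom.naturality f).symm.trans
      ((congrArg (· ≫ (F.commShiftIso n).hom.app Y) hfg).trans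
        ((F.commShiftIso n).hom.naturality g))
  · obtain ⟨g, hg⟩ := (shiftFunctor T' n).map_surjective
      ((F.commShiftIso n).inv.app X ≫ f ≫ (F.commShiftIso n).hom.app Y)
    obtain ⟨g, rfl⟩ := h.surj g
    refine ⟨g⟦n⟧', ?_⟩
    change F.map (g⟦n⟧') = f
    rw [← cancel_mono ((F.commShiftIso n).hom.app Y)]
    have := (F.commShiftIso n).hom.naturality g
    dsimp at this
    rw [this, hg]
    simp

end shift

variable [HasShift T ℤ] [HasShift T' ℤ] [Preadditive T] [Preadditive T']
  [HasZeroObject T] [HasZeroObject T'] [∀ n : ℤ, (shiftFunctor T n).Additive]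
  [∀ n : ℤ, (shiftFunctor T' n).Additive] [Pretriangulated T] [Pretriangulated T']
  [F.CommShift ℤ] [F.IsTriangulated] [F.Additive]

/-- A four-lemma argument in the target variable. -/
lemma triangle₂ {S : Triangle T} (hS : S ∈ distTriang T) (h₁ : F.HomBijective X S.obj₁)
    (h₃ : F.HomBijective X S.obj₃) (h₁' : F.HomBijective X (S.obj₁⟦(1 : ℤ)⟧))
    (h₃' : F.HomBijective X (S.obj₃⟦(-1 : ℤ)⟧)) : F.HomBijective X S.obj₂ := by
  refine ⟨(injective_iff_map_eq_zero (F.mapAddHom (X := X) (Y := S.obj₂))).2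
    fun f (hf : F.map f = 0) => ?_, fun f => ?_⟩
  · have h0 : f ≫ S.mor₂ = 0 := h₃.inj (by simp [hf])
    obtain ⟨g, rfl⟩ := S.coyoneda_exact₂ hS f h0
    have h1 := F.map_distinguished _ (inv_rot_of_distTriang _ hS)
    let δ : S.obj₃⟦(-1 : ℤ)⟧ ⟶ S.obj₁ := S.invRotate.mor₁
    have hδ : δ ≫ S.mor₁ = 0 := comp_distTriang_mor_zero₁₂ _ (inv_rot_of_distTriang _ hS)
    -- the map `g : X ⟶ S.obj₁` is only determined up to maps factoring through `δ`
    obtain ⟨k, hk⟩ : ∃ k : F.obj X ⟶ F.obj (S.obj₃⟦(-1 : ℤ)⟧), F.map g = k ≫ F.map δ :=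
      (F.mapTriangle.obj S.invRotate).coyoneda_exact₂ h1 (F.map g) ((F.map_comp _ _).symm.trans hf)
    obtain ⟨k, rfl⟩ := h₃'.surj k
    have : g = k ≫ δ := h₁.inj (by rw [hk, F.map_comp])
    rw [this, Category.assoc, hδ, comp_zero]
  · obtain ⟨g, hg⟩ := h₃.surj (f ≫ F.map S.mor₂)
    have h0 : g ≫ S.mor₃ = 0 := h₁'.inj (by
      have h := comp_distTriang_mor_zero₂₃ _ (F.map_distinguished _ hS)
      change F.map S.mor₂ ≫ F.map S.mor₃ ≫ (F.commShiftIso (1 : ℤ)).hom.app S.obj₁ = 0 at h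
      rw [F.map_zero, F.map_comp, hg, Category.assoc,
        ← cancel_mono ((F.commShiftIso (1 : ℤ)).hom.app S.obj₁), Category.assoc, Category.assoc, h,
        comp_zero, zero_comp])
    obtain ⟨g, rfl⟩ := S.coyoneda_exact₃ hS g h0
    obtain ⟨k, hk⟩ := (F.mapTriangle.obj S).coyoneda_exact₂ (F.map_distinguished _ hS)
      (f - F.map g) (by
        change (f - F.map g) ≫ F.map S.mor₂ = 0
        rw [Preadditive.sub_comp, ← hg, F.map_comp, sub_self])
    obtain ⟨k, rfl⟩ := h₁.surj k
    refine ⟨k ≫ S.mor₁ + g, ?_⟩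
    change F.map (k ≫ S.mor₁ + g) = f
    rw [F.map_add, F.map_comp]
    exact eq_add_of_sub_eq hk |>.symm

/-- A four-lemma argument in the source variable. -/
lemma triangle₂' {S : Triangle T} (hS : S ∈ distTriang T) (h₁ : F.HomBijective S.obj₁ Y)
    (h₃ : F.HomBijective S.obj₃ Y) (h₁' : F.HomBijective (S.obj₁⟦(1 : ℤ)⟧) Y)
    (h₃' : F.HomBijective (S.obj₃⟦(-1 : ℤ)⟧) Y) : F.HomBijective S.obj₂ Y := by
  refine ⟨(injective_iff_map_eq_zero (F.mapAddHom (X := S.obj₂) (Y := Y))).2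
    fun f (hf : F.map f = 0) => ?_, fun f => ?_⟩
  · have h0 : S.mor₁ ≫ f = 0 := h₁.inj (by simp [hf])
    obtain ⟨g, rfl⟩ := S.yoneda_exact₂ hS f h0
    have h1 := F.map_distinguished _ hS
    obtain ⟨k, hk⟩ := (F.mapTriangle.obj S).yoneda_exact₃ h1 (F.map g)
      ((F.map_comp _ _).symm.trans hf)
    obtain ⟨k, hk'⟩ := h₁'.surj ((F.commShiftIso (1 : ℤ)).hom.app S.obj₁ ≫ k)
    have : g = S.mor₃ ≫ k := h₃.inj (by
      rw [hk, F.map_comp, hk']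
      exact Category.assoc _ _ _)
    rw [this, ← Category.assoc, comp_distTriang_mor_zero₂₃ _ hS, zero_comp]
  · obtain ⟨g, hg⟩ := h₁.surj (F.map S.mor₁ ≫ f)
    let δ : S.obj₃⟦(-1 : ℤ)⟧ ⟶ S.obj₁ := S.invRotate.mor₁
    have h0 : δ ≫ g = 0 := h₃'.inj (by
      have h : F.map δ ≫ F.map S.mor₁ = 0 :=
        comp_distTriang_mor_zero₁₂ _ (F.map_distinguished _ (inv_rot_of_distTriang _ hS))
      rw [F.map_zero, F.map_comp, hg, ← Category.assoc, h, zero_comp])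
    obtain ⟨g, rfl⟩ : ∃ k : S.obj₂ ⟶ Y, g = S.mor₁ ≫ k :=
      S.invRotate.yoneda_exact₂ (inv_rot_of_distTriang _ hS) g h0
    obtain ⟨k, hk⟩ := (F.mapTriangle.obj S).yoneda_exact₂ (F.map_distinguished _ hS)
      (f - F.map g) (by
        change F.map S.mor₁ ≫ (f - F.map g) = 0
        rw [Preadditive.comp_sub, ← hg, F.map_comp]
        exact sub_self _)
    obtain ⟨k, rfl⟩ := h₃.surj k
    refine ⟨S.mor₂ ≫ k + g, ?_⟩
    change F.map (S.mor₂ ≫ k + g) = f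
    rw [F.map_add, F.map_comp]
    exact eq_add_of_sub_eq hk |>.symm

end Functor.HomBijective

end HomBijective

end CategoryTheory

namespace DerivedCategory

open CategoryTheory

universe w v₁ u₁

variable {C : Type u₁} [Category.{v₁} C] [Abelian C] [HasDerivedCategory.{w} C]

/-- A class of objects of the derived category which is closed under extensions and contains all
single complexes contains all bounded objects. -/
lemma prop_of_bounded (P : ObjectProperty (DerivedCategory C)) [P.IsClosedUnderIsomorphisms]
    (h₂ : ∀ S ∈ distTriang (DerivedCategory C), P S.obj₁ → P S.obj₃ → P S.obj₂)
    (h : ∀ (n : ℤ) (M : C), P ((singleFunctor C n).obj M)) (X : DerivedCategory C)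
    (hX : (TStructure.t (C := C)).bounded X) : P X := by
  obtain ⟨⟨a, ha⟩, ⟨b, hb⟩⟩ := hX
  obtain ⟨k, hk⟩ : ∃ k : ℕ, b ≤ a + k := ⟨(b - a).toNat, by lia⟩
  replace hb : TStructure.t.IsLE X (a + k) := TStructure.t.isLE_of_le X b _ hk
  clear hk
  -- induction on the amplitude `k`, cutting off the lowest cohomology object
  induction k generalizing a X with
  | zero =>
    have : X.IsGE a := ha
    have : X.IsLE a := by simpa using hb
    obtain ⟨Y, ⟨e⟩⟩ := exists_iso_singleFunctor_obj_of_isGE_of_isLE X a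
    exact P.prop_of_iso e.symm (h a Y)
  | succ k hk =>
    refine h₂ _ (TStructure.t.triangleLTGE_distinguished (a + 1) X) ?_ ?_
    · have h1 : ((TStructure.t.truncLT (a + 1)).obj X).IsGE a :=
        inferInstanceAs (TStructure.t.IsGE ((TStructure.t.truncLT (a + 1)).obj X) a)
      have h2 : ((TStructure.t.truncLT (a + 1)).obj X).IsLE a := by
        have : TStructure.t.IsLE ((TStructure.t.truncLT (a + 1)).obj X) (a + 1 - 1) := inferInstance
        simpa using this
      obtain ⟨Y, ⟨e⟩⟩ := exists_iso_singleFunctor_obj_of_isGE_of_isLE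
        ((TStructure.t.truncLT (a + 1)).obj X) a
      exact P.prop_of_iso e.symm (h a Y)
    · refine hk _ (a + 1) (inferInstanceAs
        (TStructure.t.IsGE ((TStructure.t.truncGE (a + 1)).obj X) (a + 1))) ?_
      have : TStructure.t.IsLE X (a + 1 + k) := by
        convert hb using 1; push_cast; ring
      exact inferInstanceAs (TStructure.t.IsLE ((TStructure.t.truncGE (a + 1)).obj X) (a + 1 + k))

section Exact

universe w' w₁ w₂ v₂ u₂

variable {D : Type u₂} [Category.{v₂} D] [Abelian D] [HasDerivedCategory.{w'} D]
variable (F : C ⥤ D) [F.Additive] [PreservesFiniteLimits F] [PreservesFiniteColimits F]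

/-- Bijectivity on `Extⁿ` is bijectivity on morphisms between shifted single complexes. -/
lemma homBijective_single_iff [HasExt.{w₁} C] [HasExt.{w₂} D] (M N : C) (n : ℕ) :
    F.mapDerivedCategory.HomBijective ((singleFunctor C 0).obj M)
        (((singleFunctor C 0).obj N)⟦(n : ℤ)⟧) ↔
      Function.Bijective (Ext.mapExactFunctor F : Ext.{w₁} M N n → Ext.{w₂} _ _ n) := by
  let α := (F.mapDerivedCategorySingleFunctor 0).app M
  let β := ((F.mapDerivedCategory.commShiftIso (n : ℤ)).app ((singleFunctor C 0).obj N)) ≪≫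
    (shiftFunctor (DerivedCategory D) (n : ℤ)).mapIso ((F.mapDerivedCategorySingleFunctor 0).app N)
  have h : (Ext.homEquiv ∘ (Ext.mapExactFunctor F : Ext.{w₁} M N n → Ext.{w₂} _ _ n)) =
      (α.homCongr β) ∘ (fun f => F.mapDerivedCategory.map f) ∘ Ext.homEquiv := by
    ext e
    refine (Ext.mapExactFunctor_hom F e).trans ?_
    simp [ShiftedHom.map, α, β]
  rw [Functor.HomBijective, ← Function.Bijective.of_comp_iff _ Ext.homEquiv.bijective,
    ← Function.Bijective.of_comp_iff' (α.homCongr β).bijective, ← h,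
    Function.Bijective.of_comp_iff' Ext.homEquiv.bijective]

/-- Negative extensions between objects of the abelian category vanish. -/
lemma subsingleton_hom_single_shift (M N : C) (j : ℤ) (hj : j < 0) :
    Subsingleton ((singleFunctor C 0).obj M ⟶ ((singleFunctor C 0).obj N)⟦j⟧) := by
  have : TStructure.t.IsGE (((singleFunctor C 0).obj N)⟦j⟧) (-j) :=
    TStructure.t.isGE_shift _ 0 j (-j)
  exact ⟨fun f g => (TStructure.t.zero f 0 (-j)).trans (TStructure.t.zero g 0 (-j)).symm⟩

/-- An exact functor which is bijective on all extension groups is bijective on morphisms between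
bounded objects of the derived category. -/
theorem homBijective_of_bounded [HasExt.{w₁} C] [HasExt.{w₂} D]
    (h : ∀ (M N : C) (n : ℕ),
      Function.Bijective (Ext.mapExactFunctor F : Ext.{w₁} M N n → Ext.{w₂} _ _ n))
    (X Y : DerivedCategory C) (hX : (TStructure.t (C := C)).bounded X)
    (hY : (TStructure.t (C := C)).bounded Y) : F.mapDerivedCategory.HomBijective X Y := by
  have h0 (M N : C) (j : ℤ) : F.mapDerivedCategory.HomBijective ((singleFunctor C 0).obj M)
      (((singleFunctor C 0).obj N)⟦j⟧) := by
    obtain ⟨n, rfl⟩ | hj := (le_or_gt 0 j).imp_left Int.eq_ofNat_of_zero_le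
    · exact (homBijective_single_iff F M N n).2 (h M N n)
    · have h1 := subsingleton_hom_single_shift M N j hj
      have h2 := subsingleton_hom_single_shift (F.obj M) (F.obj N) j hj
      have e := ((F.mapDerivedCategorySingleFunctor 0).app M).homCongr
        (((F.mapDerivedCategory.commShiftIso j).app ((singleFunctor C 0).obj N)) ≪≫
          (shiftFunctor (DerivedCategory D) j).mapIso
            ((F.mapDerivedCategorySingleFunctor 0).app N))
      have h3 := e.subsingleton_congr.2 h2
      exact ⟨fun _ _ _ => Subsingleton.elim _ _, fun f => ⟨0, h3.elim _ _⟩⟩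
  have h1 (M N : C) (a b : ℤ) : F.mapDerivedCategory.HomBijective ((singleFunctor C a).obj M)
      ((singleFunctor C b).obj N) :=
    ((h0 M N (a - b)).shift (-a)).of_iso
      (((singleFunctors C).shiftIso (-a) a 0 (by lia)).app M)
      ((shiftFunctorAdd' (DerivedCategory C) (a - b) (-a) (-b) (by lia)).symm.app _ ≪≫
        ((singleFunctors C).shiftIso (-b) b 0 (by lia)).app N)
  have hs (N : C) (b i : ℤ) : ((singleFunctor C (b - i)).obj N) ≅ ((singleFunctor C b).obj N)⟦i⟧ :=
    (((singleFunctors C).shiftIso i (b - i) b (by lia)).app N).symm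
  -- first the target is allowed to be any bounded object, then also the source
  have h2 (M : C) (a : ℤ) (Y : DerivedCategory C) (hY : (TStructure.t (C := C)).bounded Y) :
      ∀ i : ℤ, F.mapDerivedCategory.HomBijective ((singleFunctor C a).obj M) (Y⟦i⟧) := by
    let P : ObjectProperty (DerivedCategory C) := fun Y =>
      ∀ i : ℤ, F.mapDerivedCategory.HomBijective ((singleFunctor C a).obj M) (Y⟦i⟧)
    have : P.IsClosedUnderIsomorphisms :=
      ⟨fun e hY i => (hY i).of_iso (Iso.refl _) ((shiftFunctor _ i).mapIso e)⟩
    refine prop_of_bounded P (fun S hS h₁ h₃ i => ?_) (fun n N i => ?_) Y hY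
    · exact Functor.HomBijective.triangle₂ (Triangle.shift_distinguished _ hS i) (h₁ i) (h₃ i)
        ((h₁ (i + 1)).of_iso (Iso.refl _) ((shiftFunctorAdd _ i 1).app _))
        ((h₃ (i + -1)).of_iso (Iso.refl _) ((shiftFunctorAdd _ i (-1)).app _))
    · exact (h1 M N a (n - i)).of_iso (Iso.refl _) (hs N n i)
  have h3 (Y : DerivedCategory C) (hY : (TStructure.t (C := C)).bounded Y)
      (X : DerivedCategory C) (hX : (TStructure.t (C := C)).bounded X) :
      ∀ i : ℤ, F.mapDerivedCategory.HomBijective (X⟦i⟧) Y := by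
    let P : ObjectProperty (DerivedCategory C) := fun X =>
      ∀ i : ℤ, F.mapDerivedCategory.HomBijective (X⟦i⟧) Y
    have : P.IsClosedUnderIsomorphisms :=
      ⟨fun e hY i => (hY i).of_iso ((shiftFunctor _ i).mapIso e) (Iso.refl _)⟩
    refine prop_of_bounded P (fun S hS h₁ h₃ i => ?_) (fun n N i => ?_) X hX
    · exact Functor.HomBijective.triangle₂' (Triangle.shift_distinguished _ hS i) (h₁ i) (h₃ i)
        ((h₁ (i + 1)).of_iso ((shiftFunctorAdd _ i 1).app _) (Iso.refl _))
        ((h₃ (i + -1)).of_iso ((shiftFunctorAdd _ i (-1)).app _) (Iso.refl _))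
    · exact (h2 N (n - i) Y hY 0).of_iso (hs N n i) ((shiftFunctorZero _ ℤ).app Y)
  exact (h3 Y hY X hX 0).of_iso ((shiftFunctorZero _ ℤ).app X) (Iso.refl _)

end Exact

end DerivedCategory

/-! ### Vanishing of `Ext` -/

namespace CategoryTheory

section Ext

universe w v₁ u₁

variable {C : Type u₁} [Category.{v₁} C] [Abelian C] [HasExt.{w} C]

lemma subsingleton_ext_of_iso {X X' Y Y' : C} {n : ℕ} (e : X ≅ X') (e' : Y ≅ Y')
    (h : Subsingleton (Ext.{w} X Y n)) : Subsingleton (Ext.{w} X' Y' n) := by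
  refine subsingleton_of_forall_eq 0 fun x => ?_
  have h0 : ((Ext.mk₀ e.hom).comp x (zero_add n)).comp (Ext.mk₀ e'.inv) (add_zero n) = 0 :=
    Subsingleton.elim _ _
  have h1 := congrArg (fun t => t.comp (Ext.mk₀ e'.hom) (add_zero n)) h0
  rw [Ext.comp_assoc_of_third_deg_zero, Ext.mk₀_comp_mk₀, e'.inv_hom_id, Ext.comp_mk₀_id,
    Ext.zero_comp] at h1
  have h2 := congrArg (fun t => (Ext.mk₀ e.inv).comp t (zero_add n)) h1
  rwa [Ext.mk₀_comp_mk₀_assoc, e.inv_hom_id, Ext.mk₀_id_comp, Ext.comp_zero] at h2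

namespace ShortComplex.ShortExact

variable {S : ShortComplex C}

lemma subsingleton_ext_X₃ (hS : S.ShortExact) {Y : C} {n : ℕ}
    (h₁ : Subsingleton (Ext.{w} S.X₁ Y (n + 1)))
    (h₂ : Subsingleton (Ext.{w} S.X₂ Y (n + 2))) : Subsingleton (Ext.{w} S.X₃ Y (n + 2)) := by
  refine subsingleton_of_forall_eq 0 fun x => ?_
  obtain ⟨z, rfl⟩ := Ext.contravariant_sequence_exact₃ hS _ x (h₂.elim _ _) (add_comm 1 (n + 1))
  rw [h₁.elim z 0, Ext.comp_zero]

lemma subsingleton_ext_one_X₃ (hS : S.ShortExact) {Y : C}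
    (h₁ : ∀ g : S.X₁ ⟶ Y, ∃ k : S.X₂ ⟶ Y, S.f ≫ k = g)
    (h₂ : Subsingleton (Ext.{w} S.X₂ Y 1)) : Subsingleton (Ext.{w} S.X₃ Y 1) := by
  refine subsingleton_of_forall_eq 0 fun x => ?_
  obtain ⟨z, rfl⟩ := Ext.contravariant_sequence_exact₃ hS _ x (h₂.elim _ _) (add_zero 1)
  obtain ⟨z, rfl⟩ := (Ext.mk₀_bijective _ _).2 z
  obtain ⟨k, rfl⟩ := h₁ z
  rw [← Ext.mk₀_comp_mk₀]
  exact hS.extClass_comp_assoc _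

lemma subsingleton_ext_X₁ (hS : S.ShortExact) {X : C} {n : ℕ}
    (h₃ : Subsingleton (Ext.{w} X S.X₃ (n + 1)))
    (h₂ : Subsingleton (Ext.{w} X S.X₂ (n + 2))) : Subsingleton (Ext.{w} X S.X₁ (n + 2)) := by
  refine subsingleton_of_forall_eq 0 fun x => ?_
  obtain ⟨z, rfl⟩ := Ext.covariant_sequence_exact₁ _ hS x (h₂.elim _ _) rfl
  rw [h₃.elim z 0, Ext.zero_comp]

lemma subsingleton_ext_one_X₁ (hS : S.ShortExact) {X : C}
    (h₃ : ∀ g : X ⟶ S.X₃, ∃ k : X ⟶ S.X₂, k ≫ S.g = g)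
    (h₂ : Subsingleton (Ext.{w} X S.X₂ 1)) : Subsingleton (Ext.{w} X S.X₁ 1) := by
  refine subsingleton_of_forall_eq 0 fun x => ?_
  obtain ⟨z, rfl⟩ := Ext.covariant_sequence_exact₁ _ hS x (h₂.elim _ _) (zero_add 1)
  obtain ⟨z, rfl⟩ := (Ext.mk₀_bijective _ _).2 z
  obtain ⟨k, rfl⟩ := h₃ z
  rw [← Ext.mk₀_comp_mk₀, Ext.comp_assoc_of_second_deg_zero, hS.comp_extClass, Ext.comp_zero]

lemma subsingleton_ext_X₃' (hS : S.ShortExact) {X : C} {n : ℕ}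
    (h₁ : Subsingleton (Ext.{w} X S.X₁ (n + 2)))
    (h₂ : Subsingleton (Ext.{w} X S.X₂ (n + 1))) : Subsingleton (Ext.{w} X S.X₃ (n + 1)) := by
  refine subsingleton_of_forall_eq 0 fun x => ?_
  obtain ⟨z, rfl⟩ := Ext.covariant_sequence_exact₃ _ hS x (n₁ := n + 2) rfl (h₁.elim _ _)
  rw [h₂.elim z 0, Ext.zero_comp]

lemma subsingleton_ext_X₁' (hS : S.ShortExact) {Y : C} {n : ℕ}
    (h₃ : Subsingleton (Ext.{w} S.X₃ Y (n + 2)))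
    (h₂ : Subsingleton (Ext.{w} S.X₂ Y (n + 1))) : Subsingleton (Ext.{w} S.X₁ Y (n + 1)) := by
  refine subsingleton_of_forall_eq 0 fun x => ?_
  obtain ⟨z, rfl⟩ := Ext.contravariant_sequence_exact₁ hS _ x (n₁ := n + 2) (by lia) (h₃.elim _ _)
  rw [h₂.elim z 0, Ext.comp_zero]

lemma exists_lift_of_subsingleton_ext (hS : S.ShortExact) {X : C}
    (h₁ : Subsingleton (Ext.{w} X S.X₁ 1)) (g : X ⟶ S.X₃) : ∃ k : X ⟶ S.X₂, k ≫ S.g = g := by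
  obtain ⟨l, hl⟩ := Ext.covariant_sequence_exact₃ _ hS (Ext.mk₀ g) (zero_add 1) (h₁.elim _ _)
  obtain ⟨l, rfl⟩ := (Ext.mk₀_bijective _ _).2 l
  exact ⟨l, (Ext.mk₀_bijective _ _).1 (by simpa using hl)⟩

lemma exists_desc_of_subsingleton_ext (hS : S.ShortExact) {Y : C}
    (h₃ : Subsingleton (Ext.{w} S.X₃ Y 1)) (g : S.X₁ ⟶ Y) : ∃ k : S.X₂ ⟶ Y, S.f ≫ k = g := by
  obtain ⟨l, hl⟩ := Ext.contravariant_sequence_exact₁ hS _ (Ext.mk₀ g) (add_zero 1) (h₃.elim _ _)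
  obtain ⟨l, rfl⟩ := (Ext.mk₀_bijective _ _).2 l
  exact ⟨l, (Ext.mk₀_bijective _ _).1 (by simpa using hl)⟩

end ShortComplex.ShortExact

attribute [local instance] Ext.subsingleton_of_injective in
/-- Vanishing of `Ext` groups in positive degree passes to coproducts in the first variable. -/
lemma subsingleton_ext_of_isColimit_cofan [EnoughInjectives C] {ι : Type*} {X : ι → C}
    (c : Cofan X) (hc : IsColimit c) (Y : C) (n : ℕ)
    (h : ∀ i, Subsingleton (Ext.{w} (X i) Y (n + 1))) : Subsingleton (Ext.{w} c.pt Y (n + 1)) := by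
  let I : InjectivePresentation Y := Classical.arbitrary _
  let S := ShortComplex.mk _ _ (cokernel.condition I.f)
  have : Injective S.X₂ := I.injective
  have hS : S.ShortExact := { exact := ShortComplex.exact_cokernel I.f }
  induction n generalizing Y with
  | zero =>
    refine hS.subsingleton_ext_one_X₁ (fun g => ?_) inferInstance
    choose l hl using fun i => hS.exists_lift_of_subsingleton_ext (h i) (c.inj i ≫ g)
    exact ⟨Cofan.IsColimit.desc hc l, Cofan.IsColimit.hom_ext hc _ _ fun i => by
      rw [Cofan.IsColimit.fac_assoc, hl]⟩
  | succ n hn =>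
    let I' : InjectivePresentation S.X₃ := Classical.arbitrary _
    exact hS.subsingleton_ext_X₁ (hn S.X₃ (fun i => hS.subsingleton_ext_X₃' (h i) inferInstance)
      I'.injective { exact := ShortComplex.exact_cokernel _ }) inferInstance

end Ext

end CategoryTheory

/-! ### Homological epimorphisms and acyclicity -/

namespace HomEpi

variable {R S T : Type u} [Ring R] [Ring S] [Ring T]

/-- A ring morphism `f : R → S` is an `Ext`-acyclic epimorphism if every `R`-linear map between
`S`-modules is `S`-linear and `Extⁿ_R(S, Y) = 0` for all `n > 0` and all `S`-modules `Y`. -/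
structure IsExtAcyclicEpi (f : R →+* S) : Prop where
  /-- `R`-linear maps between `S`-modules are `S`-linear. -/
  full : (ModuleCat.restrictScalars.{u} f).Full
  /-- `Extⁿ_R(S, Y) = 0` for `n > 0`. -/
  subsingleton_ext : ∀ (Y : ModuleCat.{u} S) (n : ℕ),
    Subsingleton (Ext.{u} ((ModuleCat.restrictScalars.{u} f).obj (ModuleCat.of S S))
      ((ModuleCat.restrictScalars.{u} f).obj Y) (n + 1))

namespace IsExtAcyclicEpi

variable {f : R →+* S}

/-- `Extⁿ_R(F, Y) = 0` for a free `S`-module `F`. -/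
lemma subsingleton_ext_sigma (h : IsExtAcyclicEpi f) (ι : Type u) (Y : ModuleCat.{u} S) (n : ℕ) :
    Subsingleton (Ext.{u} ((ModuleCat.restrictScalars.{u} f).obj (∐ fun _ : ι => ModuleCat.of S S))
      ((ModuleCat.restrictScalars.{u} f).obj Y) (n + 1)) := by
  let X : ι → ModuleCat.{u} S := fun _ => ModuleCat.of S S
  have : PreservesColimitsOfSize.{u, u} (ModuleCat.restrictScalars.{u} f) :=
    (ModuleCat.restrictCoextendScalarsAdj.{u} f).leftAdjoint_preservesColimits
  exact subsingleton_ext_of_isColimit_cofan _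
    (isColimitCofanMkObjOfIsColimit (ModuleCat.restrictScalars.{u} f) X _ (coproductIsCoproduct X))
    _ n fun _ => h.subsingleton_ext Y n

/-- Injective `S`-modules are acyclic for `Hom_R(M, -)`, for every `S`-module `M`. -/
lemma subsingleton_ext_injective (h : IsExtAcyclicEpi f) (M I : ModuleCat.{u} S) [Injective I]
    (n : ℕ) : Subsingleton (Ext.{u} ((ModuleCat.restrictScalars.{u} f).obj M)
      ((ModuleCat.restrictScalars.{u} f).obj I) (n + 1)) := by
  have := h.full
  -- a presentation of `M` by a free module
  let p : (∐ fun _ : M => ModuleCat.of S S) ⟶ M :=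
    Sigma.desc fun m => ModuleCat.ofHom (LinearMap.toSpanSingleton S M m)
  have hp : Epi p := by
    rw [ModuleCat.epi_iff_surjective]
    intro m
    refine ⟨Sigma.ι (fun _ : M => ModuleCat.of S S) m (1 : S), ?_⟩
    change (Sigma.ι (fun _ : M => ModuleCat.of S S) m ≫ p) (1 : S) = m
    rw [Sigma.ι_desc]
    exact one_smul S m
  let K := ShortComplex.mk _ _ (kernel.condition p)
  have hK : K.ShortExact := { exact := ShortComplex.exact_kernel p }
  have hK' := hK.map_of_exact (ModuleCat.restrictScalars.{u} f)
  have h1 := h.subsingleton_ext_sigma M I n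
  cases n with
  | zero =>
    -- an `R`-linear map from the kernel to `I` is `S`-linear and hence extends
    refine hK'.subsingleton_ext_one_X₃ (fun g => ?_) h1
    obtain ⟨z, rfl⟩ := (ModuleCat.restrictScalars.{u} f).map_surjective (X := K.X₁) (Y := I) g
    exact ⟨(ModuleCat.restrictScalars.{u} f).map (Injective.factorThru z K.f),
      (Functor.map_comp _ _ _).symm.trans
        (congrArg (ModuleCat.restrictScalars.{u} f).map (Injective.comp_factorThru z K.f))⟩
  | succ n => exact hK'.subsingleton_ext_X₃ (h.subsingleton_ext_injective K.X₁ I n) h1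

/-- For an acyclic epimorphism, `Extⁿ_S(M, N) → Extⁿ_R(M, N)` is bijective: injective `S`-modules
remain acyclic over `R`. -/
lemma mapExactFunctor_bijective (h : IsExtAcyclicEpi f) (M N : ModuleCat.{u} S) (n : ℕ) :
    Function.Bijective (Ext.mapExactFunctor (ModuleCat.restrictScalars.{u} f) :
      Ext.{u} M N n → Ext.{u} _ _ n) := by
  have := h.full
  have h1 := extComparison_bijective.{u, u} (ModuleCat.restrictScalars.{u} f)
    (𝟙 ((ModuleCat.restrictScalars.{u} f).obj M))
    (fun Y => by
      simp only [Category.id_comp]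
      exact (Functor.FullyFaithful.ofFullyFaithful (ModuleCat.restrictScalars.{u} f)).map_bijective
        M Y)
    (fun Y => ⟨Injective.under Y, Injective.ι Y, inferInstance, inferInstance,
      fun n => h.subsingleton_ext_injective M _ n⟩) N n
  convert h1 using 1
  ext x
  exact (Ext.mk₀_id_comp _).symm

/-- Conversely, bijectivity of `Extⁿ_S(M, N) → Extⁿ_R(M, N)` for `n = 0` gives fullness, and for
`M = S` it gives vanishing since `S` is projective over itself. -/
lemma of_mapExactFunctor_bijective
    (h : ∀ (M N : ModuleCat.{u} S) (n : ℕ),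
      Function.Bijective (Ext.mapExactFunctor (ModuleCat.restrictScalars.{u} f) :
        Ext.{u} M N n → Ext.{u} _ _ n)) : IsExtAcyclicEpi f where
  full := ⟨fun {M N} g => by
    obtain ⟨x, hx⟩ := (h M N 0).2 (Ext.mk₀ g)
    obtain ⟨x, rfl⟩ := (Ext.mk₀_bijective _ _).2 x
    rw [Ext.mapExactFunctor_mk₀] at hx
    exact ⟨x, (Ext.mk₀_bijective _ _).1 hx⟩⟩
  subsingleton_ext Y n := by
    have : Projective (ModuleCat.of S S) :=
      ModuleCat.projective_of_free (Module.Basis.singleton PUnit.{1} S)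
    have := Ext.subsingleton_of_projective.{u} (ModuleCat.of S S) Y n
    exact (h (ModuleCat.of S S) Y (n + 1)).2.subsingleton

lemma comp {g : S →+* T} (hf : IsExtAcyclicEpi f) (hg : IsExtAcyclicEpi g) :
    IsExtAcyclicEpi (g.comp f) where
  full := by
    have := hf.full
    have := hg.full
    exact Functor.Full.of_iso (ModuleCat.restrictScalarsComp.{u} f g).symm
  subsingleton_ext Y n := by
    let e := ModuleCat.restrictScalarsComp.{u} f g
    have := hg.subsingleton_ext Y n
    exact subsingleton_ext_of_iso (e.symm.app _) (e.symm.app _)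
      (hf.mapExactFunctor_bijective _ _ (n + 1)).2.subsingleton

lemma of_ringEquiv (e : R ≃+* S) : IsExtAcyclicEpi (e : R →+* S) :=
  of_mapExactFunctor_bijective fun M N n => by
    have := ModuleCat.restrictScalars_isEquivalence_of_ringEquiv.{u} e
    exact Functor.mapExt_bijective_of_preservesInjectiveObjects
      (ModuleCat.restrictScalars.{u} e.toRingHom) M N n

end IsExtAcyclicEpi

attribute [local instance] HasDerivedCategory.standard

/-- Homological epimorphisms are characterized by conditions on modules only. -/
lemma isHomologicalEpi_iff_isExtAcyclicEpi (f : R →+* S) :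
    IsHomologicalEpi f ↔ IsExtAcyclicEpi f := by
  let F := ModuleCat.restrictScalars.{u} f
  have hb (M : ModuleCat.{u} S) (n : ℤ) :
      (DerivedCategory.TStructure.t (C := ModuleCat.{u} S)).bounded
        ((DerivedCategory.singleFunctor _ n).obj M) := ⟨⟨n, inferInstance⟩, ⟨n, inferInstance⟩⟩
  constructor
  · rintro ⟨h1, h2⟩
    refine .of_mapExactFunctor_bijective fun M N n => ?_
    rw [← DerivedCategory.homBijective_single_iff]
    have hN : (DerivedCategory.TStructure.t (C := ModuleCat.{u} S)).bounded
      (((DerivedCategory.singleFunctor _ 0).obj N)⟦(n : ℤ)⟧) :=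
      ObjectProperty.le_shift _ (n : ℤ) _ (hb N 0)
    let X : DerivedCategory.Bounded (ModuleCat.{u} S) := ⟨_, hb M 0⟩
    let Y : DerivedCategory.Bounded (ModuleCat.{u} S) := ⟨_, hN⟩
    refine ⟨fun g g' hg => ?_, fun g => ?_⟩
    · have := (boundedDerivedRestrict f).map_injective (X := X) (Y := Y)
        (a₁ := ObjectProperty.homMk g) (a₂ := ObjectProperty.homMk g')
        (ObjectProperty.hom_ext _ hg)
      exact congrArg (fun t => t.hom) this
    · let g₀ : (boundedDerivedRestrict f).obj X ⟶ (boundedDerivedRestrict f).obj Y :=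
        ObjectProperty.homMk g
      obtain ⟨g', hg'⟩ := (boundedDerivedRestrict f).map_surjective g₀
      exact ⟨g'.hom, congrArg (fun t => t.hom) hg'⟩
  · intro h
    have key (X Y : DerivedCategory.Bounded (ModuleCat.{u} S)) :
        F.mapDerivedCategory.HomBijective X.obj Y.obj :=
      DerivedCategory.homBijective_of_bounded F h.mapExactFunctor_bijective _ _
        X.property Y.property
    refine ⟨⟨fun {X Y} g => ?_⟩, ⟨fun {X Y} g g' hg => ?_⟩⟩
    · obtain ⟨g', hg'⟩ := (key X Y).surj g.hom
      exact ⟨ObjectProperty.homMk g', ObjectProperty.hom_ext _ hg'⟩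
    · exact ObjectProperty.hom_ext _ ((key X Y).inj (congrArg (fun t => t.hom) hg))

end HomEpi

/-! ### `Tor` and `Ext` into duals -/

namespace HomEpi

variable {R : Type u} [Ring R]

/-- The left `R`-module `Hom_ℤ(N, D)` for a right `R`-module `N`, with `(a f)(n) = f(n a)`. -/
@[reducible] def dualModule (N : ModuleCat.{u} Rᵐᵒᵖ) (D : Type u) [AddCommGroup D] :
    Module R (N →+ D) where
  smul a f := f.comp (DistribSMul.toAddMonoidHom N (MulOpposite.op a))
  one_smul f := by ext n; exact congrArg f (one_smul Rᵐᵒᵖ n)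
  mul_smul a b f := by
    ext n; exact congrArg f (mul_smul (MulOpposite.op b) (MulOpposite.op a) n)
  smul_zero a := rfl
  smul_add a f g := rfl
  add_smul a b f := by
    ext n
    exact (congrArg f (add_smul (MulOpposite.op a) (MulOpposite.op b) n)).trans (map_add f _ _)
  zero_smul f := by
    ext n; exact (congrArg f (zero_smul Rᵐᵒᵖ n)).trans (map_zero f)

/-- The left `R`-module `Hom_ℤ(N, D)`, as an object of the category of modules. -/
def dual (N : ModuleCat.{u} Rᵐᵒᵖ) (D : Type u) [AddCommGroup D] : ModuleCat.{u} R :=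
  letI := dualModule N D
  ModuleCat.of R (N →+ D)

variable {N : ModuleCat.{u} Rᵐᵒᵖ} {D : Type u} [AddCommGroup D]

/-- Elements of `dual N D` are additive maps `N → D`. -/
def dualEquiv : dual N D ≃+ (N →+ D) := AddEquiv.refl _

lemma dualEquiv_smul (a : R) (f : dual N D) (n : N) :
    dualEquiv (a • f) n = dualEquiv f (MulOpposite.op a • n) := rfl

/-- The map `N ⊗_R M → D` corresponding to `M → Hom_ℤ(N, D)`. -/
def tensDesc {M : ModuleCat.{u} R} (f : M ⟶ dual N D) : Tens N M →+ D :=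
  QuotientAddGroup.lift (balancing N M)
    (TensorProduct.liftAddHom ((dualEquiv.toAddMonoidHom.comp f.hom.toAddMonoidHom).flip)
      (fun r n m => by simp)) <| by
    rw [balancing, AddSubgroup.closure_le]
    rintro _ ⟨n, a, m, rfl⟩
    change TensorProduct.liftAddHom _ _ _ = 0
    rw [map_sub, sub_eq_zero, TensorProduct.liftAddHom_tmul, TensorProduct.liftAddHom_tmul]
    change dualEquiv (f m) (MulOpposite.op a • n) = dualEquiv (f (a • m)) n
    rw [← dualEquiv_smul]
    exact DFunLike.congr_fun (congrArg dualEquiv (f.hom.map_smul a m).symm) n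

/-- The map `M → Hom_ℤ(N, D)` corresponding to `N ⊗_R M → D`. -/
def tensCurry {M : ModuleCat.{u} R} (c : Tens N M →+ D) : M ⟶ dual N D :=
  ModuleCat.ofHom (X := M) (Y := dual N D)
    { toFun := fun m => dualEquiv.symm
        { toFun := fun n => c (QuotientAddGroup.mk (n ⊗ₜ[ℤ] m))
          map_zero' := by rw [TensorProduct.zero_tmul]; exact map_zero c
          map_add' := fun x y => (congrArg (fun t => c (QuotientAddGroup.mk t))
            (TensorProduct.add_tmul x y m)).trans
              (c.map_add (QuotientAddGroup.mk (x ⊗ₜ[ℤ] m)) (QuotientAddGroup.mk (y ⊗ₜ[ℤ] m))) }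
      map_add' := fun m m' => AddMonoidHom.ext fun n => by
        refine (congrArg (fun t => c (QuotientAddGroup.mk t))
          (TensorProduct.tmul_add n m m')).trans
            (c.map_add (QuotientAddGroup.mk (n ⊗ₜ[ℤ] m)) (QuotientAddGroup.mk (n ⊗ₜ[ℤ] m')))
      map_smul' := fun a m => AddMonoidHom.ext fun n => by
        refine congrArg c ((QuotientAddGroup.eq_iff_sub_mem).2 ?_)
        rw [← neg_mem_iff, neg_sub]
        exact AddSubgroup.subset_closure ⟨n, a, m, rfl⟩ }

lemma dual_hom_ext {M : ModuleCat.{u} R} {f g : M ⟶ dual N D}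
    (h : ∀ m n, dualEquiv (f m) n = dualEquiv (g m) n) : f = g := by
  ext m
  exact dualEquiv.injective (AddMonoidHom.ext (h m))

lemma tensDesc_map {M M' : ModuleCat.{u} R} (g : M ⟶ M') (f : M' ⟶ dual N D) :
    (tensDesc f).comp (Tens.map (𝟙 N) g) = tensDesc (g ≫ f) :=
  Tens.induction fun _ _ => rfl

lemma tensCurry_map {M M' : ModuleCat.{u} R} (g : M ⟶ M') (c : Tens N M' →+ D) :
    tensCurry (c.comp (Tens.map (𝟙 N) g)) = g ≫ tensCurry c :=
  dual_hom_ext fun _ _ => rfl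

lemma tensCurry_desc {M : ModuleCat.{u} R} (f : M ⟶ dual N D) : tensCurry (tensDesc f) = f :=
  dual_hom_ext fun _ _ => rfl

lemma tensDesc_curry {M : ModuleCat.{u} R} (c : Tens N M →+ D) : tensDesc (tensCurry c) = c :=
  Tens.induction fun _ _ => rfl

/-- An abelian group is injective if additive maps into it extend along injections. -/
def IsInjectiveGroup (D : Type u) [AddCommGroup D] : Prop :=
  ∀ ⦃X Y : Type u⦄ [AddCommGroup X] [AddCommGroup Y] (i : X →+ Y), Function.Injective i →
    ∀ f : X →+ D, ∃ g : Y →+ D, ∀ x, g (i x) = f x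

/-- There are enough injective abelian groups. -/
lemma exists_injectiveGroup (X : Type u) [AddCommGroup X] :
    ∃ (D : Type u) (_ : AddCommGroup D) (i : X →+ D),
      IsInjectiveGroup D ∧ Function.Injective i := by
  let J : AddCommGrpCat.{u} := Injective.under (AddCommGrpCat.of X)
  let ι : AddCommGrpCat.of X ⟶ J := Injective.ι (AddCommGrpCat.of X)
  have hJ : Injective J := Injective.injective_under (AddCommGrpCat.of X)
  have hι : Mono ι := Injective.ι_mono (AddCommGrpCat.of X)
  refine ⟨J, inferInstance, ι.hom, fun Y Z _ _ i hi f => ?_,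
    (AddCommGrpCat.mono_iff_injective ι).1 hι⟩
  have : Mono (AddCommGrpCat.ofHom i) := (AddCommGrpCat.mono_iff_injective _).2 hi
  let f' : AddCommGrpCat.of Y ⟶ J := AddCommGrpCat.ofHom f
  exact ⟨(Injective.factorThru f' (AddCommGrpCat.ofHom i)).hom, fun x =>
    ConcreteCategory.congr_hom (Injective.comp_factorThru f' (AddCommGrpCat.ofHom i)) x⟩

/-- Exactness of abelian groups is detected by maps to injective groups. -/
lemma exact_iff_injectiveGroup {X Y Z : Type u} [AddCommGroup X] [AddCommGroup Y] [AddCommGroup Z]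
    (f : X →+ Y) (g : Y →+ Z) :
    (∀ y, g y = 0 → ∃ x, f x = y) ↔
      ∀ (D : Type u) [AddCommGroup D], IsInjectiveGroup D → ∀ c : Y →+ D, c.comp f = 0 →
        ∃ c' : Z →+ D, c'.comp g = c := by
  constructor
  · intro hfg D _ hD c hc
    have hk : g.ker ≤ c.ker := fun y hy => by
      obtain ⟨x, rfl⟩ := hfg y hy
      exact DFunLike.congr_fun hc x
    obtain ⟨c', hc'⟩ := hD (QuotientAddGroup.kerLift g) (QuotientAddGroup.kerLift_injective g)
      (QuotientAddGroup.lift g.ker c hk)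
    exact ⟨c', AddMonoidHom.ext fun y => hc' (QuotientAddGroup.mk y)⟩
  · intro hc y hy
    -- test against an embedding of the cokernel of `f` into an injective group
    obtain ⟨D, _, i, hD, hi⟩ := exists_injectiveGroup (Y ⧸ f.range)
    obtain ⟨c', hc'⟩ := hc D hD (i.comp (QuotientAddGroup.mk' f.range))
      (AddMonoidHom.ext fun x => by
        have : (QuotientAddGroup.mk (f x) : Y ⧸ f.range) = 0 :=
          (QuotientAddGroup.eq_zero_iff _).2 ⟨x, rfl⟩
        change i (QuotientAddGroup.mk (f x)) = 0
        rw [this, map_zero])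
    have h1 := DFunLike.congr_fun hc' y
    change c' (g y) = i (QuotientAddGroup.mk y) at h1
    rw [hy, map_zero, eq_comm, map_eq_zero_iff i hi] at h1
    exact (QuotientAddGroup.eq_zero_iff _).1 h1

/-- The vanishing of `Tor` is the vanishing of `Ext` into duals: for a projective resolution `P` of
`M`, exactness of `N ⊗_R P` is exactness of `Hom_ℤ(N ⊗_R P, D) = Hom_R(P, Hom_ℤ(N, D))` for all
injective groups `D`. -/
theorem isZero_tor_iff (N : ModuleCat.{u} Rᵐᵒᵖ) (M : ModuleCat.{u} R) (n : ℕ) :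
    IsZero (Tor (n + 1) N M) ↔ ∀ (D : Type u) [AddCommGroup D], IsInjectiveGroup D →
      Subsingleton (Ext.{u} M (dual N D) (n + 1)) := by
  let P : ProjectiveResolution M := ProjectiveResolution.of M
  rw [Tor, (P.isoLeftDerivedObj (tensFunctor N) (n + 1)).isZero_iff]
  change IsZero (HomologicalComplex.homology _ _) ↔ _
  rw [← HomologicalComplex.exactAt_iff_isZero_homology,
    HomologicalComplex.exactAt_iff' _ (n + 2) (n + 1) n (by simp) (by simp),
    ShortComplex.ab_exact_iff]
  refine (exact_iff_injectiveGroup (Tens.map (𝟙 N) (P.complex.d (n + 2) (n + 1)))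
    (Tens.map (𝟙 N) (P.complex.d (n + 1) n))).trans
      (forall_congr' fun D => forall_congr' fun _ => imp_congr_right fun _ => ?_)
  constructor
  · refine fun h => subsingleton_of_forall_eq 0 fun x => ?_
    obtain ⟨f, hf, rfl⟩ := P.extMk_surjective x (n + 2) rfl
    rw [P.extMk_eq_zero_iff _ _ _ _ n rfl]
    obtain ⟨c, hc⟩ := h (tensDesc f) (by
      rw [tensDesc_map, hf]; exact Tens.induction fun _ _ => rfl)
    refine ⟨tensCurry c, ?_⟩
    rw [← tensCurry_map, hc, tensCurry_desc]
  · intro h c hc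
    have hf : P.complex.d (n + 2) (n + 1) ≫ tensCurry c = 0 := by
      rw [← tensCurry_map, hc]; exact dual_hom_ext fun _ _ => rfl
    obtain ⟨g, hg⟩ := (P.extMk_eq_zero_iff (tensCurry c) (n + 2) rfl hf n rfl).1 (h.elim _ _)
    exact ⟨tensDesc g, by rw [tensDesc_map, hg, tensDesc_curry]⟩

end HomEpi

namespace HomEpi

variable {A B : Type u} [Ring A] [Ring B]

/-! ### Consequences of `B ⊗_A B ≅ B` -/

section TensorSquare

/-- The element `x ⊗ y` of `B ⊗_A B`. -/
noncomputable def tensorSquareMk (φ : A →+* B) (x y : B) :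
    Tens (rightMod φ) (leftMod φ (ModuleCat.of B B)) :=
  QuotientAddGroup.mk
    ((show rightMod φ from x) ⊗ₜ[ℤ] (show leftMod φ (ModuleCat.of B B) from y))

variable {φ : A →+* B}

/-- The map on `B ⊗_A B` induced by a balanced biadditive map `(x, y) ↦ c y x` on `B × B`. -/
noncomputable def tensorSquareLift {D : Type u} [AddCommGroup D] (c : B →+ B →+ D)
    (hc : ∀ x a y, c (φ a * y) x = c y (x * φ a)) :
    Tens (rightMod φ) (leftMod φ (ModuleCat.of B B)) →+ D :=
  tensDesc (ModuleCat.ofHom (X := leftMod φ (ModuleCat.of B B)) (Y := dual (rightMod φ) D)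
    { toFun := fun y => dualEquiv.symm (c (show B from y) : B →+ D)
      map_add' := fun y y' => c.map_add (show B from y) (show B from y')
      map_smul' := fun a y => AddMonoidHom.ext fun x : B => hc x a (show B from y) })

lemma tensorSquareLift_mk {D : Type u} [AddCommGroup D] (c : B →+ B →+ D)
    (hc : ∀ x a y, c (φ a * y) x = c y (x * φ a)) (x y : B) :
    tensorSquareLift c hc (tensorSquareMk φ x y) = c y x := rfl

/-- If `B ⊗_A B` is isomorphic to `B` in any way, then the multiplication `B ⊗_A B → B` is
injective, since it differs from the isomorphism by an invertible central element. In particular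
`b ⊗ 1 = 1 ⊗ b`. -/
lemma TensorSquareIso.mk_one (h : TensorSquareIso φ) (b : B) :
    tensorSquareMk φ b 1 = tensorSquareMk φ 1 b := by
  obtain ⟨e, hl, hr⟩ := h
  let μ : Tens (rightMod φ) (leftMod φ (ModuleCat.of B B)) →+ B :=
    tensorSquareLift AddMonoidHom.mul.flip fun x a y => (mul_assoc x (φ a) y).symm
  have hμ (x y : B) : μ (tensorSquareMk φ x y) = x * y := rfl
  have hμl (b : B) (t) : μ (Tens.map (lmulHom φ b) (𝟙 _) t) = b * μ t := by
    refine DFunLike.congr_fun (Tens.induction (f := μ.comp (Tens.map (lmulHom φ b) (𝟙 _)))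
      (g := (AddMonoidHom.mulLeft b).comp μ) fun x y => ?_) t
    exact mul_assoc b (show B from x) (show B from y)
  have hμr (b : B) (t) : μ (Tens.map (𝟙 _) (rmulHom φ b) t) = μ t * b := by
    refine DFunLike.congr_fun (Tens.induction (f := μ.comp (Tens.map (𝟙 _) (rmulHom φ b)))
      (g := (AddMonoidHom.mulRight b).comp μ) fun x y => ?_) t
    exact (mul_assoc (show B from x) (show B from y) b).symm
  -- the preimage of `1` under the isomorphism gives the central unit `z`
  let z := μ (e.symm 1)
  have hz (b : B) : b * z = z * b := by
    have : Tens.map (lmulHom φ b) (𝟙 _) (e.symm 1) = Tens.map (𝟙 _) (rmulHom φ b) (e.symm 1) :=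
      e.injective (by rw [hl, hr, e.apply_symm_apply, mul_one, one_mul])
    rw [← hμl, this, hμr]
  have hμe (t) : μ t = e t * z := by
    rw [← hμl]
    congr 1
    exact e.injective (by rw [hl, e.apply_symm_apply, mul_one])
  obtain ⟨c, hc⟩ : ∃ c, z * c = 1 := ⟨e (tensorSquareMk φ 1 1), by
    rw [← hz, ← hμe, hμ, one_mul]⟩
  have hinj : Function.Injective μ := (injective_iff_map_eq_zero μ).2 fun t ht => by
    rw [hμe] at ht
    have := congrArg (· * c) ht
    simp only [mul_assoc, hc, mul_one, zero_mul] at this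
    exact (map_eq_zero_iff e e.injective).1 this
  exact hinj (by rw [hμ, hμ, mul_one, one_mul])

/-- `A`-linear maps `g` between left `B`-modules are `B`-linear: the balanced map
`x ⊗ y ↦ x g(y m)` takes the same value at `b ⊗ 1` and `1 ⊗ b`. -/
lemma TensorSquareIso.full (h : TensorSquareIso φ) : (ModuleCat.restrictScalars.{u} φ).Full :=
  ⟨fun {M N} g => by
    let g' : M →+ N := g.hom.toAddMonoidHom
    have hg (a : A) (m : M) : g' (φ a • m) = φ a • g' m := g.hom.map_smul a m
    refine ⟨ModuleCat.ofHom (X := M) (Y := N)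
      { toFun := g', map_add' := map_add g', map_smul' := fun b m => ?_ }, rfl⟩
    have h1 := congrArg (tensorSquareLift (φ := φ) ((smulAddHom B N).flip.comp
      (g'.comp ((smulAddHom B M).flip m)))
      fun x a y => by
        change x • g' ((φ a * y) • m) = (x * φ a) • g' (y • m)
        rw [mul_smul, hg, mul_smul]) (h.mk_one b)
    rw [tensorSquareLift_mk, tensorSquareLift_mk] at h1
    change b • g' ((1 : B) • m) = (1 : B) • g' (b • m) at h1
    rw [one_smul, one_smul] at h1
    exact h1.symm⟩

/-- `A`-linear maps between right `B`-modules are `B`-linear. -/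
lemma TensorSquareIso.full_op (h : TensorSquareIso φ) :
    (ModuleCat.restrictScalars.{u} φ.op).Full :=
  ⟨fun {M N} g => by
    let g' : M →+ N := g.hom.toAddMonoidHom
    have hg (a : A) (m : M) : g' (MulOpposite.op (φ a) • m) = MulOpposite.op (φ a) • g' m :=
      g.hom.map_smul (MulOpposite.op a) m
    refine ⟨ModuleCat.ofHom (X := M) (Y := N)
      { toFun := g', map_add' := map_add g', map_smul' := fun b m => ?_ }, rfl⟩
    have h1 := congrArg (tensorSquareLift (φ := φ) ((AddMonoidHom.compHom.flip
      (g'.comp (((smulAddHom Bᵐᵒᵖ M).flip m).comp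
        (MulOpposite.opAddEquiv (α := B)).toAddMonoidHom))).comp
          ((smulAddHom Bᵐᵒᵖ N).comp (MulOpposite.opAddEquiv (α := B)).toAddMonoidHom))
      fun x a y => by
        change MulOpposite.op (φ a * y) • g' (MulOpposite.op x • m) =
          MulOpposite.op y • g' (MulOpposite.op (x * φ a) • m)
        rw [MulOpposite.op_mul, MulOpposite.op_mul, mul_smul, mul_smul, hg]) (h.mk_one b.unop)
    rw [tensorSquareLift_mk, tensorSquareLift_mk] at h1
    change (1 : Bᵐᵒᵖ) • g' (b • m) = b • g' ((1 : Bᵐᵒᵖ) • m) at h1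
    rwa [one_smul, one_smul] at h1⟩

end TensorSquare

/-! ### Vanishing of `Tor` and acyclicity -/

section Dual

variable {D : Type u} [AddCommGroup D]

/-- The map `y ↦ (x ↦ c (x y))` from a left `B`-module `Y` to `Hom_ℤ(B, D)`. -/
noncomputable def dualLift {Y : ModuleCat.{u} B} (c : Y →+ D) :
    Y ⟶ dual (ModuleCat.of Bᵐᵒᵖ B) D :=
  ModuleCat.ofHom (X := Y) (Y := dual (ModuleCat.of Bᵐᵒᵖ B) D)
    { toFun := fun y => dualEquiv.symm
        (c.comp ((smulAddHom B Y).flip y) : B →+ D)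
      map_add' := fun y y' => AddMonoidHom.ext fun x : B =>
        (congrArg c (smul_add x y y')).trans (map_add c _ _)
      map_smul' := fun b y => AddMonoidHom.ext fun x : B =>
        congrArg c (mul_smul x b y).symm }

lemma dualLift_apply {Y : ModuleCat.{u} B} (c : Y →+ D) (y : Y) (x : B) :
    dualEquiv (dualLift c y) x = c (x • y) := rfl

/-- A map into `Hom_ℤ(B, D)` is determined by its evaluation at `1`, an arbitrary additive map to
`D`; so the dual of `B` is injective. -/
lemma injective_dual (hD : IsInjectiveGroup D) : Injective (dual (ModuleCat.of Bᵐᵒᵖ B) D) where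
  factors {X Y} g f hf := by
    rw [ModuleCat.mono_iff_injective] at hf
    obtain ⟨c, hc⟩ := hD f.hom.toAddMonoidHom hf
      ((AddMonoidHom.eval (1 : B)).comp (dualEquiv.toAddMonoidHom.comp g.hom.toAddMonoidHom))
    refine ⟨dualLift c, dual_hom_ext fun x (b : B) => ?_⟩
    change c (b • f.hom x) = dualEquiv (g x) b
    rw [← map_smul]
    refine (hc (b • x)).trans ?_
    change dualEquiv (g.hom (b • x)) (1 : B) = _
    rw [map_smul, dualEquiv_smul]
    exact congrArg (dualEquiv (g x)) (one_mul b)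

/-- `Hom_ℤ(B, D)` restricted to `A` is the dual of the right `A`-module `B`. -/
noncomputable def restrictDualIso (φ : A →+* B) (D : Type u) [AddCommGroup D] :
    (ModuleCat.restrictScalars.{u} φ).obj (dual (ModuleCat.of Bᵐᵒᵖ B) D) ≅ dual (rightMod φ) D :=
  Iso.refl (dual (rightMod φ) D)

/-- Every left `B`-module embeds into the dual of `B` with values in an injective group. -/
lemma exists_mono_dual (Y : ModuleCat.{u} B) :
    ∃ (D : Type u) (_ : AddCommGroup D) (i : Y ⟶ dual (ModuleCat.of Bᵐᵒᵖ B) D),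
      IsInjectiveGroup D ∧ Mono i := by
  obtain ⟨D, _, i, hD, hi⟩ := exists_injectiveGroup Y
  refine ⟨D, _, dualLift i, hD, (ModuleCat.mono_iff_injective _).2 fun y y' h => hi ?_⟩
  have h1 : dualEquiv (dualLift i y) (1 : B) = dualEquiv (dualLift i y') (1 : B) := by rw [h]
  rwa [dualLift_apply, dualLift_apply, one_smul, one_smul] at h1

end Dual

/-- For the vanishing of `Extⁿ_A(B, Y)` for all `B`-modules `Y` it is enough to consider a class of
modules `Y` in which every module embeds. -/
lemma IsExtAcyclicEpi.of_exists_mono {φ : A →+* B} (hφ : (ModuleCat.restrictScalars.{u} φ).Full)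
    (h : ∀ Y : ModuleCat.{u} B, ∃ (J : ModuleCat.{u} B) (i : Y ⟶ J), Mono i ∧
      ∀ n, Subsingleton (Ext.{u} ((ModuleCat.restrictScalars.{u} φ).obj (ModuleCat.of B B))
        ((ModuleCat.restrictScalars.{u} φ).obj J) (n + 1))) : IsExtAcyclicEpi φ := by
  refine ⟨hφ, fun Y n => ?_⟩
  have : Projective (ModuleCat.of B B) :=
    ModuleCat.projective_of_free (Module.Basis.singleton PUnit.{1} B)
  induction n generalizing Y with
  | zero =>
    obtain ⟨J, i, hi, hJ⟩ := h Y
    let S := ShortComplex.mk _ _ (cokernel.condition i)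
    have hS : S.ShortExact := { exact := ShortComplex.exact_cokernel i }
    -- `A`-linear maps from `B` to the cokernel are `B`-linear, so they lift to `J`
    refine (hS.map_of_exact (ModuleCat.restrictScalars.{u} φ)).subsingleton_ext_one_X₁
      (fun g => ?_) (hJ 0)
    obtain ⟨g, rfl⟩ := (ModuleCat.restrictScalars.{u} φ).map_surjective
      (X := ModuleCat.of B B) (Y := S.X₃) g
    have := hS.epi_g
    exact ⟨(ModuleCat.restrictScalars.{u} φ).map (Projective.factorThru g S.g),
      (Functor.map_comp _ _ _).symm.trans
        (congrArg (ModuleCat.restrictScalars.{u} φ).map (Projective.factorThru_comp g S.g))⟩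
  | succ n hn =>
    obtain ⟨J, i, hi, hJ⟩ := h Y
    let S := ShortComplex.mk _ _ (cokernel.condition i)
    have hS : S.ShortExact := { exact := ShortComplex.exact_cokernel i }
    exact (hS.map_of_exact (ModuleCat.restrictScalars.{u} φ)).subsingleton_ext_X₁ (hn S.X₃)
      (hJ (n + 1))

/-- If `Tor_n^A(B, B) = 0` for `n > 0` then `Extⁿ_A(B, -)` vanishes on the duals of `B`, into
which all `B`-modules embed. -/
theorem isExtAcyclicEpi_of_tor {φ : A →+* B} (hφ : (ModuleCat.restrictScalars.{u} φ).Full)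
    (h : ∀ n : ℕ, IsZero (Tor (n + 1) (rightMod φ) (leftMod φ (ModuleCat.of B B)))) :
    IsExtAcyclicEpi φ := by
  refine .of_exists_mono hφ fun Y => ?_
  obtain ⟨D, _, i, hD, hi⟩ := exists_mono_dual Y
  exact ⟨_, i, hi, fun n => subsingleton_ext_of_iso (Iso.refl _) (restrictDualIso φ D).symm
    ((isZero_tor_iff _ _ n).1 (h n) D hD)⟩

/-- `Tor_n^A(B, M) = 0` for `n > 0` since the duals of `B` are injective `B`-modules. -/
theorem IsExtAcyclicEpi.isZero_tor {φ : A →+* B} (h : IsExtAcyclicEpi φ) (M : ModuleCat.{u} B)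
    (n : ℕ) : IsZero (Tor (n + 1) (rightMod φ) (leftMod φ M)) := by
  refine (isZero_tor_iff _ _ n).2 fun D _ hD => ?_
  have := injective_dual (B := B) hD
  exact subsingleton_ext_of_iso (Iso.refl _) (restrictDualIso φ D)
    (h.subsingleton_ext_injective M _ n)

end HomEpi

/-! ### Exact contravariant functors and acyclicity -/

namespace CategoryTheory

universe w w' v₁ v₂ u₁ u₂

variable {C : Type u₁} [Category.{v₁} C] [Abelian C] [HasExt.{w} C] [EnoughProjectives C]
variable {D : Type u₂} [Category.{v₂} D] [Abelian D] [HasExt.{w'} D]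

/-- Dimension shifting along an exact contravariant functor `T` which takes projective objects to
`X`-acyclic ones, when `Hom(X, T N)` is naturally isomorphic to `Hom(N, V)`. -/
theorem subsingleton_ext_contravariant (T : Cᵒᵖ ⥤ D) [T.PreservesZeroMorphisms]
    (hT : ∀ S : ShortComplex C, S.ShortExact → (S.op.map T).ShortExact) (X : D) (V : C)
    (e : ∀ N : C, (X ⟶ T.obj (.op N)) ≃ (N ⟶ V))
    (he : ∀ {N N' : C} (i : N ⟶ N') (g : X ⟶ T.obj (.op N')), e N (g ≫ T.map i.op) = i ≫ e N' g)
    (hP : ∀ P : C, Projective P → ∀ n, Subsingleton (Ext.{w'} X (T.obj (.op P)) (n + 1)))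
    (n : ℕ) (N : C) (h : Subsingleton (Ext.{w} N V (n + 1))) :
    Subsingleton (Ext.{w'} X (T.obj (.op N)) (n + 1)) := by
  induction n generalizing N with
  | zero =>
    let S := ShortComplex.mk _ _ (kernel.condition (Projective.π N))
    have hS : S.ShortExact := { exact := ShortComplex.exact_kernel (Projective.π N) }
    have hX₂ : Projective S.X₂ := Projective.projective_over N
    refine (hT S hS).subsingleton_ext_one_X₁ (fun g => ?_) (hP S.X₂ hX₂ 0)
    obtain ⟨l, hl⟩ := hS.exists_desc_of_subsingleton_ext h (e _ g)
    exact ⟨(e S.X₂).symm l, (e S.X₁).injective (by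
      refine (he S.f _).trans ?_
      rw [Equiv.apply_symm_apply, hl])⟩
  | succ n hn =>
    let S := ShortComplex.mk _ _ (kernel.condition (Projective.π N))
    have hS : S.ShortExact := { exact := ShortComplex.exact_kernel (Projective.π N) }
    have hX₂ : Projective S.X₂ := Projective.projective_over N
    have : Subsingleton (Ext.{w} S.X₂ V (n + 1)) :=
      subsingleton_of_forall_eq 0 Ext.eq_zero_of_projective
    exact (hT S hS).subsingleton_ext_X₁ (hn S.X₁ (hS.subsingleton_ext_X₁' h this))
      (hP S.X₂ hX₂ (n + 1))

end CategoryTheory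

namespace HomEpi

/-! ### Passage to opposite rings -/

section Opposite

variable {R : Type u} [Ring R]

/-- The right `R`-module `Hom_ℤ(M, D)` for a left `R`-module `M`, with `(f a)(m) = f(a m)`. -/
@[reducible] def codualModule (M : ModuleCat.{u} R) (D : Type u) [AddCommGroup D] :
    Module Rᵐᵒᵖ (M →+ D) where
  smul a f := f.comp (DistribSMul.toAddMonoidHom M a.unop)
  one_smul f := by ext m; exact congrArg f (one_smul R m)
  mul_smul a b f := by ext m; exact congrArg f (mul_smul b.unop a.unop m)
  smul_zero a := rfl
  smul_add a f g := rfl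
  add_smul a b f := by
    ext m
    exact (congrArg f (add_smul a.unop b.unop m)).trans (map_add f _ _)
  zero_smul f := by
    ext m; exact (congrArg f (zero_smul R m)).trans (map_zero f)

/-- The right `R`-module `Hom_ℤ(M, D)`, as an object of the category of modules. -/
def codual (M : ModuleCat.{u} R) (D : Type u) [AddCommGroup D] : ModuleCat.{u} Rᵐᵒᵖ :=
  letI := codualModule M D
  ModuleCat.of Rᵐᵒᵖ (M →+ D)

variable {M : ModuleCat.{u} R} {D : Type u} [AddCommGroup D]

/-- Elements of `codual M D` are additive maps `M → D`. -/
def codualEquiv : codual M D ≃+ (M →+ D) := AddEquiv.refl _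

lemma codual_hom_ext {N : ModuleCat.{u} Rᵐᵒᵖ} {f g : N ⟶ codual M D}
    (h : ∀ n m, codualEquiv (f n) m = codualEquiv (g n) m) : f = g := by
  ext n
  exact codualEquiv.injective (AddMonoidHom.ext (h n))

variable (R D) in
/-- The contravariant functor `M ↦ Hom_ℤ(M, D)`. -/
def codualFunctor : (ModuleCat.{u} R)ᵒᵖ ⥤ ModuleCat.{u} Rᵐᵒᵖ where
  obj M := codual M.unop D
  map {M N} i := ModuleCat.ofHom (X := codual M.unop D) (Y := codual N.unop D)
    { toFun := fun f => codualEquiv.symm ((codualEquiv f).comp i.unop.hom.toAddMonoidHom)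
      map_add' := fun _ _ => rfl
      map_smul' := fun a f => codualEquiv.injective (AddMonoidHom.ext fun m =>
        congrArg (codualEquiv f) (i.unop.hom.map_smul a.unop m).symm) }

instance : (codualFunctor R D).PreservesZeroMorphisms where
  map_zero _ _ := codual_hom_ext fun f _ => map_zero (codualEquiv f)

/-- `Hom_ℤ(-, D)` is exact for an injective group `D`. -/
lemma codualFunctor_shortExact (hD : IsInjectiveGroup D) (S : ShortComplex (ModuleCat.{u} R))
    (hS : S.ShortExact) : (S.op.map (codualFunctor R D)).ShortExact where
  exact := by
    rw [ShortComplex.moduleCat_exact_iff]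
    intro f hf
    have hex := (ShortComplex.moduleCat_exact_iff S).1 hS.exact
    obtain ⟨c, hc⟩ := (exact_iff_injectiveGroup S.f.hom.toAddMonoidHom S.g.hom.toAddMonoidHom).1
      hex D hD (codualEquiv f) hf
    exact ⟨codualEquiv.symm c, hc⟩
  mono_f := (ModuleCat.mono_iff_injective _).2 fun f g hfg => by
    have := (ModuleCat.epi_iff_surjective _).1 hS.epi_g
    refine codualEquiv.injective (AddMonoidHom.ext fun m => ?_)
    obtain ⟨m, rfl⟩ := this m
    exact DFunLike.congr_fun (congrArg codualEquiv hfg) m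
  epi_g := (ModuleCat.epi_iff_surjective _).2 fun f => by
    obtain ⟨c, hc⟩ := hD S.f.hom.toAddMonoidHom ((ModuleCat.mono_iff_injective _).1 hS.mono_f)
      (codualEquiv f)
    exact ⟨codualEquiv.symm c, AddMonoidHom.ext hc⟩

/-- Maps `N → Hom_ℤ(M, D)` of right modules and maps `M → Hom_ℤ(N, D)` of left modules both
correspond to balanced biadditive maps `N × M → D`. -/
def codualHomEquiv (N : ModuleCat.{u} Rᵐᵒᵖ) (M : ModuleCat.{u} R) (D : Type u) [AddCommGroup D] :
    (N ⟶ codual M D) ≃ (M ⟶ dual N D) where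
  toFun f := ModuleCat.ofHom (X := M) (Y := dual N D)
    { toFun := fun m => dualEquiv.symm
        ((codualEquiv.toAddMonoidHom.comp f.hom.toAddMonoidHom).flip m)
      map_add' := fun m m' => AddMonoidHom.ext fun n => map_add (codualEquiv (f n)) m m'
      map_smul' := fun a m => AddMonoidHom.ext fun n =>
        (DFunLike.congr_fun (congrArg codualEquiv (f.hom.map_smul (MulOpposite.op a) n)) m).symm }
  invFun f := ModuleCat.ofHom (X := N) (Y := codual M D)
    { toFun := fun n => codualEquiv.symm
        ((dualEquiv.toAddMonoidHom.comp f.hom.toAddMonoidHom).flip n)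
      map_add' := fun n n' => AddMonoidHom.ext fun m => map_add (dualEquiv (f m)) n n'
      map_smul' := fun a n => AddMonoidHom.ext fun m =>
        (DFunLike.congr_fun (congrArg dualEquiv (f.hom.map_smul a.unop m)) n).symm }
  left_inv _ := codual_hom_ext fun _ _ => rfl
  right_inv _ := dual_hom_ext fun _ _ => rfl

/-- The dual of a projective module is injective. -/
lemma injective_codual (hD : IsInjectiveGroup D) {P : ModuleCat.{u} R} (hP : Projective P) :
    Injective (codual P D) where
  factors {X Y} g f hf := by
    let fd : dual Y D ⟶ dual X D := ModuleCat.ofHom (X := dual Y D) (Y := dual X D)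
      { toFun := fun c => dualEquiv.symm ((dualEquiv c).comp f.hom.toAddMonoidHom)
        map_add' := fun _ _ => rfl
        map_smul' := fun a c => dualEquiv.injective (AddMonoidHom.ext fun x =>
          congrArg (dualEquiv c) (f.hom.map_smul (MulOpposite.op a) x).symm) }
    have hepi : Epi fd :=
      (ModuleCat.epi_iff_surjective _).2 fun c => by
        obtain ⟨c', hc'⟩ := hD f.hom.toAddMonoidHom ((ModuleCat.mono_iff_injective _).1 hf)
          (dualEquiv c)
        exact ⟨dualEquiv.symm c', AddMonoidHom.ext hc'⟩
    obtain ⟨l, hl⟩ := hP.factors (codualHomEquiv X P D g) fd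
    refine ⟨(codualHomEquiv Y P D).symm l, codual_hom_ext fun x p => ?_⟩
    exact DFunLike.congr_fun (congrArg dualEquiv (ConcreteCategory.congr_hom hl p)) x

/-- The balancing of `Tor`, in terms of the `Ext` groups into duals. -/
lemma subsingleton_ext_codual (hD : IsInjectiveGroup D) (N : ModuleCat.{u} Rᵐᵒᵖ)
    (M : ModuleCat.{u} R) (n : ℕ) (h : Subsingleton (Ext.{u} M (dual N D) (n + 1))) :
    Subsingleton (Ext.{u} N (codual M D) (n + 1)) :=
  subsingleton_ext_contravariant (codualFunctor R D) (codualFunctor_shortExact hD) N (dual N D)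
    (fun M => codualHomEquiv N M D) (fun _ _ => rfl)
    (fun P hP n => by
      have : Injective ((codualFunctor R D).obj (.op P)) := injective_codual hD hP
      exact Ext.subsingleton_of_injective _ _ n) n M h

variable {A B : Type u} [Ring A] [Ring B]

/-- The map `y ↦ (x ↦ c (y x))` from a right `B`-module `Y` to `Hom_ℤ(B, D)`. -/
def codualLift {Y : ModuleCat.{u} Bᵐᵒᵖ} (c : Y →+ D) : Y ⟶ codual (ModuleCat.of B B) D :=
  ModuleCat.ofHom (X := Y) (Y := codual (ModuleCat.of B B) D)
    { toFun := fun y => codualEquiv.symm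
        (c.comp (((smulAddHom Bᵐᵒᵖ Y).flip y).comp
          (MulOpposite.opAddEquiv (α := B)).toAddMonoidHom) : B →+ D)
      map_add' := fun y y' => AddMonoidHom.ext fun x : B =>
        (congrArg c (smul_add (MulOpposite.op x) y y')).trans (map_add c _ _)
      map_smul' := fun b y => AddMonoidHom.ext fun x : B =>
        congrArg c (mul_smul (MulOpposite.op x) b y).symm }

lemma codualLift_apply {Y : ModuleCat.{u} Bᵐᵒᵖ} (c : Y →+ D) (y : Y) (x : B) :
    codualEquiv (codualLift c y) x = c (MulOpposite.op x • y) := rfl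

/-- Every right `B`-module embeds into the dual of the left module `B` with values in an injective
group. -/
lemma exists_mono_codual (Y : ModuleCat.{u} Bᵐᵒᵖ) :
    ∃ (D : Type u) (_ : AddCommGroup D) (i : Y ⟶ codual (ModuleCat.of B B) D),
      IsInjectiveGroup D ∧ Mono i := by
  obtain ⟨D, _, i, hD, hi⟩ := exists_injectiveGroup Y
  refine ⟨D, _, codualLift i, hD, (ModuleCat.mono_iff_injective _).2 fun y y' h => hi ?_⟩
  have h1 : codualEquiv (codualLift i y) (1 : B) = codualEquiv (codualLift i y') (1 : B) := by
    rw [h]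
  rwa [codualLift_apply, codualLift_apply, MulOpposite.op_one, one_smul, one_smul] at h1

/-- `rightMod φ` is the restriction of the regular left `Bᵐᵒᵖ`-module. -/
noncomputable def rightModIso (φ : A →+* B) :
    rightMod φ ≅ (ModuleCat.restrictScalars.{u} φ.op).obj (ModuleCat.of Bᵐᵒᵖ Bᵐᵒᵖ) :=
  (ModuleCat.restrictScalars.{u} φ.op).mapIso (LinearEquiv.toModuleIso
    { MulOpposite.opAddEquiv (α := B) with map_smul' := fun _ _ => rfl })

/-- Acyclicity passes to the opposite rings, by the symmetry of `Tor_n^A(B, B)`. -/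
theorem IsExtAcyclicEpi.op {φ : A →+* B} (h : IsExtAcyclicEpi φ)
    (hφ : (ModuleCat.restrictScalars.{u} φ.op).Full) : IsExtAcyclicEpi φ.op := by
  refine .of_exists_mono hφ fun Y => ?_
  obtain ⟨D, _, i, hD, hi⟩ := exists_mono_codual Y
  refine ⟨_, i, hi, fun n => ?_⟩
  have h1 := subsingleton_ext_codual hD (rightMod φ) (leftMod φ (ModuleCat.of B B)) n
    (subsingleton_ext_of_iso (Iso.refl _) (restrictDualIso φ D) (h.subsingleton_ext _ n))
  exact subsingleton_ext_of_iso (rightModIso φ)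
    (Iso.refl (codual (leftMod φ (ModuleCat.of B B)) D)) h1

end Opposite

end HomEpi

/-! ### `Ext` and adjunctions -/

namespace CategoryTheory

universe w w' v₁ v₂ u₁ u₂

variable {C : Type u₁} [Category.{v₁} C] [Abelian C] [HasExt.{w} C]
variable {D : Type u₂} [Category.{v₂} D] [Abelian D] [HasExt.{w'} D] [EnoughInjectives D]

/-- Exact adjoint functors `F ⊣ G` satisfy `Extⁿ(F X, Y) ≅ Extⁿ(X, G Y)`; here only the injectivity
of the comparison map is used, to transport vanishing. -/
lemma subsingleton_ext_of_adjunction {F : C ⥤ D} {G : D ⥤ C} (adj : F ⊣ G) [G.Additive]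
    [PreservesFiniteLimits G] [PreservesFiniteColimits G] [F.PreservesMonomorphisms]
    (X : C) (Y : D) (n : ℕ) (h : Subsingleton (Ext.{w} X (G.obj Y) n)) :
    Subsingleton (Ext.{w'} (F.obj X) Y n) := by
  have hu := extComparison_bijective.{w', w} (X' := F.obj X) G (adj.unit.app X) (fun Z => ?_)
    (fun Z => ?_) Y n
  · exact @Function.Injective.subsingleton _ _ _ hu.injective h
  · exact (adj.homEquiv X Z).bijective
  · have : Injective (G.obj (Injective.under Z)) := Injective.injective_of_adjoint adj _
    exact ⟨Injective.under Z, Injective.ι Z, inferInstance, inferInstance,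
      fun n => Ext.subsingleton_of_injective _ _ n⟩

end CategoryTheory

namespace HomEpi

attribute [local instance] ModuleCat.moduleOfAlgebraModule
  ModuleCat.isScalarTower_of_algebra_moduleCat

variable {k : Type v} [Field k] {A B C C' : Type u} [Ring A] [Algebra k A] [Ring B] [Algebra k B]
  [Ring C] [Algebra k C] [Ring C'] [Algebra k C']

/-! ### Tensor products of modules over two algebras -/

section TensorObj

/-- The action of `A ⊗ C` on `X ⊗_k W` for an `A`-module `X` and a `C`-module `W`. -/
noncomputable def tensorAct (X : ModuleCat.{u} A) (W : ModuleCat.{u} C) :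
    A ⊗[k] C →ₐ[k] Module.End k (X ⊗[k] W) :=
  Module.endTensorEndAlgHom.comp
    (Algebra.TensorProduct.map (Algebra.lsmul k k X) (Algebra.lsmul k k W))

variable (k) in
/-- The `A ⊗ C`-module `X ⊗_k W` for an `A`-module `X` and a `C`-module `W`. -/
noncomputable def tensorObj (X : ModuleCat.{u} A) (W : ModuleCat.{u} C) :
    ModuleCat.{u} (A ⊗[k] C) :=
  letI : Module (A ⊗[k] C) (X ⊗[k] W) := Module.compHom _ (tensorAct X W).toRingHom
  ModuleCat.of (A ⊗[k] C) (X ⊗[k] W)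

variable (k) in
/-- Elements of `tensorObj k X W` are elements of `X ⊗_k W`. -/
noncomputable def tensorEquiv (X : ModuleCat.{u} A) (W : ModuleCat.{u} C) :
    X ⊗[k] W ≃+ tensorObj k X W := AddEquiv.refl _

lemma tensorEquiv_smul (X : ModuleCat.{u} A) (W : ModuleCat.{u} C) (a : A) (c : C) (x : X) (w : W) :
    (a ⊗ₜ[k] c : A ⊗[k] C) • tensorEquiv k X W (x ⊗ₜ w) =
      tensorEquiv k X W ((a • x) ⊗ₜ[k] (c • w)) := rfl

lemma tensorObj_induction {X : ModuleCat.{u} A} {W : ModuleCat.{u} C} {p : tensorObj k X W → Prop}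
    (z : tensorObj k X W) (h0 : p 0) (h1 : ∀ x w, p (tensorEquiv k X W (x ⊗ₜ w)))
    (h2 : ∀ x y, p x → p y → p (x + y)) : p z :=
  TensorProduct.induction_on z h0 h1 h2

lemma tensorObj_hom_ext {X : ModuleCat.{u} A} {W : ModuleCat.{u} C} {Z : ModuleCat.{u} (A ⊗[k] C)}
    {f g : tensorObj k X W ⟶ Z}
    (h : ∀ x w, f (tensorEquiv k X W (x ⊗ₜ w)) = g (tensorEquiv k X W (x ⊗ₜ w))) : f = g := by
  ext z
  induction z using tensorObj_induction with
  | h0 => exact (map_zero f.hom).trans (map_zero g.hom).symm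
  | h1 x w => exact h x w
  | h2 x y hx hy =>
    exact (f.hom.map_add x y).trans ((congrArg₂ (· + ·) hx hy).trans (g.hom.map_add x y).symm)

/-- An additive map between `A ⊗ C`-modules is linear if it commutes with pure tensors. -/
lemma tensor_linear {Y Z : Type*} [AddCommGroup Y] [AddCommGroup Z] [Module (A ⊗[k] C) Y]
    [Module (A ⊗[k] C) Z] (f : Y →+ Z)
    (h : ∀ (a : A) (c : C) (y : Y), f ((a ⊗ₜ[k] c : A ⊗[k] C) • y) =
      (a ⊗ₜ[k] c : A ⊗[k] C) • f y) (e : A ⊗[k] C) (y : Y) : f (e • y) = e • f y := by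
  induction e using TensorProduct.induction_on with
  | zero =>
    exact (congrArg f (zero_smul (A ⊗[k] C) y)).trans
      ((map_zero f).trans (zero_smul (A ⊗[k] C) (f y)).symm)
  | tmul a c => exact h a c y
  | add x y hx hy => rw [add_smul, add_smul, map_add, hx, hy]

/-- The linear map out of `X ⊗_k W` with given underlying additive map. -/
noncomputable def tensorHom {X : ModuleCat.{u} A} {W : ModuleCat.{u} C}
    {Z : ModuleCat.{u} (A ⊗[k] C)} (f : X ⊗[k] W →+ Z)
    (h : ∀ (a : A) (c : C) (x : X) (w : W), f ((a • x) ⊗ₜ[k] (c • w)) =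
      (a ⊗ₜ[k] c : A ⊗[k] C) • f (x ⊗ₜ w)) : tensorObj k X W ⟶ Z :=
  ModuleCat.ofHom (X := tensorObj k X W) (Y := Z)
    { toFun := f.comp (tensorEquiv k X W).symm.toAddMonoidHom
      map_add' := map_add _
      map_smul' := tensor_linear _ fun a c z => by
        induction z using tensorObj_induction with
        | h0 => simp
        | h1 x w => exact h a c x w
        | h2 x y hx hy => simp only [smul_add, map_add, hx, hy] }

variable (k) in
/-- Functoriality of `X ⊗_k W` in both variables. -/
noncomputable def tensorMap {X X' : ModuleCat.{u} A} {W W' : ModuleCat.{u} C} (f : X ⟶ X')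
    (g : W ⟶ W') : tensorObj k X W ⟶ tensorObj k X' W' :=
  tensorHom ((tensorEquiv k X' W').toAddMonoidHom.comp
    (TensorProduct.map (f.hom.restrictScalars k) (g.hom.restrictScalars k)).toAddMonoidHom)
    fun a c x w => congrArg₂ (fun x w => tensorEquiv k X' W' (x ⊗ₜ w)) (f.hom.map_smul a x)
      (g.hom.map_smul c w)

variable (k) (A) in
/-- The functor `X ↦ X ⊗_k W` from `A`-modules to `A ⊗ C`-modules. -/
noncomputable def tensorFunctor (W : ModuleCat.{u} C) :
    ModuleCat.{u} A ⥤ ModuleCat.{u} (A ⊗[k] C) where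
  obj X := tensorObj k X W
  map f := tensorMap k f (𝟙 W)
  map_id _ := tensorObj_hom_ext fun _ _ => rfl
  map_comp _ _ := tensorObj_hom_ext fun _ _ => rfl

instance (W : ModuleCat.{u} C) : (tensorFunctor k A W).Additive where
  map_add {_ Y f g} := tensorObj_hom_ext fun x w =>
    congrArg (tensorEquiv k Y W) (TensorProduct.add_tmul (f x) (g x) w)

/-- Tensor products over a field are exact. -/
lemma tensorFunctor_shortExact (W : ModuleCat.{u} C) (S : ShortComplex (ModuleCat.{u} A))
    (hS : S.ShortExact) : (S.map (tensorFunctor k A W)).ShortExact := by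
  have hf : Function.Injective S.f := (ModuleCat.mono_iff_injective _).1 hS.mono_f
  have hg : Function.Surjective S.g := (ModuleCat.epi_iff_surjective _).1 hS.epi_g
  have hex : Function.Exact (S.f.hom.restrictScalars k) (S.g.hom.restrictScalars k) := fun x =>
    ⟨(ShortComplex.moduleCat_exact_iff S).1 hS.exact x, fun ⟨y, hy⟩ => by
      rw [← hy]; exact ConcreteCategory.congr_hom S.zero y⟩
  exact
    { exact := (ShortComplex.moduleCat_exact_iff _).2 fun z hz =>
        (rTensor_exact W hex hg z).1 hz
      mono_f := (ModuleCat.mono_iff_injective _).2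
        (Module.Flat.rTensor_preserves_injective_linearMap (M := W) (S.f.hom.restrictScalars k) hf)
      epi_g := (ModuleCat.epi_iff_surjective _).2 (LinearMap.rTensor_surjective W hg) }

lemma tensorFunctor_exact (W : ModuleCat.{u} C) :
    PreservesFiniteLimits (tensorFunctor k A W) ∧ PreservesFiniteColimits (tensorFunctor k A W) :=
  ((Functor.exact_tfae (tensorFunctor k A W)).out 0 3).mp (tensorFunctor_shortExact W)

instance (W : ModuleCat.{u} C) : PreservesFiniteLimits (tensorFunctor k A W) :=
  (tensorFunctor_exact W).1

instance (W : ModuleCat.{u} C) : PreservesFiniteColimits (tensorFunctor k A W) :=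
  (tensorFunctor_exact W).2

/-- Restriction along an algebra homomorphism does not change the vector space structure. -/
noncomputable def restrictEquiv (φ : A →ₐ[k] B) (Y : ModuleCat.{u} B) :
    (ModuleCat.restrictScalars.{u} φ.toRingHom).obj Y ≃ₗ[k] Y :=
  { AddEquiv.refl Y with
    map_smul' := fun r y => by
      refine Eq.trans (b := φ (algebraMap k A r) • (y : Y)) rfl ?_
      rw [φ.commutes]; rfl }

/-- The isomorphism out of `X ⊗_k W` with given underlying additive bijection. -/
noncomputable def tensorIso {X : ModuleCat.{u} A} {W : ModuleCat.{u} C}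
    {Z : ModuleCat.{u} (A ⊗[k] C)} (f : X ⊗[k] W ≃+ Z)
    (h : ∀ (a : A) (c : C) (x : X) (w : W), f ((a • x) ⊗ₜ[k] (c • w)) =
      (a ⊗ₜ[k] c : A ⊗[k] C) • f (x ⊗ₜ w)) : tensorObj k X W ≅ Z :=
  have : IsIso (tensorHom f.toAddMonoidHom h) :=
    (ConcreteCategory.isIso_iff_bijective _).2 f.bijective
  asIso (tensorHom f.toAddMonoidHom h)

/-- Tensor products of modules are compatible with restriction of scalars. -/
noncomputable def tensorRestrictIso (φ : A →ₐ[k] B) (ψ : C →ₐ[k] C') (Y : ModuleCat.{u} B)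
    (W : ModuleCat.{u} C') :
    tensorObj k ((ModuleCat.restrictScalars.{u} φ.toRingHom).obj Y)
        ((ModuleCat.restrictScalars.{u} ψ.toRingHom).obj W) ≅
      (ModuleCat.restrictScalars.{u} (Algebra.TensorProduct.map φ ψ).toRingHom).obj
        (tensorObj k Y W) :=
  tensorIso (Z := (ModuleCat.restrictScalars.{u}
      (Algebra.TensorProduct.map φ ψ).toRingHom).obj (tensorObj k Y W))
    (TensorProduct.congr (restrictEquiv φ Y) (restrictEquiv ψ W)).toAddEquiv fun _ _ _ _ => rfl

/-- The tensor product of free modules of rank one is free of rank one. -/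
noncomputable def tensorRegularIso {X : ModuleCat.{u} B} {W : ModuleCat.{u} C} (e : X ≃ₗ[B] B)
    (e' : W ≃ₗ[C] C) : tensorObj k X W ≅ ModuleCat.of (B ⊗[k] C) (B ⊗[k] C) :=
  tensorIso (Z := ModuleCat.of (B ⊗[k] C) (B ⊗[k] C))
    (TensorProduct.congr (e.restrictScalars k) (e'.restrictScalars k)).toAddEquiv
    fun a c x w => by
      change e (a • x) ⊗ₜ[k] e' (c • w) = (a ⊗ₜ[k] c : B ⊗[k] C) * (e x ⊗ₜ[k] e' w)
      rw [map_smul, map_smul, Algebra.TensorProduct.tmul_mul_tmul]; rfl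

/-- The `A`-linear map `x ↦ f (x ⊗ w)`. -/
noncomputable def tensorEval {X : ModuleCat.{u} A} {W : ModuleCat.{u} C}
    {Z : ModuleCat.{u} (A ⊗[k] C)} (w : W) (f : tensorObj k X W ⟶ Z) :
    X ⟶ (ModuleCat.restrictScalars.{u}
      (Algebra.TensorProduct.includeLeft : A →ₐ[k] A ⊗[k] C).toRingHom).obj Z :=
  ModuleCat.ofHom (X := X) (Y := (ModuleCat.restrictScalars.{u}
      (Algebra.TensorProduct.includeLeft : A →ₐ[k] A ⊗[k] C).toRingHom).obj Z)
    { toFun := fun x => f (tensorEquiv k X W (x ⊗ₜ w))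
      map_add' := fun x y => by
        rw [TensorProduct.add_tmul, map_add, map_add]; rfl
      map_smul' := fun a x => by
        refine Eq.trans ?_ (f.hom.map_smul (a ⊗ₜ[k] (1 : C)) (tensorEquiv k X W (x ⊗ₜ w)))
        rw [tensorEquiv_smul, one_smul] }

/-- The map `x ⊗ w ↦ w x` on the tensor product with a free `C`-module of rank one. -/
noncomputable def tensorExtend {X : ModuleCat.{u} A} {W : ModuleCat.{u} C} (e : W ≃ₗ[C] C)
    {Z : ModuleCat.{u} (A ⊗[k] C)} (g : X ⟶ (ModuleCat.restrictScalars.{u}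
      (Algebra.TensorProduct.includeLeft : A →ₐ[k] A ⊗[k] C).toRingHom).obj Z) :
    tensorObj k X W ⟶ Z :=
  have hg (a : A) (x : X) : (g (a • x) : Z) = (a ⊗ₜ[k] (1 : C) : A ⊗[k] C) • (g x : Z) :=
    g.hom.map_smul a x
  let g' : X →ₗ[k] Z :=
    { toFun := fun x => g x
      map_add' := g.hom.map_add
      map_smul' := fun r x => by
        rw [← algebraMap_smul A r x, hg]; rfl }
  have hg' (x : X) : g' x = g x := rfl
  let e' : W →ₗ[k] C := e.toLinearMap.restrictScalars k
  let m : (A ⊗[k] C) →ₗ[k] Z →ₗ[k] Z := (Algebra.lsmul k k Z).toLinearMap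
  tensorHom (TensorProduct.lift ((m ∘ₗ
    (Algebra.TensorProduct.includeRight : C →ₐ[k] A ⊗[k] C).toLinearMap ∘ₗ e').flip ∘ₗ
      g')).toAddMonoidHom fun a c x w => by
    change ((1 : A) ⊗ₜ[k] e (c • w) : A ⊗[k] C) • (g (a • x) : Z) =
      (a ⊗ₜ[k] c : A ⊗[k] C) • ((1 : A) ⊗ₜ[k] e w : A ⊗[k] C) • (g x : Z)
    rw [hg, ← mul_smul, ← mul_smul, Algebra.TensorProduct.tmul_mul_tmul,
      Algebra.TensorProduct.tmul_mul_tmul, map_smul, smul_eq_mul, one_mul, mul_one, mul_one]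

lemma tensorExtend_tmul {X : ModuleCat.{u} A} {W : ModuleCat.{u} C} (e : W ≃ₗ[C] C)
    {Z : ModuleCat.{u} (A ⊗[k] C)} (g : X ⟶ (ModuleCat.restrictScalars.{u}
      (Algebra.TensorProduct.includeLeft : A →ₐ[k] A ⊗[k] C).toRingHom).obj Z) (x : X) (w : W) :
    tensorExtend e g (tensorEquiv k X W (x ⊗ₜ w)) = ((1 : A) ⊗ₜ[k] e w : A ⊗[k] C) • (g x : Z) :=
  rfl

/-- For a free `C`-module `W` of rank one, `X ↦ X ⊗_k W` is left adjoint to the restriction of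
scalars along `A → A ⊗ C`. -/
noncomputable def tensorAdjunction {W : ModuleCat.{u} C} (e : W ≃ₗ[C] C) :
    tensorFunctor k A W ⊣ ModuleCat.restrictScalars.{u}
      (Algebra.TensorProduct.includeLeft : A →ₐ[k] A ⊗[k] C).toRingHom :=
  Adjunction.mkOfHomEquiv
    { homEquiv := fun X Z =>
        { toFun := fun f => tensorEval (X := X) (e.symm 1) f
          invFun := fun g => tensorExtend (X := X) e g
          left_inv := fun f => tensorObj_hom_ext (X := X) (W := W) (Z := Z) fun x w => by
            rw [tensorExtend_tmul]
            refine (f.hom.map_smul ((1 : A) ⊗ₜ[k] e w)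
              (tensorEquiv k X W (x ⊗ₜ e.symm 1))).symm.trans (congrArg f.hom ?_)
            refine (tensorEquiv_smul X W _ _ _ _).trans ?_
            rw [one_smul, ← map_smul, smul_eq_mul, mul_one, LinearEquiv.symm_apply_apply]
          right_inv := fun g => by
            ext x
            refine (tensorExtend_tmul e g x (e.symm 1)).trans ?_
            rw [LinearEquiv.apply_symm_apply, ← Algebra.TensorProduct.one_def]
            exact one_smul (A ⊗[k] C) (g x : Z) }
      homEquiv_naturality_left_symm := fun f g => tensorObj_hom_ext fun _ _ => rfl
      homEquiv_naturality_right := fun f g => rfl }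

/-! ### Change of base -/

/-- Acyclicity of `A → B` is inherited by `A ⊗ C → B ⊗ C`: by adjunction, extensions of `B ⊗ C` over
`A ⊗ C` are extensions of `B` over `A`. -/
theorem IsExtAcyclicEpi.tensor {φ : A →ₐ[k] B} (h : IsExtAcyclicEpi φ.toRingHom) :
    IsExtAcyclicEpi (Algebra.TensorProduct.map φ (AlgHom.id k C)).toRingHom where
  full := ⟨fun {M N} g => by
    let M' := (ModuleCat.restrictScalars.{u}
      (Algebra.TensorProduct.includeLeft : B →ₐ[k] B ⊗[k] C).toRingHom).obj M
    let N' := (ModuleCat.restrictScalars.{u}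
      (Algebra.TensorProduct.includeLeft : B →ₐ[k] B ⊗[k] C).toRingHom).obj N
    let g' : M →+ N := g.hom.toAddMonoidHom
    have hg (a : A) (c : C) (m : M) :
        g' ((φ a ⊗ₜ[k] c : B ⊗[k] C) • m) = (φ a ⊗ₜ[k] c : B ⊗[k] C) • g' m :=
      g.hom.map_smul (a ⊗ₜ c) m
    let g₁ : (ModuleCat.restrictScalars.{u} φ.toRingHom).obj M' ⟶
        (ModuleCat.restrictScalars.{u} φ.toRingHom).obj N' :=
      ModuleCat.ofHom (X := (ModuleCat.restrictScalars.{u} φ.toRingHom).obj M')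
        (Y := (ModuleCat.restrictScalars.{u} φ.toRingHom).obj N')
        { toFun := g'
          map_add' := map_add g'
          map_smul' := fun a m => hg a 1 m }
    have := h.full
    obtain ⟨g₂, hg₂⟩ := (ModuleCat.restrictScalars.{u} φ.toRingHom).map_surjective g₁
    have hg' (m : M) : g' m = g₂ m := (ConcreteCategory.congr_hom hg₂ m).symm
    have hg₃ (b : B) (m : M) :
        g' ((b ⊗ₜ[k] (1 : C) : B ⊗[k] C) • m) = (b ⊗ₜ[k] (1 : C) : B ⊗[k] C) • g' m := by
      rw [hg', hg']; exact g₂.hom.map_smul b m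
    refine ⟨ModuleCat.ofHom (X := M) (Y := N)
      { toFun := g'
        map_add' := map_add g'
        map_smul' := tensor_linear g' fun b c m => ?_ }, rfl⟩
    have h1 := hg 1 c m
    rw [map_one] at h1
    have hbc : (b ⊗ₜ[k] c : B ⊗[k] C) = (b ⊗ₜ[k] (1 : C)) * ((1 : B) ⊗ₜ[k] c) := by simp
    rw [hbc, mul_smul, mul_smul, hg₃, h1]⟩
  subsingleton_ext Y n := by
    let W := (ModuleCat.restrictScalars.{u} (AlgHom.id k C).toRingHom).obj (ModuleCat.of C C)
    let e : W ≃ₗ[C] C := LinearEquiv.refl C C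
    let Y' := (ModuleCat.restrictScalars.{u}
      (Algebra.TensorProduct.includeLeft : B →ₐ[k] B ⊗[k] C).toRingHom).obj Y
    have h1 := subsingleton_ext_of_adjunction.{u, u} (tensorAdjunction (k := k) (A := A) e)
      ((ModuleCat.restrictScalars.{u} φ.toRingHom).obj (ModuleCat.of B B))
      ((ModuleCat.restrictScalars.{u}
        (Algebra.TensorProduct.map φ (AlgHom.id k C)).toRingHom).obj Y)
      (n + 1) (subsingleton_ext_of_iso (Iso.refl _) (Iso.refl _) (h.subsingleton_ext Y' n))
    exact subsingleton_ext_of_iso (tensorRestrictIso φ (AlgHom.id k C) _ _ ≪≫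
      (ModuleCat.restrictScalars.{u} _).mapIso (tensorRegularIso (LinearEquiv.refl B B)
        (LinearEquiv.refl C C))) (Iso.refl _) h1

end TensorObj

/-- Acyclicity of `C → C'` is inherited by `A ⊗ C → A ⊗ C'`, by exchanging the factors. -/
theorem IsExtAcyclicEpi.tensor_left {ψ : C →ₐ[k] C'} (h : IsExtAcyclicEpi ψ.toRingHom) :
    IsExtAcyclicEpi (Algebra.TensorProduct.map (AlgHom.id k A) ψ).toRingHom := by
  have h1 := ((IsExtAcyclicEpi.of_ringEquiv
    (Algebra.TensorProduct.comm k A C).toRingEquiv).comp (h.tensor (C := A))).comp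
    (.of_ringEquiv (Algebra.TensorProduct.comm k C' A).toRingEquiv)
  have h2 : (Algebra.TensorProduct.comm k C' A).toAlgHom.comp
      ((Algebra.TensorProduct.map ψ (AlgHom.id k A)).comp
        (Algebra.TensorProduct.comm k A C).toAlgHom) =
      Algebra.TensorProduct.map (AlgHom.id k A) ψ := by
    ext <;> simp
  rw [← h2]
  exact h1

/-- If `A → B` is acyclic on both sides, then so is `A^e → B^e`. -/
theorem IsExtAcyclicEpi.envMap {φ : A →ₐ[k] B} (h : IsExtAcyclicEpi φ.toRingHom)
    (hφ : (ModuleCat.restrictScalars.{u} φ.toRingHom.op).Full) :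
    IsExtAcyclicEpi (HomEpi.envMap φ).toRingHom := by
  have h1 := (h.tensor (C := Aᵐᵒᵖ)).comp
    (IsExtAcyclicEpi.tensor_left (A := B) (ψ := AlgHom.op φ) (h.op hφ))
  have h2 : (Algebra.TensorProduct.map (AlgHom.id k B) (AlgHom.op φ)).comp
      (Algebra.TensorProduct.map φ (AlgHom.id k Aᵐᵒᵖ)) = HomEpi.envMap φ := by
    ext <;> simp [HomEpi.envMap]
  rw [← h2]
  exact h1

end HomEpi

/-! ### Naturality of exact functors on `Ext` -/

namespace CategoryTheory

/-- Pasting of two commutative squares in the graded category of extensions. -/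
lemma Abelian.Ext.comp_square {C : Type*} [Category* C] [Abelian C] [HasExt.{v} C]
    {X X' Y Y' Z Z' : C} {n m p : ℕ} {a : Ext X Y n} {b : Ext X' Y' n} {r : Ext X X' 0}
    {s : Ext Y Y' 0} {e : Ext Y Z m} {e' : Ext Y' Z' m} {t : Ext Z Z' 0}
    (h₁ : a.comp s (add_zero n) = r.comp b (zero_add n))
    (h₂ : e.comp t (add_zero m) = s.comp e' (zero_add m)) {h : n + m = p} :
    (a.comp e h).comp t (add_zero p) = r.comp (b.comp e' h) (zero_add p) := by
  rw [Ext.comp_assoc _ _ _ h (add_zero m) (by lia), h₂,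
    ← Ext.comp_assoc _ _ _ (add_zero n) (zero_add m) (by lia), h₁,
    Ext.comp_assoc _ _ _ (zero_add n) h (by lia)]

universe w w' v₁ v₂ u₁ u₂

variable {C : Type u₁} [Category.{v₁} C] [Abelian C] [HasExt.{w} C] [EnoughInjectives C]
variable {D : Type u₂} [Category.{v₂} D] [Abelian D] [HasExt.{w'} D]

attribute [local instance] Ext.subsingleton_of_injective in
/-- Naturality on `Ext` of a transformation from the identity to a composition of exact functors. -/
lemma comp_mk₀_eq_mapExactFunctor (F : C ⥤ D) (H : D ⥤ C) [F.Additive] [PreservesFiniteLimits F]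
    [PreservesFiniteColimits F] [H.Additive] [PreservesFiniteLimits H] [PreservesFiniteColimits H]
    (τ : 𝟭 C ⟶ F ⋙ H) {X Y : C} {n : ℕ} (x : Ext.{w} X Y n) :
    x.comp (Ext.mk₀ (τ.app Y)) (add_zero n) = (Ext.mk₀ (τ.app X)).comp
      ((x.mapExactFunctor F : Ext.{w'} _ _ n).mapExactFunctor H) (zero_add n) := by
  induction n generalizing Y with
  | zero =>
    obtain ⟨x, rfl⟩ := (Ext.mk₀_bijective X Y).2 x
    rw [Ext.mapExactFunctor_mk₀, Ext.mapExactFunctor_mk₀]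
    refine (Ext.mk₀_comp_mk₀ _ _).trans (Eq.trans ?_ (Ext.mk₀_comp_mk₀ _ _).symm)
    exact congrArg Ext.mk₀ (τ.naturality x)
  | succ n hn =>
    let I : InjectivePresentation Y := Classical.arbitrary _
    let S := ShortComplex.mk _ _ (cokernel.condition I.f)
    have : Injective S.X₂ := I.injective
    have hS : S.ShortExact := { exact := ShortComplex.exact_cokernel I.f }
    obtain ⟨y, rfl⟩ := Ext.covariant_sequence_exact₁ _ hS x (by subsingleton) rfl
    have h := ShortComplex.ShortExact.extClass_naturality hS
      ((hS.map_of_exact F).map_of_exact H) (S.mapNatTrans τ)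
    have h' := Ext.mapExactFunctor_extClass.{w', w} H (hS.map_of_exact F)
    rw [Ext.mapExactFunctor_comp, Ext.mapExactFunctor_comp, Ext.mapExactFunctor_extClass]
    exact Ext.comp_square (hn y)
      (h.trans (congrArg (fun t => (Ext.mk₀ _).comp t (zero_add 1)) h'.symm))

end CategoryTheory

namespace HomEpi

attribute [local instance] ModuleCat.moduleOfAlgebraModule
  ModuleCat.isScalarTower_of_algebra_moduleCat

variable {k : Type v} [Field k] {A B C : Type u} [Ring A] [Algebra k A] [Ring B] [Algebra k B]
  [Ring C] [Algebra k C]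

/-! ### From the enveloping algebra back to the algebra -/

variable (k A) in
/-- The natural map `x ↦ x ⊗ w`. -/
noncomputable def tensorUnit (W : ModuleCat.{u} C) (w : W) :
    𝟭 (ModuleCat.{u} A) ⟶ tensorFunctor k A W ⋙ ModuleCat.restrictScalars.{u}
      (Algebra.TensorProduct.includeLeft : A →ₐ[k] A ⊗[k] C).toRingHom where
  app X := tensorEval (X := X) w (𝟙 _)
  naturality _ _ _ := rfl

/-- The map `x ↦ x ⊗ w` is a split monomorphism if `w ≠ 0`. -/
lemma exists_retraction (X : ModuleCat.{u} A) (W : ModuleCat.{u} C) (w : W) (hw : w ≠ 0) :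
    ∃ r, (tensorUnit k A W w).app X ≫ r = 𝟙 X := by
  obtain ⟨l, hl⟩ := (LinearMap.toSpanSingleton k W w).exists_leftInverse_of_injective
    (LinearMap.ker_toSpanSingleton k hw)
  have hl1 : l w = 1 := by
    simpa using LinearMap.congr_fun hl 1
  let r : X ⊗[k] W →ₗ[k] X := TensorProduct.lift ((LinearMap.lsmul k X).flip.compl₂ l)
  have hr (x : X) (w' : W) : r (x ⊗ₜ w') = l w' • x := rfl
  refine ⟨ModuleCat.ofHom (X := (tensorFunctor k A W ⋙ ModuleCat.restrictScalars.{u}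
      (Algebra.TensorProduct.includeLeft : A →ₐ[k] A ⊗[k] C).toRingHom).obj X) (Y := X)
    { toFun := fun t => r t
      map_add' := r.map_add
      map_smul' := fun a t => ?_ }, ?_⟩
  · induction t using TensorProduct.induction_on with
    | zero =>
      exact (congrArg r (map_zero (tensorAct (k := k) X W (a ⊗ₜ (1 : C))))).trans
        ((map_zero r).trans ((congrArg (fun t => a • t) (map_zero r)).trans (smul_zero a)).symm)
    | tmul x w' =>
      refine (hr (a • x) ((1 : C) • w')).trans ?_
      rw [one_smul, RingHom.id_apply, hr, smul_algebra_smul_comm]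
    | add x y hx hy =>
      exact (congrArg r (map_add (tensorAct (k := k) X W (a ⊗ₜ (1 : C))) x y)).trans
        ((map_add r _ _).trans ((congrArg₂ (· + ·) hx hy).trans
          ((smul_add a _ _).symm.trans (congrArg (fun t => a • t) (map_add r x y).symm))))
  · ext x
    refine (hr x w).trans ?_
    rw [hl1, one_smul]; rfl

/-- If `A^e → B^e` is acyclic then the extensions of `A`-modules of `B` by `B`-modules vanish: such
an extension is a retract of its tensor product over `k` with the right module `B`. -/
theorem IsExtAcyclicEpi.of_envMap {φ : A →ₐ[k] B} (h : IsExtAcyclicEpi (HomEpi.envMap φ).toRingHom)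
    (hφ : (ModuleCat.restrictScalars.{u} φ.toRingHom).Full) :
    IsExtAcyclicEpi φ.toRingHom where
  full := hφ
  subsingleton_ext N n := by
    -- for `B = 0` there is no nonzero vector to split off, but then there is nothing to show
    cases subsingleton_or_nontrivial B with
    | inl hB =>
      have : IsZero ((ModuleCat.restrictScalars.{u} φ.toRingHom).obj (ModuleCat.of B B)) :=
        @ModuleCat.isZero_of_subsingleton _ _ _ hB
      refine subsingleton_of_forall_eq 0 fun x => ?_
      rw [← x.mk₀_id_comp, this.eq_of_src (𝟙 _) 0, Ext.mk₀_zero, Ext.zero_comp]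
    | inr hB =>
      let W : ModuleCat.{u} Aᵐᵒᵖ := (ModuleCat.restrictScalars.{u} (AlgHom.op φ).toRingHom).obj
        (ModuleCat.of Bᵐᵒᵖ Bᵐᵒᵖ)
      let w : W := (1 : Bᵐᵒᵖ)
      have hw : w ≠ 0 := one_ne_zero (α := Bᵐᵒᵖ)
      let e (Y : ModuleCat.{u} B) : (tensorFunctor k A W).obj
          ((ModuleCat.restrictScalars.{u} φ.toRingHom).obj Y) ≅
          (ModuleCat.restrictScalars.{u} (HomEpi.envMap φ).toRingHom).obj
            (tensorObj k Y (ModuleCat.of Bᵐᵒᵖ Bᵐᵒᵖ)) :=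
        tensorRestrictIso φ (AlgHom.op φ) Y (ModuleCat.of Bᵐᵒᵖ Bᵐᵒᵖ)
      have h1 := subsingleton_ext_of_iso ((ModuleCat.restrictScalars.{u} _).mapIso
          (tensorRegularIso (LinearEquiv.refl B B) (LinearEquiv.refl Bᵐᵒᵖ Bᵐᵒᵖ)).symm ≪≫
            (e (ModuleCat.of B B)).symm) (e N).symm
        (h.subsingleton_ext (tensorObj k N (ModuleCat.of Bᵐᵒᵖ Bᵐᵒᵖ)) n)
      refine subsingleton_of_forall_eq 0 fun x => ?_
      have h2 := comp_mk₀_eq_mapExactFunctor.{u, u} (tensorFunctor k A W)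
        (ModuleCat.restrictScalars.{u}
          (Algebra.TensorProduct.includeLeft : A →ₐ[k] A ⊗[k] Aᵐᵒᵖ).toRingHom)
        (tensorUnit k A W w) x
      rw [h1.elim (x.mapExactFunctor (tensorFunctor k A W)) 0, Ext.mapExactFunctor_zero,
        Ext.comp_zero] at h2
      obtain ⟨r, hr⟩ := exists_retraction (k := k)
        ((ModuleCat.restrictScalars.{u} φ.toRingHom).obj N) W w hw
      have h3 := congrArg (fun t => t.comp (Ext.mk₀ r) (add_zero (n + 1))) h2
      rw [Ext.zero_comp, Ext.comp_assoc_of_third_deg_zero] at h3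
      have h4 := Ext.mk₀_comp_mk₀.{u} ((tensorUnit k A W w).app _) r
      exact x.comp_mk₀_id.symm.trans ((congrArg (fun t => x.comp t (add_zero _))
        (h4.trans (congrArg Ext.mk₀ hr)).symm).trans h3)

end HomEpi

namespace HomEpi

attribute [local instance] ModuleCat.moduleOfAlgebraModule
  ModuleCat.isScalarTower_of_algebra_moduleCat

variable {k : Type v} [Field k] {A B : Type u} [Ring A] [Algebra k A] [Ring B] [Algebra k B]

/-! ### Central elements of bimodules -/

section Central

lemma regular_hom_apply {M : ModuleCat.{u} (Env k A)} (f : regular k A ⟶ M) (x : A) :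
    f (regularEquiv k A x) = lact k x (f (regularEquiv k A 1)) := by
  refine Eq.trans (congrArg f ?_) (f.hom.map_smul _ _)
  exact (congrArg _ (mul_one x).symm).trans (regular_lact x 1).symm

/-- The value at `1` of a bimodule map from `A` is a central element. -/
lemma regular_hom_central {M : ModuleCat.{u} (Env k A)} (f : regular k A ⟶ M) (a : A) :
    lact k a (f (regularEquiv k A 1)) = ract k (f (regularEquiv k A 1)) a := by
  rw [← regular_hom_apply]
  refine Eq.trans (congrArg f ?_) (f.hom.map_smul _ _)
  exact (congrArg _ (one_mul a).symm).trans (regular_ract a 1).symm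

lemma regular_hom_ext {M : ModuleCat.{u} (Env k A)} {f g : regular k A ⟶ M}
    (h : f (regularEquiv k A 1) = g (regularEquiv k A 1)) : f = g := by
  ext x
  exact (regular_hom_apply f x).trans ((congrArg _ h).trans (regular_hom_apply g x).symm)

/-- The bimodule map `A → M` with value `m` at `1`, for a central element `m`. -/
noncomputable def centralHom {M : ModuleCat.{u} (Env k A)} (m : M)
    (hm : ∀ a : A, lact k a m = ract k m a) : regular k A ⟶ M :=
  ModuleCat.ofHom (X := regular k A) (Y := M)
    { toFun := fun x => lact k ((regularEquiv k A).symm x) m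
      map_add' := fun x y => by
        rw [map_add, lact, lact, lact, TensorProduct.add_tmul, add_smul]
      map_smul' := env_linear
        (((smulAddHom (Env k A) M).flip m).comp
          ((Algebra.TensorProduct.includeLeft : A →ₐ[k] Env k A).toRingHom.toAddMonoidHom.comp
            (regularEquiv k A).symm.toAddMonoidHom))
        (fun a x => by
          obtain ⟨x, rfl⟩ := (regularEquiv k A).surjective x
          rw [regular_lact]
          exact (lact_lact a x m).symm)
        (fun x a => by
          obtain ⟨x, rfl⟩ := (regularEquiv k A).surjective x
          rw [regular_ract]
          refine Eq.trans (lact_lact x a m).symm ?_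
          rw [hm]
          exact lact_ract x a m) }

lemma centralHom_one {M : ModuleCat.{u} (Env k A)} (m : M)
    (hm : ∀ a : A, lact k a m = ract k m a) :
    centralHom m hm (regularEquiv k A 1) = m := lact_one m

end Central

/-! ### Bimodules of linear maps -/

section HomBimod

open MulOpposite

/-- The action `(a ⊗ c) F = (n ↦ F(n a) c)` of `A^e` on `Hom_k(N, V)` for right `A`-modules `N`
and `V`. -/
noncomputable def homAct (N V : ModuleCat.{u} Aᵐᵒᵖ) :
    Env k A →ₐ[k] Module.End k (N →ₗ[k] V) :=
  Algebra.TensorProduct.lift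
    { toFun := fun a => (Algebra.lsmul k k N (op a)).lcomp k V
      map_one' := by ext F n; exact congrArg F (one_smul Aᵐᵒᵖ n)
      map_mul' := fun a b => by ext F n; exact congrArg F (mul_smul (op b) (op a) n)
      map_zero' := by ext F n; exact (congrArg F (zero_smul Aᵐᵒᵖ n)).trans (map_zero F)
      map_add' := fun a b => by
        ext F n; exact (congrArg F (add_smul (op a) (op b) n)).trans (map_add F _ _)
      commutes' := fun r => by
        ext F n; exact (congrArg F (algebraMap_smul Aᵐᵒᵖ r n)).trans (map_smul F _ _) }
    { toFun := fun c => LinearMap.compRight k (Algebra.lsmul k k V c)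
      map_one' := by ext F n; exact one_smul Aᵐᵒᵖ (F n)
      map_mul' := fun a b => by ext F n; exact mul_smul a b (F n)
      map_zero' := by ext F n; exact zero_smul Aᵐᵒᵖ (F n)
      map_add' := fun a b => by ext F n; exact add_smul a b (F n)
      commutes' := fun r => by ext F n; exact algebraMap_smul Aᵐᵒᵖ r (F n) }
    (fun _ _ => rfl)

variable (k) in
/-- The `A`-bimodule `Hom_k(N, V)` for right `A`-modules `N` and `V`. -/
noncomputable def homBimod (N V : ModuleCat.{u} Aᵐᵒᵖ) : ModuleCat.{u} (Env k A) :=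
  letI : Module (Env k A) (N →ₗ[k] V) := Module.compHom _ (homAct N V).toRingHom
  ModuleCat.of (Env k A) (N →ₗ[k] V)

variable (k) in
/-- Elements of `homBimod k N V` are `k`-linear maps. -/
noncomputable def homBimodEquiv (N V : ModuleCat.{u} Aᵐᵒᵖ) : (N →ₗ[k] V) ≃+ homBimod k N V :=
  AddEquiv.refl _

lemma homBimodEquiv_smul {N V : ModuleCat.{u} Aᵐᵒᵖ} (a : A) (c : Aᵐᵒᵖ) (F : homBimod k N V)
    (n : N) : (homBimodEquiv k N V).symm ((a ⊗ₜ[k] c : Env k A) • F) n =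
      c • (homBimodEquiv k N V).symm F (op a • n) := rfl

lemma homBimodEquiv_lact {N V : ModuleCat.{u} Aᵐᵒᵖ} (a : A) (F : homBimod k N V) (n : N) :
    (homBimodEquiv k N V).symm (lact k a F) n = (homBimodEquiv k N V).symm F (op a • n) :=
  (homBimodEquiv_smul a 1 F n).trans (one_smul _ _)

lemma homBimodEquiv_ract {N V : ModuleCat.{u} Aᵐᵒᵖ} (a : A) (F : homBimod k N V) (n : N) :
    (homBimodEquiv k N V).symm (ract k F a) n = op a • (homBimodEquiv k N V).symm F n :=
  (homBimodEquiv_smul 1 (op a) F n).trans (by rw [op_one, one_smul])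

lemma homBimod_ext {N V : ModuleCat.{u} Aᵐᵒᵖ} {F G : homBimod k N V}
    (h : ∀ n, (homBimodEquiv k N V).symm F n = (homBimodEquiv k N V).symm G n) : F = G :=
  (homBimodEquiv k N V).symm.injective (LinearMap.ext h)

variable (k) in
/-- The contravariant functor `N ↦ Hom_k(N, V)`. -/
noncomputable def homBimodFunctor (V : ModuleCat.{u} Aᵐᵒᵖ) :
    (ModuleCat.{u} Aᵐᵒᵖ)ᵒᵖ ⥤ ModuleCat.{u} (Env k A) where
  obj N := homBimod k N.unop V
  map {M N} i := ModuleCat.ofHom (X := homBimod k M.unop V) (Y := homBimod k N.unop V)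
    { toFun := fun F => homBimodEquiv k N.unop V
        (((homBimodEquiv k M.unop V).symm F) ∘ₗ i.unop.hom.restrictScalars k)
      map_add' := fun _ _ => rfl
      map_smul' := tensor_linear ((homBimodEquiv k N.unop V).toAddMonoidHom.comp
        (((i.unop.hom.restrictScalars k).lcomp k V).toAddMonoidHom.comp
          (homBimodEquiv k M.unop V).symm.toAddMonoidHom)) fun a c F => homBimod_ext fun n =>
            congrArg (fun t => c • (homBimodEquiv k M.unop V).symm F t)
              (i.unop.hom.map_smul (op a) n).symm }

instance (V : ModuleCat.{u} Aᵐᵒᵖ) : (homBimodFunctor k V).PreservesZeroMorphisms where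
  map_zero M N := by
    ext F
    exact homBimod_ext fun n => map_zero ((homBimodEquiv k M.unop V).symm F)

/-- `Hom_k(-, V)` is exact, since short exact sequences of vector spaces split. -/
lemma homBimodFunctor_shortExact (V : ModuleCat.{u} Aᵐᵒᵖ) (S : ShortComplex (ModuleCat.{u} Aᵐᵒᵖ))
    (hS : S.ShortExact) : (S.op.map (homBimodFunctor k V)).ShortExact := by
  have hf : Function.Injective S.f := (ModuleCat.mono_iff_injective _).1 hS.mono_f
  have hg : Function.Surjective S.g := (ModuleCat.epi_iff_surjective _).1 hS.epi_g
  obtain ⟨s, hs⟩ := (S.g.hom.restrictScalars k).exists_rightInverse_of_surjective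
    (LinearMap.range_eq_top.2 hg)
  obtain ⟨r, hr⟩ := (S.f.hom.restrictScalars k).exists_leftInverse_of_injective
    (LinearMap.ker_eq_bot.2 hf)
  exact
    { exact := (ShortComplex.moduleCat_exact_iff _).2 fun F hF => by
        refine ⟨homBimodEquiv k _ _ ((homBimodEquiv k S.X₂ V).symm F ∘ₗ s), ?_⟩
        refine homBimod_ext (N := S.X₂) (V := V) fun x => ?_
        change (homBimodEquiv k S.X₂ V).symm F (s (S.g x)) = _
        obtain ⟨y, hy⟩ := (ShortComplex.moduleCat_exact_iff S).1 hS.exact (s (S.g x) - x) (by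
          rw [map_sub, sub_eq_zero]; exact LinearMap.congr_fun hs (S.g x))
        rw [← sub_eq_zero, ← map_sub, ← hy]
        exact LinearMap.congr_fun (congrArg (homBimodEquiv k S.X₁ V).symm hF) y
      mono_f := (ModuleCat.mono_iff_injective _).2 fun F G h => by
        refine homBimod_ext (N := S.X₃) (V := V) fun x => ?_
        obtain ⟨x, rfl⟩ := hg x
        exact LinearMap.congr_fun (congrArg (homBimodEquiv k S.X₂ V).symm h) x
      epi_g := (ModuleCat.epi_iff_surjective _).2 fun F =>
        ⟨homBimodEquiv k S.X₂ V ((homBimodEquiv k S.X₁ V).symm F ∘ₗ r),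
          homBimod_ext (N := S.X₁) (V := V) fun x =>
            congrArg ((homBimodEquiv k S.X₁ V).symm F) (LinearMap.congr_fun hr x)⟩ }

/-- A map of right modules `N → V` is a central element of `Hom_k(N, V)`. -/
lemma homBimod_central {N V : ModuleCat.{u} Aᵐᵒᵖ} (g : N ⟶ V) (a : A) :
    lact k a (homBimodEquiv k N V (g.hom.restrictScalars k)) =
      ract k (homBimodEquiv k N V (g.hom.restrictScalars k)) a :=
  homBimod_ext fun n => by
    rw [homBimodEquiv_lact, homBimodEquiv_ract]
    exact g.hom.map_smul (op a) n

/-- A bimodule map from `A` to `Hom_k(N, V)` is determined by its value at `1`, which can be any map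
of right modules. -/
noncomputable def homBimodHomEquiv (N V : ModuleCat.{u} Aᵐᵒᵖ) :
    (regular k A ⟶ homBimod k N V) ≃ (N ⟶ V) where
  toFun f := ModuleCat.ofHom
    { toFun := (homBimodEquiv k N V).symm (f (regularEquiv k A 1))
      map_add' := map_add _
      map_smul' := fun a n => by
        have h1 := homBimodEquiv_lact a.unop (f (regularEquiv k A 1)) n
        rw [regular_hom_central] at h1
        exact h1.symm.trans (homBimodEquiv_ract a.unop (f (regularEquiv k A 1)) n) }
  invFun g := centralHom _ (homBimod_central g)
  left_inv _ := regular_hom_ext (centralHom_one _ _)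
  right_inv g := by
    ext n
    exact LinearMap.congr_fun (congrArg (homBimodEquiv k N V).symm
      (centralHom_one _ (homBimod_central (k := k) g))) n

/-- The bimodule map `y ↦ (n ↦ h (n y))` from a bimodule `Y` to `Hom_k(N, V)`, where `N` is
isomorphic to `A`. -/
noncomputable def homBimodLift {N : ModuleCat.{u} Aᵐᵒᵖ} (e : N ≃ₗ[Aᵐᵒᵖ] Aᵐᵒᵖ)
    {Y : ModuleCat.{u} (Env k A)} {V : ModuleCat.{u} Aᵐᵒᵖ}
    (h : (ModuleCat.restrictScalars.{u} (Algebra.TensorProduct.includeRight :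
      Aᵐᵒᵖ →ₐ[k] Env k A).toRingHom).obj Y ⟶ V) : Y ⟶ homBimod k N V :=
  let h' : Y →ₗ[k] V := h.hom.restrictScalars k ∘ₗ
    (restrictEquiv (Algebra.TensorProduct.includeRight : Aᵐᵒᵖ →ₐ[k] Env k A) Y).symm.toLinearMap
  have hh (c : Aᵐᵒᵖ) (y : Y) : h' (((1 : A) ⊗ₜ[k] c : Env k A) • y) = c • h' y :=
    h.hom.map_smul c y
  let e' : N →ₗ[k] A := (opLinearEquiv k).symm.toLinearMap ∘ₗ e.toLinearMap.restrictScalars k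
  have he (a : A) (n : N) : e' (op a • n) = e' n * a := congrArg unop (e.map_smul (op a) n)
  let l : A →ₗ[k] Y →ₗ[k] Y := (Algebra.lsmul k k Y).toLinearMap ∘ₗ
    (Algebra.TensorProduct.includeLeft : A →ₐ[k] Env k A).toLinearMap
  let F : Y →+ homBimod k N V := (homBimodEquiv k N V).toAddMonoidHom.comp
    ((l.flip.compr₂ h').compl₂ e').toAddMonoidHom
  have hF (y : Y) (n : N) : (homBimodEquiv k N V).symm (F y) n = h' (lact k (e' n) y) := rfl
  ModuleCat.ofHom (X := Y) (Y := homBimod k N V)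
    { toFun := F
      map_add' := map_add F
      map_smul' := tensor_linear F fun a c y => homBimod_ext fun n => by
        rw [homBimodEquiv_smul, hF, hF, he, ← hh, lact, lact, ← mul_smul, ← mul_smul]
        simp }

lemma homBimodLift_apply {N : ModuleCat.{u} Aᵐᵒᵖ} (e : N ≃ₗ[Aᵐᵒᵖ] Aᵐᵒᵖ)
    {Y : ModuleCat.{u} (Env k A)} {V : ModuleCat.{u} Aᵐᵒᵖ}
    (h : (ModuleCat.restrictScalars.{u} (Algebra.TensorProduct.includeRight :
      Aᵐᵒᵖ →ₐ[k] Env k A).toRingHom).obj Y ⟶ V) (y : Y) (n : N) :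
    (homBimodEquiv k N V).symm (homBimodLift e h y) n = h (lact k (e n).unop y : Y) := rfl

/-- If `V` is injective then so is `Hom_k(A, V)`, which is coinduced from the right module `V`. -/
lemma injective_homBimod {N : ModuleCat.{u} Aᵐᵒᵖ} (e : N ≃ₗ[Aᵐᵒᵖ] Aᵐᵒᵖ) (V : ModuleCat.{u} Aᵐᵒᵖ)
    [Injective V] : Injective (homBimod k N V) where
  factors {X Y} g f hf := by
    let ρ := ModuleCat.restrictScalars.{u} (Algebra.TensorProduct.includeRight :
      Aᵐᵒᵖ →ₐ[k] Env k A).toRingHom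
    let g₁ : ρ.obj X ⟶ V := ModuleCat.ofHom (X := ρ.obj X) (Y := V)
      { toFun := fun x => (homBimodEquiv k N V).symm (g x) (e.symm 1)
        map_add' := fun x y =>
          congrArg (fun t => (homBimodEquiv k N V).symm t (e.symm 1)) (g.hom.map_add x y)
        map_smul' := fun c x => by
          have h := homBimodEquiv_smul (k := k) 1 c (g x) (e.symm 1)
          rw [op_one, one_smul] at h
          refine Eq.trans ?_ h
          exact congrArg (fun t => (homBimodEquiv k N V).symm t (e.symm 1)) (g.hom.map_smul _ x) }
    obtain ⟨h, hh⟩ : ∃ h : ρ.obj Y ⟶ V, ρ.map f ≫ h = g₁ := ⟨_, Injective.comp_factorThru g₁ _⟩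
    refine ⟨homBimodLift e h, ?_⟩
    ext x
    refine homBimod_ext fun n => ?_
    refine (homBimodLift_apply e h (f x) n).trans ?_
    refine (congrArg h.hom (f.hom.map_smul ((e n).unop ⊗ₜ[k] (1 : Aᵐᵒᵖ)) x).symm).trans ?_
    refine (ConcreteCategory.congr_hom hh (lact k (e n).unop x : X)).trans ?_
    refine (congrArg (fun t => (homBimodEquiv k N V).symm t (e.symm 1))
      (g.hom.map_smul _ x)).trans ((homBimodEquiv_lact _ _ _).trans ?_)
    rw [op_unop, ← map_smul, smul_eq_mul, mul_one, LinearEquiv.symm_apply_apply]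

/-- Every bimodule embeds into some `Hom_k(A, V)` with `V` injective. -/
lemma exists_mono_homBimod {N : ModuleCat.{u} Aᵐᵒᵖ} (e : N ≃ₗ[Aᵐᵒᵖ] Aᵐᵒᵖ)
    (Y : ModuleCat.{u} (Env k A)) : ∃ (V : ModuleCat.{u} Aᵐᵒᵖ) (i : Y ⟶ homBimod k N V),
      Injective V ∧ Mono i := by
  let Y' := (ModuleCat.restrictScalars.{u} (Algebra.TensorProduct.includeRight :
    Aᵐᵒᵖ →ₐ[k] Env k A).toRingHom).obj Y
  refine ⟨Injective.under Y', homBimodLift e (Injective.ι Y'), inferInstance,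
    (ModuleCat.mono_iff_injective _).2 fun y z h => ?_⟩
  have h1 := congrArg (fun t => (homBimodEquiv k N _).symm t (e.symm 1)) h
  have h2 : (lact k (e (e.symm 1)).unop y : Y) = lact k (e (e.symm 1)).unop z :=
    (ModuleCat.mono_iff_injective _).1 (Injective.ι_mono Y') h1
  rw [LinearEquiv.apply_symm_apply] at h2
  exact (lact_one y).symm.trans (h2.trans (lact_one z))

/-- `Hom_k(N, V)` is compatible with restriction of scalars. -/
noncomputable def homBimodRestrictIso (φ : A →ₐ[k] B) (N V : ModuleCat.{u} Bᵐᵒᵖ) :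
    homBimod k ((ModuleCat.restrictScalars.{u} (AlgHom.op φ).toRingHom).obj N)
        ((ModuleCat.restrictScalars.{u} (AlgHom.op φ).toRingHom).obj V) ≅
      resBimod φ (homBimod k N V) :=
  let f := (((homBimodEquiv k _ _).symm.trans (LinearEquiv.arrowCongr
      (restrictEquiv (AlgHom.op φ) N) (restrictEquiv (AlgHom.op φ) V)).toAddEquiv).trans
    (homBimodEquiv k N V))
  let g := ModuleCat.ofHom (X := homBimod k
        ((ModuleCat.restrictScalars.{u} (AlgHom.op φ).toRingHom).obj N)
        ((ModuleCat.restrictScalars.{u} (AlgHom.op φ).toRingHom).obj V))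
      (Y := resBimod φ (homBimod k N V))
    { toFun := f
      map_add' := map_add f
      map_smul' := tensor_linear (Z := resBimod φ (homBimod k N V)) f.toAddMonoidHom
        fun _ _ _ => rfl }
  have : IsIso g := (ConcreteCategory.isIso_iff_bijective _).2 f.bijective
  @asIso _ _ _ _ g this

end HomBimod

end HomEpi

namespace HomEpi

attribute [local instance] ModuleCat.moduleOfAlgebraModule
  ModuleCat.isScalarTower_of_algebra_moduleCat

variable {k : Type v} [Field k] {A B : Type u} [Ring A] [Algebra k A] [Ring B] [Algebra k B]

/-! ### Hochschild cohomology of bimodules of linear maps -/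

lemma cocycleClass_eq_zero {M : ModuleCat.{u} (Env k A)} {n : ℕ} (f : barMod k A (n + 2) ⟶ M)
    (hf : (barComplex k A).d (n + 2) (n + 1) ≫ f = 0) :
    cocycleClass f hf = 0 ↔ ∃ g : barMod k A (n + 1) ⟶ M, barDHom k A (n + 1) ≫ g = f := by
  rw [← barComplex_d]
  exact (barResolution k A).extMk_eq_zero_iff f (n + 2) rfl hf n rfl

section Acyclic

open MulOpposite

/-- The map `a ⊗ u ↦ f (1 ⊗ a y) (u)` on `A ⊗ P`, for a cochain `f` with values in
`Hom_k(P, V)`. -/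
noncomputable def contraction {P V : ModuleCat.{u} Aᵐᵒᵖ} {n : ℕ}
    (f : barMod k A (n + 1) ⟶ homBimod k P V) : Bar k A n →+ (Aᵐᵒᵖ ⊗[k] P →ₗ[k] V) :=
  let f' : Bar k A (n + 1) →ₗ[k] P →ₗ[k] V :=
    { toFun := fun x => (homBimodEquiv k P V).symm (f x)
      map_add' := fun x y => by rw [map_add, map_add]
      map_smul' := fun r x => by
        rw [smul_eq_ract (A := A) r x]
        refine LinearMap.ext fun p => ?_
        refine (congrArg (fun t => (homBimodEquiv k P V).symm t p) (f.hom.map_smul _ x)).trans ?_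
        refine (homBimodEquiv_ract (algebraMap k A r) (f x) p).trans ?_
        exact algebraMap_smul Aᵐᵒᵖ r _ }
  { toFun := fun y => TensorProduct.lift
      (f' ∘ₗ barCons k A n 1 ∘ₗ (lactₗ k A (Bar k A n)).flip y ∘ₗ
        (opLinearEquiv k (M := A)).symm.toLinearMap)
    map_zero' := by
      refine TensorProduct.ext' fun a u => ?_
      simp
    map_add' := fun y z => by
      refine TensorProduct.ext' fun a u => ?_
      simp }

lemma contraction_lact {P V : ModuleCat.{u} Aᵐᵒᵖ} {n : ℕ}
    (f : barMod k A (n + 1) ⟶ homBimod k P V) (b : A) (y : Bar k A n) (t : Aᵐᵒᵖ ⊗[k] P) :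
    contraction f (lact k b y) t = contraction f y (op b • t) := by
  induction t using TensorProduct.induction_on with
  | zero => rw [smul_zero, map_zero, map_zero]
  | tmul a p =>
    rw [TensorProduct.smul_tmul', smul_eq_mul]
    change (homBimodEquiv k P V).symm (f (barCons k A n 1 (lact k a.unop (lact k b y)))) p =
      (homBimodEquiv k P V).symm (f (barCons k A n 1 (lact k (a.unop * b) y))) p
    rw [lact_lact]
  | add s t hs ht => rw [map_add, hs, ht, smul_add, map_add]

lemma contraction_ract {P V : ModuleCat.{u} Aᵐᵒᵖ} {n : ℕ}
    (f : barMod k A (n + 1) ⟶ homBimod k P V) (b : A) (y : Bar k A n) (t : Aᵐᵒᵖ ⊗[k] P) :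
    contraction f (ract k y b) t = op b • contraction f y t := by
  induction t using TensorProduct.induction_on with
  | zero => rw [map_zero, map_zero, smul_zero]
  | tmul a p =>
    change (homBimodEquiv k P V).symm (f (barCons k A n 1 (lact k a.unop (ract k y b)))) p = _
    rw [lact_ract, ← bar_ract]
    exact (congrArg (fun t => (homBimodEquiv k P V).symm t p) (f.hom.map_smul _ _)).trans
      (homBimodEquiv_ract _ _ _)
  | add s t hs ht => rw [map_add, hs, ht, map_add, smul_add]

/-- The action `a ⊗ u ↦ a u` from the free module on the vector space `P` to `P`. -/
noncomputable def actionHom (P : ModuleCat.{u} Aᵐᵒᵖ) :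
    ModuleCat.of Aᵐᵒᵖ (Aᵐᵒᵖ ⊗[k] P) ⟶ P :=
  ModuleCat.ofHom
    { toFun := TensorProduct.lift (Algebra.lsmul k k P).toLinearMap
      map_add' := map_add _
      map_smul' := fun a t => by
        induction t using TensorProduct.induction_on with
        | zero => rw [smul_zero, map_zero, smul_zero]
        | tmul b p => exact mul_smul a b p
        | add s t hs ht => rw [smul_add, map_add, hs, ht, map_add, smul_add] }

/-- On cocycles `f`, contraction inverts the bar differential, up to the action `A ⊗ P → P`. -/
lemma contraction_barD {P V : ModuleCat.{u} Aᵐᵒᵖ} {n : ℕ}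
    (f : barMod k A (n + 2) ⟶ homBimod k P V) (hf : barDHom k A (n + 2) ≫ f = 0)
    (z : Bar k A (n + 2)) (t : Aᵐᵒᵖ ⊗[k] P) :
    contraction f (barD k A (n + 1) z) t =
      (homBimodEquiv k P V).symm (f z) (actionHom (k := k) P t) := by
  induction t using TensorProduct.induction_on with
  | zero => rw [map_zero, map_zero, map_zero]
  | tmul a p =>
    have h1 : f (barD k A (n + 2) (barCons k A (n + 2) 1 (lact k a.unop z))) = 0 :=
      ConcreteCategory.congr_hom hf _
    rw [barD_cons_succ, lact_one, map_sub, sub_eq_zero, barD_lact] at h1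
    refine (congrArg (fun t => (homBimodEquiv k P V).symm t p) h1.symm).trans ?_
    refine (congrArg (fun t => (homBimodEquiv k P V).symm t p) (f.hom.map_smul _ z)).trans ?_
    exact homBimodEquiv_lact _ _ _
  | add s t hs ht => rw [map_add, map_add, map_add, hs, ht]

/-- `Hom_k(P, V)` is acyclic for Hochschild cohomology if `P` is projective: cocycles are
contracted by means of a splitting of the action `A ⊗ P → P`. -/
lemma subsingleton_HH_homBimod (P V : ModuleCat.{u} Aᵐᵒᵖ) (hP : Projective P) (n : ℕ) :
    Subsingleton (HH k A (homBimod k P V) (n + 1)) := by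
  have hepi : Epi (actionHom (k := k) P) := (ModuleCat.epi_iff_surjective _).2 fun p =>
    ⟨(1 : Aᵐᵒᵖ) ⊗ₜ p, one_smul Aᵐᵒᵖ p⟩
  obtain ⟨σ, hσ⟩ := hP.factors (𝟙 P) (actionHom (k := k) P)
  refine subsingleton_of_forall_eq 0 fun x => ?_
  obtain ⟨f, hf, rfl⟩ := exists_cocycle x
  rw [cocycleClass_eq_zero]
  have hf' : barDHom k A (n + 2) ≫ f = 0 := by
    rw [← barComplex_d]; exact hf
  let G : Bar k A (n + 1) →+ homBimod k P V := (homBimodEquiv k P V).toAddMonoidHom.comp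
    (((σ.hom.restrictScalars k).lcomp k V).toAddMonoidHom.comp (contraction f))
  have hG (y : Bar k A (n + 1)) (p : P) :
      (homBimodEquiv k P V).symm (G y) p = contraction f y (σ p) := rfl
  let g : barMod k A (n + 1) ⟶ homBimod k P V := ModuleCat.ofHom
    (X := barMod k A (n + 1)) (Y := homBimod k P V)
    { toFun := G
      map_add' := map_add G
      map_smul' := env_linear (N := homBimod k P V) G
        (fun a y => homBimod_ext fun p => by
          rw [homBimodEquiv_lact, hG, hG, contraction_lact]
          exact congrArg (contraction f y) (σ.hom.map_smul (op a) p).symm)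
        (fun y a => homBimod_ext fun p => by
          rw [homBimodEquiv_ract, hG, hG, contraction_ract]) }
  refine ⟨g, ?_⟩
  ext z
  refine homBimod_ext fun p => ?_
  refine (hG (barD k A (n + 1) z) p).trans ((contraction_barD f hf' z (σ p)).trans ?_)
  exact congrArg ((homBimodEquiv k P V).symm (f z)) (ConcreteCategory.congr_hom hσ p)

/-- The cohomology `Hⁿ(A, Hom_k(N, V))` vanishes if `Extⁿ(N, V)` does,
for `n > 0`. -/
lemma subsingleton_HH_homBimod_of_ext (N V : ModuleCat.{u} Aᵐᵒᵖ) (n : ℕ)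
    (h : Subsingleton (Ext.{u} N V (n + 1))) : Subsingleton (HH k A (homBimod k N V) (n + 1)) :=
  subsingleton_ext_contravariant (homBimodFunctor k V) (homBimodFunctor_shortExact V)
    (regular k A) V (fun N => homBimodHomEquiv N V) (fun _ _ => rfl)
    (fun P hP n => subsingleton_HH_homBimod P V hP n) n N h

end Acyclic

/-! ### Comparison of Hochschild cohomology -/

/-- An element of a `B`-bimodule which commutes with `A` commutes with `B`. -/
lemma TensorSquareIso.central {φ : A →ₐ[k] B} (h : TensorSquareIso φ.toRingHom)
    {M : ModuleCat.{u} (Env k B)} (m : M) (hm : ∀ a : A, lact k (φ a) m = ract k m (φ a)) (b : B) :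
    lact k b m = ract k m b := by
  let c : B →+ B →+ M := AddMonoidHom.mk' (fun y => AddMonoidHom.mk' (fun x =>
    lact k x (ract k m y)) fun x x' => by
      simp only [lact, TensorProduct.add_tmul, add_smul]) fun y y' => by
      refine AddMonoidHom.ext fun x => ?_
      change lact k x (ract k m (y + y')) = lact k x (ract k m y) + lact k x (ract k m y')
      rw [← lact_add, ract, MulOpposite.op_add, TensorProduct.tmul_add, add_smul]; rfl
  have hc (x y : B) : c y x = lact k x (ract k m y) := rfl
  have h1 := congrArg (tensorSquareLift (φ := φ.toRingHom) c fun x a y => by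
    change c (φ a * y) x = c y (x * φ a)
    rw [hc, hc, ← lact_lact, lact_ract (φ a), hm, ract_ract]) (h.mk_one b)
  rw [tensorSquareLift_mk, tensorSquareLift_mk, hc, hc, lact_one] at h1
  rw [← h1, ract, MulOpposite.op_one, ← Algebra.TensorProduct.one_def, one_smul]

lemma regularHom_one (φ : A →ₐ[k] B) :
    regularHom φ (regularEquiv k A 1) = regularEquiv k B 1 :=
  congrArg (regularEquiv k B) (map_one φ)

/-- The comparison map `H^n(B, M) → H^n(A, M)` is bijective. In degree zero both sides are given by
central elements; the modules `Hom_k(B, V)` provide enough injective bimodules without cohomology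
over `A`. -/
theorem IsExtAcyclicEpi.hochschild_bijective {φ : A →ₐ[k] B}
    (h : IsExtAcyclicEpi φ.toRingHom) (hB : TensorSquareIso φ.toRingHom)
    (M : ModuleCat.{u} (Env k B)) (n : ℕ) :
    Function.Bijective (extComparison.{u, u} (X' := regular k B)
      (ModuleCat.restrictScalars.{u} (HomEpi.envMap φ).toRingHom) (regularHom φ) M n) := by
  refine extComparison_bijective _ _ (fun Y => ⟨fun f g hfg => ?_, fun g => ?_⟩) (fun Y => ?_) M n
  · refine regular_hom_ext ?_
    have h1 := ConcreteCategory.congr_hom hfg (regularEquiv k A 1)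
    exact (congrArg f (regularHom_one φ)).symm.trans (h1.trans (congrArg g (regularHom_one φ)))
  · have hm (b : B) :
        lact k b (g (regularEquiv k A 1) : Y) = ract k (g (regularEquiv k A 1) : Y) b :=
      hB.central _ (fun a => (res_lact φ Y a _).symm.trans
        ((regular_hom_central g a).trans (res_ract φ Y a _))) b
    exact ⟨centralHom _ hm, regular_hom_ext ((congrArg (centralHom _ hm) (regularHom_one φ)).trans
      (centralHom_one _ hm))⟩
  · let N := ModuleCat.of Bᵐᵒᵖ Bᵐᵒᵖ
    obtain ⟨V, i, hV, hi⟩ := exists_mono_homBimod (LinearEquiv.refl Bᵐᵒᵖ N) Y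
    refine ⟨homBimod k N V, i, hi, injective_homBimod (LinearEquiv.refl Bᵐᵒᵖ N) V, fun n => ?_⟩
    exact subsingleton_ext_of_iso (Iso.refl _) (homBimodRestrictIso φ N V)
      (subsingleton_HH_homBimod_of_ext _ _ n
        ((h.op hB.full_op).subsingleton_ext V n))

end HomEpi

/-! ### Exact functors and cocycles on projective resolutions -/

section

open Localization

namespace CategoryTheory.LocalizerMorphism

universe w w' u₁ v₁ u₂ v₂ u₃

variable {C₁ : Type u₁} [Category.{v₁} C₁] {C₂ : Type u₂} [Category.{v₂} C₂]
  {W₁ : MorphismProperty C₁} {W₂ : MorphismProperty C₂}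
  (Φ : LocalizerMorphism W₁ W₂)
  {M : Type u₃} [AddMonoid M] [HasShift C₁ M] [HasShift C₂ M]
  [Φ.functor.CommShift M]
  [W₁.IsCompatibleWithShift M] [W₂.IsCompatibleWithShift M]

/-- Composition of morphisms of the category is preserved by the localization. -/
lemma mk₀_comp_mk {X Y Z : C₂}
    [HasSmallLocalizedShiftedHom.{w} W₂ M X Y]
    [HasSmallLocalizedShiftedHom.{w} W₂ M Y Z] [HasSmallLocalizedShiftedHom.{w} W₂ M X Z]
    [HasSmallLocalizedShiftedHom.{w} W₂ M Z Z]
    (m₀ : M) (hm₀ : m₀ = 0) (f : X ⟶ Y) {m : M} (z : ShiftedHom Y Z m) :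
    (SmallShiftedHom.mk₀.{w} W₂ m₀ hm₀ f).comp (SmallShiftedHom.mk.{w} W₂ z)
      (show m + m₀ = m by simp [hm₀]) = SmallShiftedHom.mk W₂ (f ≫ z) := by
  apply (SmallShiftedHom.equiv W₂ W₂.Q).injective
  rw [SmallShiftedHom.equiv_comp, SmallShiftedHom.equiv_mk₀, SmallShiftedHom.equiv_mk,
    SmallShiftedHom.equiv_mk, ← ShiftedHom.map_mk₀ m₀ hm₀, ← ShiftedHom.map_comp,
    ShiftedHom.mk₀_comp]

set_option synthInstance.maxHeartbeats 400000 in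
/-- The image under a localizer morphism of a class represented by a roof `X ← K → Y⟦m⟧`,
precomposed with a morphism that lifts to the apex. -/
lemma mk₀_comp_smallShiftedHomMap {K X Y : C₁} {L K' X' Y' : C₂}
    [HasSmallLocalizedShiftedHom.{w} W₁ M K X] [HasSmallLocalizedShiftedHom.{w} W₁ M X Y]
    [HasSmallLocalizedShiftedHom.{w} W₁ M K Y] [HasSmallLocalizedShiftedHom.{w} W₁ M Y Y]
    [HasSmallLocalizedShiftedHom.{w} W₁ M X X]
    [HasSmallLocalizedShiftedHom.{w'} W₂ M K' K']
    [HasSmallLocalizedShiftedHom.{w'} W₂ M K' X']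
    [HasSmallLocalizedShiftedHom.{w'} W₂ M K' Y']
    [HasSmallLocalizedShiftedHom.{w'} W₂ M X' X'] [HasSmallLocalizedShiftedHom.{w'} W₂ M X' Y']
    [HasSmallLocalizedShiftedHom.{w'} W₂ M Y' Y'] [HasSmallLocalizedShiftedHom.{w'} W₂ M L X']
    [HasSmallLocalizedShiftedHom.{w'} W₂ M L Y']
    [HasSmallLocalizedShiftedHom.{w'} W₂ M L K']
    (eK : Φ.functor.obj K ≅ K')
    (eX : Φ.functor.obj X ≅ X') (eY : Φ.functor.obj Y ≅ Y') (π : K ⟶ X) {m : M}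
    (z : ShiftedHom K Y m) (x : SmallShiftedHom.{w} W₁ X Y m)
    (hx : (SmallShiftedHom.mk₀.{w} W₁ (0 : M) rfl π).comp x (add_zero m) =
      SmallShiftedHom.mk.{w} W₁ z)
    (θ : L ⟶ K') :
    (SmallShiftedHom.mk₀.{w'} W₂ (0 : M) rfl (θ ≫ eK.inv ≫ Φ.functor.map π ≫ eX.hom)).comp
      (Φ.smallShiftedHomMap eX eY x : SmallShiftedHom.{w'} W₂ X' Y' m) (add_zero m) =
      SmallShiftedHom.mk.{w'} W₂ (θ ≫ eK.inv ≫
        (z.map Φ.functor).comp (.mk₀ _ rfl eY.hom) (zero_add m)) := by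
  have h : (Φ.smallShiftedHomMap eK eY _ : SmallShiftedHom.{w'} W₂ K' Y' m) =
    Φ.smallShiftedHomMap eK eY _ := congrArg (fun t => Φ.smallShiftedHomMap eK eY t) hx
  rw [Φ.smallShiftedHomMap_comp eK eX eY, Φ.smallShiftedHomMap_mk₀,
    Φ.smallShiftedHomMap_mk] at h
  rw [ShiftedHom.mk₀_comp] at h
  apply (SmallShiftedHom.equiv W₂ W₂.Q).injective
  have h1 := congrArg (fun t => (ShiftedHom.mk₀ 0 rfl (W₂.Q.map θ)).comp
    (SmallShiftedHom.equiv W₂ W₂.Q t) (add_zero m)) h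
  rw [SmallShiftedHom.equiv_comp, SmallShiftedHom.equiv_mk₀, SmallShiftedHom.equiv_mk] at h1 ⊢
  rw [← ShiftedHom.comp_assoc _ _ _ (add_zero 0) _ (by simp), ShiftedHom.mk₀_comp_mk₀,
    ← Functor.map_comp, ShiftedHom.mk₀_comp, ShiftedHom.mk₀_comp] at h1
  rw [ShiftedHom.mk₀_comp]
  refine h1.trans ?_
  simp [ShiftedHom.map]

end CategoryTheory.LocalizerMorphism

end

namespace CategoryTheory.ProjectiveResolution

open CategoryTheory.Localization CochainComplex.HomComplex

universe w w' v₁ v₂ u₁ u₂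

variable {C : Type u₁} [Category.{v₁} C] [Abelian C] {D : Type u₂} [Category.{v₂} D] [Abelian D]
  (G : C ⥤ D) [G.Additive]
  {X : C} {X' : D} (P : ProjectiveResolution X) (Q : ProjectiveResolution X')
  (θ : ∀ n, Q.complex.X n ⟶ G.obj (P.complex.X n))
  (hθ : ∀ n, θ (n + 1) ≫ G.map (P.complex.d (n + 1) n) = Q.complex.d (n + 1) n ≫ θ n)

include hθ in
/-- The map of resolutions `θ`, reindexed to cochain complexes which are concentrated in nonpositive
degrees. -/
lemma exists_hom_mapHomologicalComplex_cochainComplex :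
    ∃ θ' : Q.cochainComplex ⟶ (G.mapHomologicalComplex (.up ℤ)).obj P.cochainComplex,
      ∀ (i : ℤ) (n : ℕ) (h : -(n : ℤ) = i), θ'.f i =
        (Q.cochainComplexXIso i n h).hom ≫ θ n ≫ G.map (P.cochainComplexXIso i n h).inv := by
  let t (i : ℤ) : Q.cochainComplex.X i ⟶ G.obj (P.cochainComplex.X i) :=
    if h : -(i.natAbs : ℤ) = i then
      (Q.cochainComplexXIso i i.natAbs h).hom ≫ θ i.natAbs ≫
        G.map (P.cochainComplexXIso i i.natAbs h).inv
    else 0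
  have ht (i : ℤ) (n : ℕ) (h : -(n : ℤ) = i) : t i =
      (Q.cochainComplexXIso i n h).hom ≫ θ n ≫ G.map (P.cochainComplexXIso i n h).inv := by
    obtain rfl : n = i.natAbs := by lia
    exact dif_pos h
  refine ⟨⟨t, fun i j hij => ?_⟩, ht⟩
  obtain rfl : i + 1 = j := hij
  by_cases h : i + 1 ≤ 0
  · obtain ⟨n, hn⟩ := Int.exists_eq_neg_ofNat h
    change t i ≫ G.map (P.cochainComplex.d i (i + 1)) =
      Q.cochainComplex.d i (i + 1) ≫ t (i + 1)
    rw [ht i (n + 1) (by lia), ht (i + 1) n hn.symm,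
      P.cochainComplex_d i (i + 1) (n + 1) n (by lia) hn.symm,
      Q.cochainComplex_d i (i + 1) (n + 1) n (by lia) hn.symm]
    simp only [Category.assoc, ← Functor.map_comp,
      Iso.inv_hom_id_assoc]
    rw [Functor.map_comp, reassoc_of% (hθ n)]
  · have h0 : IsZero (P.cochainComplex.X (i + 1)) :=
      CochainComplex.isZero_of_isStrictlyLE _ 0 _ (by lia)
    exact (G.map_isZero h0).eq_of_tgt _ _

/-- The only nonzero component of the map of complexes `K → Y[n]` given by a cocycle `f`. -/
lemma equivHomShift_symm_toSingleMk_f {K : CochainComplex C ℤ} {Y : C} {n : ℕ}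
    (f : K.X (-n) ⟶ Y) (h : -(n : ℤ) + n = 0) (h' : -(n + 1 : ℕ) + 1 = -(n : ℤ))
    (hf : K.d (-(n + 1 : ℕ)) (-n) ≫ f = 0) :
    (Cocycle.equivHomShift.symm (Cocycle.toSingleMk f h (-(n + 1 : ℕ)) h' hf)).f (-n) =
      f ≫ (HomologicalComplex.singleObjXSelf (.up ℤ) 0 Y).inv ≫
        (((CochainComplex.singleFunctor C 0).obj Y).XIsoOfEq h.symm).hom := by
  have := Cochain.rightShift_v (Cochain.toSingleMk f h) n 0 (zero_add _) (-n) (-n) (by simp) 0 h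
  rw [Cochain.toSingleMk_v] at this
  exact this.trans (Category.assoc _ _ _)

/-- The image of a single complex under an additive functor is a single complex. -/
noncomputable def mapSingleIso (Z : C) :
    (G.mapHomologicalComplex (.up ℤ)).obj ((CochainComplex.singleFunctor C 0).obj Z) ≅
      (CochainComplex.singleFunctor D 0).obj (G.obj Z) :=
  (G.mapCochainComplexSingleFunctor 0).app Z

lemma mapSingleIso_hom_f (Z : C) : (mapSingleIso G Z).hom.f 0 =
    G.map (HomologicalComplex.singleObjXSelf (.up ℤ) 0 Z).hom ≫
      (HomologicalComplex.singleObjXSelf (.up ℤ) 0 (G.obj Z)).inv :=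
  HomologicalComplex.singleMapHomologicalComplex_hom_app_self G (.up ℤ) 0 Z

/-- The lift `θ'` of `u` is compatible with the augmentations of the two resolutions. -/
lemma comp_map_π' (θ' : Q.cochainComplex ⟶ (G.mapHomologicalComplex (.up ℤ)).obj P.cochainComplex)
    (θ₀ : Q.complex.X 0 ⟶ G.obj (P.complex.X 0))
    (hθ' : θ'.f 0 = (Q.cochainComplexXIso 0 0 rfl).hom ≫ θ₀ ≫
      G.map (P.cochainComplexXIso 0 0 rfl).inv) (u : X' ⟶ G.obj X)
    (hu : θ₀ ≫ G.map (P.π.f 0 ≫ (HomologicalComplex.singleObjXSelf (.down ℕ) 0 X).hom) =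
      Q.π.f 0 ≫ (HomologicalComplex.singleObjXSelf (.down ℕ) 0 X').hom ≫ u) :
    θ' ≫ (G.mapHomologicalComplex (.up ℤ)).map P.π' ≫ (mapSingleIso G X).hom =
      Q.π' ≫ (CochainComplex.singleFunctor D 0).map u := by
  refine HomologicalComplex.to_single_hom_ext ?_
  have h2 : ((CochainComplex.singleFunctor D 0).map u).f 0 =
      (HomologicalComplex.singleObjXSelf _ 0 X').hom ≫ u ≫
      (HomologicalComplex.singleObjXSelf _ 0 (G.obj X)).inv :=
    HomologicalComplex.single_map_f_self (.up ℤ) 0 u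
  change θ'.f 0 ≫ G.map (P.π'.f 0) ≫ (mapSingleIso G X).hom.f 0 =
    Q.π'.f 0 ≫ ((CochainComplex.singleFunctor D 0).map u).f 0
  rw [mapSingleIso_hom_f, h2, hθ', P.π'_f_zero, Q.π'_f_zero]
  -- the isomorphisms identifying the terms of the complexes cancel; they are replaced by arbitrary
  -- ones, since the identities hold for the given ones only up to unfolding of definitions
  have aux {Q₀ Q₁ T S' : D} {P₀ P₁ S : C} (a : Q₁ ≅ Q₀) (b : P₁ ≅ P₀) (s : S ≅ X)
      (t : T ≅ X') (s' : S' ≅ G.obj X) (τ : Q₀ ⟶ G.obj P₀) (p : P₀ ⟶ X) (q : Q₀ ⟶ X')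
      (h : τ ≫ G.map p = q ≫ u) :
      (a.hom ≫ τ ≫ G.map b.inv) ≫ G.map (b.hom ≫ p ≫ s.inv) ≫ G.map s.hom ≫ s'.inv =
        (a.hom ≫ q ≫ t.inv) ≫ t.hom ≫ u ≫ s'.inv := by
    simp only [Category.assoc, ← G.map_comp_assoc, Iso.inv_hom_id_assoc, Iso.inv_hom_id,
      Category.comp_id]
    rw [reassoc_of% h]
  refine aux _ _ _ _ _ _ _ _ ?_
  -- `singleObjXSelf` is an identity by definition
  have h1 : P.π.f 0 ≫ (HomologicalComplex.singleObjXSelf (.down ℕ) 0 X).hom = P.π.f 0 :=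
    Category.comp_id _
  have h3 : (HomologicalComplex.singleObjXSelf (.down ℕ) 0 X').hom ≫ u = u :=
    Category.id_comp _
  exact (congrArg (fun t => θ₀ ≫ G.map t) h1.symm).trans (hu.trans (congrArg _ h3))

/-- The map of complexes to `G Y[n]` given by a cocycle `f` on `K`, pulled back along `θ'`, is the
one given by the pull-back of `f`. -/
lemma comp_map_equivHomShift {L : CochainComplex D ℤ} {K : CochainComplex C ℤ}
    (θ' : L ⟶ (G.mapHomologicalComplex (.up ℤ)).obj K) {Y : C} {n : ℕ}
    (f : K.X (-n) ⟶ Y) (f' : L.X (-n) ⟶ G.obj Y) (hff : θ'.f (-n) ≫ G.map f = f')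
    (h : -(n : ℤ) + n = 0) (h' : -(n + 1 : ℕ) + 1 = -(n : ℤ))
    (hf : K.d (-(n + 1 : ℕ)) (-n) ≫ f = 0) (hf' : L.d (-(n + 1 : ℕ)) (-n) ≫ f' = 0) :
    θ' ≫ (ShiftedHom.map (Cocycle.equivHomShift.symm
      (Cocycle.toSingleMk f h (-(n + 1 : ℕ)) h' hf)) (G.mapHomologicalComplex (.up ℤ))).comp
        (.mk₀ (0 : ℤ) rfl (mapSingleIso G Y).hom) (zero_add (n : ℤ)) =
      Cocycle.equivHomShift.symm (Cocycle.toSingleMk f' h (-(n + 1 : ℕ)) h' hf') := by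
  rw [ShiftedHom.comp_mk₀]
  refine HomologicalComplex.hom_ext _ _ fun i => ?_
  by_cases hi : i = -(n : ℤ)
  · subst hi
    rw [equivHomShift_symm_toSingleMk_f]
    change θ'.f (-n) ≫ (G.map ((Cocycle.equivHomShift.symm
      (Cocycle.toSingleMk f h (-(n + 1 : ℕ)) h' hf)).f (-n)) ≫ 𝟙 _) ≫
        (mapSingleIso G Y).hom.f (-n + n) = _
    rw [equivHomShift_symm_toSingleMk_f]
    -- the degree `-n + n` is generalized in order to replace it by `0`
    have aux (j : ℤ) (hj : 0 = j) :
        G.map ((HomologicalComplex.singleObjXSelf (.up ℤ) 0 Y).inv ≫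
          (((CochainComplex.singleFunctor C 0).obj Y).XIsoOfEq hj).hom) ≫
            (mapSingleIso G Y).hom.f j =
        (HomologicalComplex.singleObjXSelf (.up ℤ) 0 (G.obj Y)).inv ≫
          (((CochainComplex.singleFunctor D 0).obj (G.obj Y)).XIsoOfEq hj).hom := by
      subst hj
      have h1 (K : CochainComplex D ℤ) : (K.XIsoOfEq (rfl : (0 : ℤ) = 0)).hom = 𝟙 _ := rfl
      have h2 (K : CochainComplex C ℤ) : (K.XIsoOfEq (rfl : (0 : ℤ) = 0)).hom = 𝟙 _ := rfl
      have h3 {S Z : C} {T : D} (s : S ≅ Z) (t : T ≅ G.obj Z) :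
          G.map (s.inv ≫ 𝟙 _) ≫ G.map s.hom ≫ t.inv = t.inv ≫ 𝟙 _ := by
        rw [Category.comp_id, ← G.map_comp_assoc, s.inv_hom_id, G.map_id, Category.id_comp,
          Category.comp_id]
      rw [h1, h2, mapSingleIso_hom_f]
      exact h3 _ _
    rw [← aux _ h.symm, ← hff]
    have h4 {S T U : C} {V W : D} (a : V ⟶ G.obj S) (b : S ⟶ T) (c : T ⟶ U) (d : G.obj U ⟶ W) :
        a ≫ (G.map (b ≫ c) ≫ 𝟙 _) ≫ d = (a ≫ G.map b) ≫ G.map c ≫ d := by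
      simp
    exact h4 _ _ _ _
  · exact (HomologicalComplex.isZero_single_obj_X (.up ℤ) 0 (G.obj Y) (i + n)
      (by lia)).eq_of_tgt _ _

variable [HasExt.{w} C]

/-- The extension class of a cocycle `f` on a projective resolution `P` is represented by the roof
`X ← P → Y[n]`. -/
lemma mk₀_π'_comp_extMk {Y : C} {n : ℕ} (f : P.complex.X n ⟶ Y)
    (hf : P.complex.d (n + 1) n ≫ f = 0) :
    (SmallShiftedHom.mk₀.{w} (HomologicalComplex.quasiIso C (.up ℤ)) (0 : ℤ) rfl P.π').comp
      (P.extMk f (n + 1) rfl hf) (add_zero (n : ℤ)) =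
    SmallShiftedHom.mk.{w} (HomologicalComplex.quasiIso C (.up ℤ)) (Cocycle.equivHomShift.symm
      (Cocycle.toSingleMk ((P.cochainComplexXIso (-n) n rfl).hom ≫ f) (neg_add_cancel (n : ℤ))
        (-(n + 1 : ℕ)) (by lia) (by
          rw [P.cochainComplex_d _ _ (n + 1) n rfl rfl]; simp [hf]))) :=
  (SmallShiftedHom.precompEquiv.{w} P.π'
    ((by rw [HomologicalComplex.mem_quasiIso_iff]; infer_instance))).apply_symm_apply _

variable [HasExt.{w'} D]

lemma smallShiftedHom_mk₀_comp_mk₀ {K : CochainComplex D ℤ} [K.IsGE 0] [K.IsLE 0] {X Y : D}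
    (π : K ⟶ (CochainComplex.singleFunctor D 0).obj X) (u : X ⟶ Y) :
    (SmallShiftedHom.mk₀.{w'} (HomologicalComplex.quasiIso D (.up ℤ)) (0 : ℤ) rfl π).comp
      (Ext.mk₀.{w'} u) (add_zero (0 : ℤ)) =
    SmallShiftedHom.mk₀.{w'} (HomologicalComplex.quasiIso D (.up ℤ)) (0 : ℤ) rfl
      (π ≫ (CochainComplex.singleFunctor D 0).map u) := by
  refine (LocalizerMorphism.mk₀_comp_mk (0 : ℤ) rfl π
    (ShiftedHom.mk₀ (0 : ℤ) rfl ((CochainComplex.singleFunctor D 0).map u))).trans ?_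
  simp [ShiftedHom.mk₀, SmallShiftedHom.mk₀]

variable [PreservesFiniteLimits G] [PreservesFiniteColimits G]

/-- The image under an exact functor of an extension class represented by a roof
`X ← K → Y[m]`, precomposed with a morphism that lifts to the image of `K`. -/
lemma mk₀_comp_mapExactFunctor {X Y : C} {K : CochainComplex C ℤ} {L : CochainComplex D ℤ}
    [K.IsGE 0] [K.IsLE 0] [L.IsGE 0] [L.IsLE 0]
    [CochainComplex.IsGE ((G.mapHomologicalComplex (.up ℤ)).obj K) 0]
    [CochainComplex.IsLE ((G.mapHomologicalComplex (.up ℤ)).obj K) 0]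
    (π : K ⟶ (CochainComplex.singleFunctor C 0).obj X) {m : ℕ}
    (z : ShiftedHom K ((CochainComplex.singleFunctor C 0).obj Y) (m : ℤ)) (x : Ext.{w} X Y m)
    (hx : (SmallShiftedHom.mk₀.{w} (HomologicalComplex.quasiIso C (.up ℤ)) (0 : ℤ) rfl π).comp
      x (add_zero (m : ℤ)) = SmallShiftedHom.mk.{w} _ z)
    (θ : L ⟶ (G.mapHomologicalComplex (.up ℤ)).obj K) :
    (SmallShiftedHom.mk₀.{w'} (HomologicalComplex.quasiIso D (.up ℤ)) (0 : ℤ) rfl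
      (θ ≫ (G.mapHomologicalComplex (.up ℤ)).map π ≫ (mapSingleIso G X).hom)).comp
      (x.mapExactFunctor G : Ext.{w'} (G.obj X) (G.obj Y) m) (add_zero (m : ℤ)) =
    SmallShiftedHom.mk.{w'} (HomologicalComplex.quasiIso D (.up ℤ)) (θ ≫
      (z.map (G.mapHomologicalComplex (.up ℤ))).comp
        (.mk₀ (0 : ℤ) rfl ((mapSingleIso G Y).hom))
          (zero_add (m : ℤ))) := by
  have h := (G.mapHomologicalComplexUpToQuasiIsoLocalizerMorphism
    (.up ℤ)).mk₀_comp_smallShiftedHomMap (L := L) (K := K)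
      (K' := (G.mapHomologicalComplex (.up ℤ)).obj K)
      (Iso.refl ((G.mapHomologicalComplex (.up ℤ)).obj K))
      (mapSingleIso G X) (mapSingleIso G Y) π z x hx θ
  refine Eq.trans ?_ (h.trans ?_)
  · exact congrArg (fun t => (SmallShiftedHom.mk₀.{w'} (HomologicalComplex.quasiIso D (.up ℤ))
      (0 : ℤ) rfl (θ ≫ t)).comp (x.mapExactFunctor G : Ext.{w'} (G.obj X) (G.obj Y) m)
        (add_zero (m : ℤ))) (Category.id_comp _).symm
  · exact congrArg (fun t => SmallShiftedHom.mk.{w'} (HomologicalComplex.quasiIso D (.up ℤ))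
      (θ ≫ t)) (Category.id_comp _)

include hθ in
/-- Extension classes given by cocycles on projective resolutions are compatible with exact
functors: if `θ` is a map of complexes lifting `u`, the class of `f` goes to that of `θ ≫ f`. -/
lemma mk₀_comp_mapExactFunctor_extMk (u : X' ⟶ G.obj X)
    (hu : θ 0 ≫ G.map (P.π.f 0 ≫ (HomologicalComplex.singleObjXSelf (.down ℕ) 0 X).hom) =
      Q.π.f 0 ≫ (HomologicalComplex.singleObjXSelf (.down ℕ) 0 X').hom ≫ u)
    {Y : C} {n : ℕ} (f : P.complex.X n ⟶ Y) (hf : P.complex.d (n + 1) n ≫ f = 0) :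
    (Ext.mk₀ u).comp ((P.extMk f (n + 1) rfl hf).mapExactFunctor G) (zero_add n) =
      Q.extMk (θ n ≫ G.map f) (n + 1) rfl
        (by rw [← reassoc_of% hθ, ← G.map_comp, hf, G.map_zero, comp_zero]) := by
  obtain ⟨θ', hθ'⟩ := exists_hom_mapHomologicalComplex_cochainComplex G P Q θ hθ
  have hπ : QuasiIso ((G.mapHomologicalComplex (.up ℤ)).map P.π' ≫ (mapSingleIso G X).hom) := by
    have : QuasiIso ((G.mapHomologicalComplex (.up ℤ)).map P.π') :=
      HomologicalComplex.quasiIso_map_of_preservesHomology _ _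
    infer_instance
  have : CochainComplex.IsGE ((G.mapHomologicalComplex (.up ℤ)).obj P.cochainComplex) 0 :=
    (HomologicalComplex.isSupported_iff_of_quasiIso ((G.mapHomologicalComplex (.up ℤ)).map P.π' ≫
      (mapSingleIso G X).hom) _).2
      (inferInstanceAs (((CochainComplex.singleFunctor D 0).obj (G.obj X)).IsGE 0))
  have : CochainComplex.IsLE ((G.mapHomologicalComplex (.up ℤ)).obj P.cochainComplex) 0 :=
    (HomologicalComplex.isSupported_iff_of_quasiIso ((G.mapHomologicalComplex (.up ℤ)).map P.π' ≫
      (mapSingleIso G X).hom) _).2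
      (inferInstanceAs (((CochainComplex.singleFunctor D 0).obj (G.obj X)).IsLE 0))
  have hcomm := comp_map_π' G P Q θ' (θ 0) (hθ' 0 0 rfl) u hu
  -- both sides are compared after precomposition with the quasi-isomorphism `Q → X'`
  apply (SmallShiftedHom.precompEquiv.{w'} Q.π'
    ((by rw [HomologicalComplex.mem_quasiIso_iff]; infer_instance))).injective
  refine Eq.trans ?_ (mk₀_π'_comp_extMk Q _ _).symm
  have h := mk₀_comp_mapExactFunctor G P.π' _ _ (mk₀_π'_comp_extMk P f hf) θ'
  rw [hcomm] at h
  refine Eq.trans ?_ (h.trans ?_)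
  · refine (SmallShiftedHom.comp_assoc _ _ _ _ (add_zero (0 : ℤ)) _ (by simp)).symm.trans ?_
    rw [smallShiftedHom_mk₀_comp_mk₀]
  · refine congrArg _ (comp_map_equivHomShift G θ' _ _ ?_ _ _ _ _)
    rw [hθ' _ n rfl]
    have h4 {S T U : C} {V W : D} (a : V ⟶ W) (b : W ⟶ G.obj S) (c : T ≅ S) (d : S ⟶ U) :
        (a ≫ b ≫ G.map c.inv) ≫ G.map (c.hom ≫ d) = a ≫ b ≫ G.map d := by
      simp only [Category.assoc, ← G.map_comp, Iso.inv_hom_id_assoc]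
    exact h4 _ _ _ _

end CategoryTheory.ProjectiveResolution

namespace HomEpi

attribute [local instance] ModuleCat.moduleOfAlgebraModule
  ModuleCat.isScalarTower_of_algebra_moduleCat

variable {k : Type v} [Field k] {A B : Type u} [Ring A] [Algebra k A] [Ring B] [Algebra k B]

/-! ### Functoriality of the bar resolution -/

/-- The map `φ ⊗ ⋯ ⊗ φ` from the bar construction of `A` to that of `B`. -/
noncomputable def barMap (φ : A →ₐ[k] B) : ∀ n, Bar k A n →ₗ[k] Bar k B n
  | 0 => (barZero k B).toLinearMap ∘ₗ φ.toLinearMap ∘ₗ (barZero k A).symm.toLinearMap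
  | n + 1 => barLift ((barCons k B n).compl₁₂ φ.toLinearMap (barMap φ n))

variable (φ : A →ₐ[k] B)

lemma barMap_zero (a : A) : barMap φ 0 (barZero k A a) = barZero k B (φ a) := rfl

lemma barMap_cons (n : ℕ) (a : A) (x : Bar k A n) :
    barMap φ (n + 1) (barCons k A n a x) = barCons k B n (φ a) (barMap φ n x) :=
  barLift_cons _ _ _

lemma barMap_lact (n : ℕ) (a : A) (x : Bar k A n) :
    barMap φ n (lact k a x) = lact k (φ a) (barMap φ n x) := by
  cases n with
  | zero =>
    obtain ⟨x, rfl⟩ := (barZero k A).surjective x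
    rw [barZero_lact, barMap_zero, barMap_zero, barZero_lact, map_mul]
  | succ n =>
    induction x using bar_induction with
    | h0 => simp [lact]
    | h1 b x => rw [bar_lact, barMap_cons, barMap_cons, bar_lact, map_mul]
    | h2 x y hx hy => rw [lact_add, map_add, hx, hy, map_add, lact_add]

lemma barMap_ract (n : ℕ) (x : Bar k A n) (a : A) :
    barMap φ n (ract k x a) = ract k (barMap φ n x) (φ a) := by
  induction n with
  | zero =>
    obtain ⟨x, rfl⟩ := (barZero k A).surjective x
    rw [barZero_ract, barMap_zero, barMap_zero, barZero_ract, map_mul]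
  | succ n ih =>
    induction x using bar_induction with
    | h0 => simp [ract]
    | h1 b x => rw [bar_ract, barMap_cons, barMap_cons, bar_ract, ih]
    | h2 x y hx hy => rw [ract_add, map_add, hx, hy, map_add, ract_add]

lemma barMap_barD (n : ℕ) (x : Bar k A (n + 1)) :
    barMap φ n (barD k A n x) = barD k B n (barMap φ (n + 1) x) := by
  induction n with
  | zero =>
    induction x using bar_induction with
    | h0 => simp
    | h1 a x => rw [barD_cons_zero, barMap_lact, barMap_cons, barD_cons_zero]
    | h2 x y hx hy => rw [map_add, map_add, hx, hy, map_add, map_add]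
  | succ n ih =>
    induction x using bar_induction with
    | h0 => simp
    | h1 a x =>
      rw [barD_cons_succ, map_sub, barMap_lact, barMap_cons, ih, barMap_cons, barD_cons_succ]
    | h2 x y hx hy => rw [map_add, map_add, hx, hy, map_add, map_add]

/-- `φ ⊗ ⋯ ⊗ φ` as a map of `A`-bimodules. -/
noncomputable def barMapHom (n : ℕ) : barMod k A n ⟶ resBimod φ (barMod k B n) :=
  ModuleCat.ofHom (X := barMod k A n) (Y := resBimod φ (barMod k B n))
    { toFun := barMap φ n
      map_add' := map_add _
      map_smul' := env_linear (N := resBimod φ (barMod k B n)) (barMap φ n).toAddMonoidHom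
        (fun a x => (barMap_lact φ n a x).trans (res_lact φ (barMod k B n) a _).symm)
        (fun x a => (barMap_ract φ n x a).trans (res_ract φ (barMod k B n) a _).symm) }

lemma barMapHom_barDHom (n : ℕ) : barMapHom φ (n + 1) ≫
    (ModuleCat.restrictScalars (envMap φ).toRingHom).map (barDHom k B n) =
      barDHom k A n ≫ barMapHom φ n := by
  ext x
  exact (barMap_barD φ n x).symm

lemma barMapHom_barAug : barMapHom φ 1 ≫
    (ModuleCat.restrictScalars (envMap φ).toRingHom).map (barAug k B) =
      barAug k A ≫ regularHom φ := by
  ext x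
  exact (barMap_barD φ 0 x).symm

/-- The pull-back along `φ : A → B` of a Hochschild cocycle. -/
noncomputable def pullCocycle {M : ModuleCat.{u} (Env k B)} {n : ℕ} (f : barMod k B n ⟶ M) :
    barMod k A n ⟶ resBimod φ M :=
  barMapHom φ n ≫ (ModuleCat.restrictScalars (envMap φ).toRingHom).map f

lemma barComplex_d_pullCocycle {M : ModuleCat.{u} (Env k B)} {n : ℕ} (f : barMod k B (n + 1) ⟶ M)
    (hf : (barComplex k B).d (n + 1) n ≫ f = 0) :
    (barComplex k A).d (n + 1) n ≫ pullCocycle φ f = 0 := by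
  rw [barComplex_d] at hf ⊢
  ext x
  exact (congrArg f (barMap_barD φ (n + 1) x)).trans (ConcreteCategory.congr_hom hf _)

/-- On Hochschild cocycles, the comparison map is composition with `φ ⊗ ⋯ ⊗ φ`, which is a map of
bar resolutions lifting `φ : A → B`. -/
lemma extComparison_cocycleClass {M : ModuleCat.{u} (Env k B)} {n : ℕ}
    (f : barMod k B (n + 1) ⟶ M) (hf : (barComplex k B).d (n + 1) n ≫ f = 0) :
    (Ext.mk₀ (regularHom φ)).comp ((cocycleClass f hf).mapExactFunctor
      (ModuleCat.restrictScalars (envMap φ).toRingHom)) (zero_add n) =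
      cocycleClass (pullCocycle φ f) (barComplex_d_pullCocycle φ f hf) := by
  refine (barResolution k B).mk₀_comp_mapExactFunctor_extMk
    (ModuleCat.restrictScalars (envMap φ).toRingHom) (barResolution k A)
    (fun n => barMapHom φ (n + 1)) (fun n => ?_) (regularHom φ) ?_ f hf
  · refine (congrArg (fun t => barMapHom φ (n + 1 + 1) ≫
      (ModuleCat.restrictScalars (envMap φ).toRingHom).map t) (barComplex_d n)).trans ?_
    exact (barMapHom_barDHom φ (n + 1)).trans
      (congrArg (fun t => t ≫ barMapHom φ (n + 1)) (barComplex_d n).symm)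
  · exact barMapHom_barAug φ

/-! ### Cup products and restriction -/

/-- The cup product of cochains commutes with pull-back along `φ ⊗ ⋯ ⊗ φ`. -/
lemma cochainCup_res {M N L : ModuleCat.{u} (Env k B)} (μ : Pairing k B M N L) {p q : ℕ}
    (γ : Bar k B q →ₗ[k] N) (γ' : Bar k A q →ₗ[k] resBimod φ N)
    (hγ : ∀ x, γ' x = γ (barMap φ q x)) (f : Bar k B p →ₗ[k] M)
    (f' : Bar k A p →ₗ[k] resBimod φ M) (hf : ∀ x, f' x = f (barMap φ p x))
    (x : Bar k A (q + p)) :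
    cochainCup (μ.res φ) γ' p f' x = cochainCup μ γ p f (barMap φ (q + p) x) := by
  induction p with
  | zero =>
    refine (cochainCup_zero (μ.res φ) γ' f' x).trans
      (Eq.trans ?_ (cochainCup_zero μ γ f _).symm)
    rw [hγ, hf, barMap_zero, map_one]
    rfl
  | succ p ih =>
    induction x using bar_induction with
    | h0 => rw [map_zero, map_zero, map_zero]; rfl
    | h1 a x =>
      refine (cochainCup_cons (μ.res φ) γ' f' a x).trans (Eq.trans ?_
        ((cochainCup_cons μ γ f _ _).symm.trans (congrArg _ (barMap_cons φ _ a x).symm)))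
      refine ih _ _ (fun y => ?_) x
      refine (hf _).trans ?_
      rw [barMap_cons]
      rfl
    | h2 x y hx hy => rw [map_add, map_add, hx, hy, map_add]; rfl

lemma restrictOne_pullCocycle {M : ModuleCat.{u} (Env k B)} {n : ℕ} (f : barMod k B (n + 1) ⟶ M)
    (x : Bar k A n) :
    restrictOne (pullCocycle φ f).hom x = restrictOne f.hom (barMap φ n x) := by
  change f.hom (barMap φ (n + 1) (barCons k A n 1 x)) = f.hom (barCons k B n 1 (barMap φ n x))
  rw [barMap_cons, map_one]

lemma cupHom_pullCocycle {M N L : ModuleCat.{u} (Env k B)} (μ : Pairing k B M N L) {p q : ℕ}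
    (f : barMod k B (p + 1) ⟶ M) (g : barMod k B (q + 1) ⟶ N) :
    cupHom (μ.res φ) (pullCocycle φ f) (pullCocycle φ g) = pullCocycle φ (cupHom μ f g) := by
  ext x
  change extendLeft (cochainCup (μ.res φ) (restrictOne (pullCocycle φ g).hom) p
    (restrictOne (pullCocycle φ f).hom)) x =
      extendLeft (cochainCup μ (restrictOne g.hom) p (restrictOne f.hom)) (barMap φ (q + p + 1) x)
  induction x using bar_induction with
  | h0 => rw [map_zero, map_zero, map_zero]; rfl
  | h1 a x =>
    rw [barMap_cons, extendLeft_cons, extendLeft_cons, ← cochainCup_res φ μ _ _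
      (restrictOne_pullCocycle φ g) _ _ (restrictOne_pullCocycle φ f)]
    exact res_lact φ L a _
  | h2 x y hx hy => rw [map_add, map_add, hx, hy, map_add]; rfl

end HomEpi

/-! ### Extension classes of degree zero -/

namespace CategoryTheory.ProjectiveResolution

open CochainComplex CochainComplex.HomComplex

universe w v₁ u₁

/-- In degree zero there are no coboundaries. -/
lemma extMk_zero_degree_eq_zero {C : Type u₁} [Category.{v₁} C] [Abelian C] [HasExt.{w} C]
    {X Y : C} (R : ProjectiveResolution X) (f : R.complex.X 0 ⟶ Y)
    (hf : R.complex.d 1 0 ≫ f = 0) (h : R.extMk f 1 rfl hf = 0) : f = 0 := by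
  rw [← R.extEquivCohomologyClass.apply_eq_iff_eq, extEquivCohomologyClass_extMk,
    extEquivCohomologyClass_zero, CohomologyClass.mk_eq_zero_iff,
    Cocycle.toSingleMk_mem_coboundaries_iff _ _ _ _ _ 1 (by simp)] at h
  obtain ⟨g, hg⟩ := h
  have hz : IsZero (R.cochainComplex.X 1) := CochainComplex.isZero_of_isStrictlyLE _ 0 _ (by lia)
  rw [hz.eq_of_src g 0, comp_zero] at hg
  rw [← cancel_epi (R.cochainComplexXIso (-(0 : ℕ)) 0 rfl).hom, ← hg, comp_zero]

end CategoryTheory.ProjectiveResolution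

namespace HomEpi

attribute [local instance] ModuleCat.moduleOfAlgebraModule
  ModuleCat.isScalarTower_of_algebra_moduleCat

variable {k : Type v} [Field k] {A B : Type u} [Ring A] [Algebra k A] [Ring B] [Algebra k B]

/-! ### The cup product of Hochschild classes -/

section cast

/-- The identification of `Bar m` and `Bar n` for `m = n`. -/
noncomputable def barCast {m n : ℕ} (h : m = n) : Bar k A m →ₗ[k] Bar k A n :=
  (LinearEquiv.cast (R := k) (M := fun n => Bar k A n) h).toLinearMap

lemma barCast_cons {m n : ℕ} (h : m = n) (h' : m + 1 = n + 1) (a : A) (x : Bar k A m) :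
    barCast h' (barCons k A m a x) = barCons k A n a (barCast h x) := by
  subst h; rfl

end cast

variable {M N L : ModuleCat.{u} (Env k A)} (μ : Pairing k A M N L)

/-- The Leibniz rule for the cup product of cochains. The second term lives on `Bar (q + 1 + p)`,
which is not definitionally `Bar (q + p + 1)`. -/
lemma cochainD_cup_eq_add {p q : ℕ} (γ : Bar k A q →ₗ[k] N)
    (f : Bar k A p →ₗ[k] M) (hf : IsRightLinear f) (x : Bar k A (q + p + 1)) :
    cochainD (cochainCup μ γ p f) x = cochainCup μ γ (p + 1) (cochainD f) x +
      (-1 : ℤ) ^ p • cochainCup μ (cochainD γ) p f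
        (barCast (show q + p + 1 = q + 1 + p by lia) x) := by
  induction p with
  | zero =>
    induction x using bar_induction with
    | h0 => simp
    | h2 x y hx hy => simp only [map_add, hx, hy, smul_add]; abel
    | h1 a y =>
      have h1 := cochainD_cons γ a y
      have h2 : cochainCup μ γ 0 f (barD k A q (barCons k A q a y)) =
          μ.toFun (f (barZero k A a)) (γ y) -
            μ.toFun (f (barZero k A 1)) (cochainD γ (barCons k A q a y)) := by
        rw [cochainCup_zero, h1, map_sub, ← μ.mid, ← hf, barZero_ract, one_mul]
        abel
      have h3 : cochainCup μ γ 0 (cochainD f ∘ₗ barCons k A 0 a) y =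
          lact k a (μ.toFun (f (barZero k A 1)) (γ y)) - μ.toFun (f (barZero k A a)) (γ y) := by
        rw [cochainCup_zero, LinearMap.comp_apply, cochainD_cons, barD_cons_zero, barZero_lact,
          mul_one, map_sub, AddMonoidHom.sub_apply, μ.left]
      have h4 : cochainD (cochainCup μ γ 0 f) (barCons k A q a y) =
        lact k a (μ.toFun (f (barZero k A 1)) (γ y)) -
          (μ.toFun (f (barZero k A a)) (γ y) -
            μ.toFun (f (barZero k A 1)) (cochainD γ (barCons k A q a y))) := by
        rw [← h2]
        exact cochainD_cons (cochainCup μ γ 0 f) a y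
      have h5 : cochainCup μ γ (0 + 1) (cochainD f) (barCons k A q a y) = _ :=
        (cochainCup_cons μ γ (cochainD f) a y).trans h3
      refine h4.trans (Eq.trans ?_ (congrArg₂ (· + ·) h5.symm rfl))
      have h6 : (-1 : ℤ) ^ 0 • cochainCup μ (cochainD γ) 0 f (barCons k A q a y) =
        μ.toFun (f (barZero k A 1)) (cochainD γ (barCons k A q a y)) := one_smul _ _
      refine Eq.trans ?_ (congrArg₂ (· + ·) rfl h6.symm)
      abel
  | succ p ih =>
    induction x using bar_induction with
    | h0 => simp
    | h2 x y hx hy => simp only [map_add, hx, hy, smul_add]; abel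
    | h1 a z =>
      induction z using bar_induction with
      | h0 => simp
      | h2 x y hx hy => simp only [map_add, hx, hy, smul_add]; abel
      | h1 b x =>
        have hr : IsRightLinear (f ∘ₗ barCons k A p a) := fun x c => by
          rw [LinearMap.comp_apply, ← bar_ract, hf]; rfl
        have h := ih (f ∘ₗ barCons k A p a) hr (barCons k A (q + p) b x)
        rw [cochainD_cons, cochainCup_cons] at h
        have key : (cochainD f ∘ₗ barCons k A (p + 1) a) ∘ₗ barCons k A p b =
            lactₗ k A M a ∘ₗ (f ∘ₗ barCons k A p b) - f ∘ₗ barCons k A p (a * b) +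
              lactₗ k A M b ∘ₗ (f ∘ₗ barCons k A p a) -
                cochainD (f ∘ₗ barCons k A p a) ∘ₗ barCons k A p b := by
          ext y
          simp only [LinearMap.comp_apply, LinearMap.sub_apply, LinearMap.add_apply, cochainD_cons,
            barD_cons_succ, lactₗ_apply, bar_lact, map_sub]
          abel
        have e1 : cochainCup μ γ (p + 1 + 1) (cochainD f)
            (barCons k A (q + (p + 1)) a (barCons k A (q + p) b x)) =
            cochainCup μ γ p ((cochainD f ∘ₗ barCons k A (p + 1) a) ∘ₗ barCons k A p b) x := by
          rw [cochainCup_cons]; exact cochainCup_cons _ _ _ _ _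
        have e2 : cochainD (cochainCup μ γ (p + 1) f)
            (barCons k A (q + (p + 1)) a (barCons k A (q + p) b x)) =
            lact k a (cochainCup μ γ p (f ∘ₗ barCons k A p b) x) -
              (cochainCup μ γ p (f ∘ₗ barCons k A p (a * b)) x -
                cochainCup μ γ p (f ∘ₗ barCons k A p a)
                  (barD k A (q + p) (barCons k A (q + p) b x))) := by
          refine (cochainD_cons (cochainCup μ γ (p + 1) f) a (barCons k A (q + p) b x)).trans ?_
          have := barD_cons_succ a (barCons k A (q + p) b x)
          rw [bar_lact] at this
          refine congrArg₂ _ (congrArg _ (cochainCup_cons _ _ _ _ _)) ?_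
          refine (congrArg (cochainCup μ γ (p + 1) f) this).trans ?_
          rw [map_sub]
          exact congrArg₂ _ (cochainCup_cons _ _ _ _ _) (cochainCup_cons _ _ _ _ _)
        have e3 : cochainCup μ (cochainD γ) (p + 1) f
            (barCast (show q + (p + 1) + 1 = q + 1 + (p + 1) by lia)
              (barCons k A (q + (p + 1)) a (barCons k A (q + p) b x))) =
            cochainCup μ (cochainD γ) p (f ∘ₗ barCons k A p a)
              (barCast (show q + p + 1 = q + 1 + p by lia) (barCons k A (q + p) b x)) :=
          (congrArg _ (barCast_cons (show q + p + 1 = q + 1 + p by lia) _ a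
            (barCons k A (q + p) b x))).trans (cochainCup_cons _ _ _ _ _)
        refine e2.trans (Eq.trans ?_ (congrArg₂ (· + ·) e1.symm
          (congrArg (fun t => (-1 : ℤ) ^ (p + 1) • t) e3.symm)))
        rw [key]
        simp only [map_sub, map_add, LinearMap.sub_apply, LinearMap.add_apply, cochainCup_lact]
        have h' : cochainCup μ γ p (f ∘ₗ barCons k A p a)
            (barD k A (q + p) (barCons k A (q + p) b x)) =
            lact k b (cochainCup μ γ p (f ∘ₗ barCons k A p a) x) -
              (cochainCup μ γ p (cochainD (f ∘ₗ barCons k A p a) ∘ₗ barCons k A p b) x +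
                (-1 : ℤ) ^ p • cochainCup μ (cochainD γ) p (f ∘ₗ barCons k A p a)
                  (barCast (show q + p + 1 = q + 1 + p by lia) (barCons k A (q + p) b x))) := by
          rw [← h]; abel
        rw [h', pow_succ, mul_neg_one, neg_smul]
        abel

lemma cocycleClass_sub {n : ℕ} (f g : barMod k A (n + 1) ⟶ M)
    (hf : (barComplex k A).d (n + 1) n ≫ f = 0) (hg : (barComplex k A).d (n + 1) n ≫ g = 0) :
    cocycleClass f hf - cocycleClass g hg =
      cocycleClass (f - g) ((Preadditive.comp_sub ..).trans
        ((congrArg₂ (· - ·) hf hg).trans (sub_zero _))) :=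
  (barResolution k A).sub_extMk f g (n + 1) rfl hf hg

/-- The correspondence of bimodule maps on `Bar (n + 1)` and right linear cochains on `Bar n` is
compatible with the differentials. -/
lemma extendHom_cochainD {n : ℕ} (ψ : Bar k A n →ₗ[k] M) (hψ : IsRightLinear ψ)
    (f : barMod k A (n + 2) ⟶ M) (hf : ∀ x, restrictOne f.hom x = cochainD ψ x) :
    barDHom k A (n + 1) ≫ ModuleCat.ofHom (extendHom ψ hψ) = f := by
  ext x
  refine Eq.trans ?_ (extendLeft_restrictOne f.hom x)
  change extendLeft ψ (barD k A (n + 1) x) = _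
  induction x using bar_induction with
  | h0 => simp
  | h2 x y hx hy => rw [map_add, map_add, hx, hy, map_add]
  | h1 a x => rw [extendLeft_barD, extendLeft_cons, hf]

/-- A cocycle is a coboundary if its restriction is the differential of a right linear cochain. -/
lemma cocycleClass_eq_zero_of_cochainD {m n : ℕ} (h : m + 1 = n) (f : barMod k A (n + 1) ⟶ M)
    (hf : (barComplex k A).d (n + 1) n ≫ f = 0) (ψ : Bar k A m →ₗ[k] M) (hψ : IsRightLinear ψ)
    (e : ∀ x, restrictOne f.hom (barCast h x) = cochainD ψ x) : cocycleClass f hf = 0 := by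
  subst h
  exact (cocycleClass_eq_zero f hf).2 ⟨_, extendHom_cochainD ψ hψ f e⟩

/-- A cocycle with zero class is the differential of a right linear cochain. -/
lemma exists_cochain_of_cocycleClass_eq_zero {n : ℕ} (f : barMod k A (n + 2) ⟶ M)
    (hf : (barComplex k A).d (n + 2) (n + 1) ≫ f = 0) (h : cocycleClass f hf = 0) :
    ∃ ψ : Bar k A n →ₗ[k] M, IsRightLinear ψ ∧ restrictOne f.hom = cochainD ψ := by
  obtain ⟨g, rfl⟩ := (cocycleClass_eq_zero f hf).1 h
  refine ⟨restrictOne g.hom, restrictOne_right _, LinearMap.ext fun x => ?_⟩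
  have h := extendLeft_barD (restrictOne g.hom) (1 : A) x
  rw [lact_one, extendLeft_restrictOne] at h
  exact h

lemma restrictOne_cupHom {p q : ℕ} (f : barMod k A (p + 1) ⟶ M) (g : barMod k A (q + 1) ⟶ N)
    (x : Bar k A (q + p)) : restrictOne (cupHom μ f g).hom x =
      cochainCup μ (restrictOne g.hom) p (restrictOne f.hom) x := by
  refine (extendLeft_cons (cochainCup μ (restrictOne g.hom) p (restrictOne f.hom)) 1 x).trans ?_
  exact lact_one _

lemma cochainCup_sub {p q : ℕ} (γ γ' : Bar k A q →ₗ[k] N) (f : Bar k A p →ₗ[k] M)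
    (x : Bar k A (q + p)) :
    cochainCup μ (γ - γ') p f x = cochainCup μ γ p f x - cochainCup μ γ' p f x := by
  induction p with
  | zero => exact map_sub (μ.toFun (f (barZero k A 1))) (γ x) (γ' x)
  | succ p ih =>
    induction x using bar_induction with
    | h0 => simp
    | h2 x y hx hy => simp only [map_add, hx, hy]; abel
    | h1 a x =>
      exact (cochainCup_cons _ _ _ _ _).trans ((ih _ _).trans
        (congrArg₂ (· - ·) (cochainCup_cons _ _ _ _ _).symm (cochainCup_cons _ _ _ _ _).symm))

lemma cupHom_sub_left {p q : ℕ} (f f' : barMod k A (p + 1) ⟶ M) (g : barMod k A (q + 1) ⟶ N) :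
    cupHom μ (f - f') g = cupHom μ f g - cupHom μ f' g := by
  ext x
  change extendLeft (cochainCup μ (restrictOne g.hom) p
    (restrictOne f.hom - restrictOne f'.hom)) x =
      extendLeft (cochainCup μ (restrictOne g.hom) p (restrictOne f.hom)) x -
      extendLeft (cochainCup μ (restrictOne g.hom) p (restrictOne f'.hom)) x
  induction x using bar_induction with
  | h0 => simp
  | h2 x y hx hy => simp only [map_add, hx, hy]; abel
  | h1 a x => rw [extendLeft_cons, extendLeft_cons, extendLeft_cons, ← lact_sub, map_sub]; rfl

lemma cupHom_sub_right {p q : ℕ} (f : barMod k A (p + 1) ⟶ M) (g g' : barMod k A (q + 1) ⟶ N) :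
    cupHom μ f (g - g') = cupHom μ f g - cupHom μ f g' := by
  ext x
  change extendLeft (cochainCup μ (restrictOne g.hom - restrictOne g'.hom) p
    (restrictOne f.hom)) x =
      extendLeft (cochainCup μ (restrictOne g.hom) p (restrictOne f.hom)) x -
      extendLeft (cochainCup μ (restrictOne g'.hom) p (restrictOne f.hom)) x
  induction x using bar_induction with
  | h0 => simp
  | h2 x y hx hy => simp only [map_add, hx, hy]; abel
  | h1 a x => rw [extendLeft_cons, extendLeft_cons, extendLeft_cons, ← lact_sub, cochainCup_sub]

lemma cupHom_zero_left {p q : ℕ} (g : barMod k A (q + 1) ⟶ N) :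
    cupHom μ (0 : barMod k A (p + 1) ⟶ M) g = 0 := by
  have h := cupHom_sub_left μ (0 : barMod k A (p + 1) ⟶ M) 0 g
  rwa [sub_self, sub_self] at h

lemma cupHom_zero_right {p q : ℕ} (f : barMod k A (p + 1) ⟶ M) :
    cupHom μ f (0 : barMod k A (q + 1) ⟶ N) = 0 := by
  have h := cupHom_sub_right μ f (0 : barMod k A (q + 1) ⟶ N) 0
  rwa [sub_self, sub_self] at h

lemma cochainD_zsmul {n : ℕ} (c : ℤ) (ψ : Bar k A n →ₗ[k] M) (x : Bar k A (n + 1)) :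
    cochainD (c • ψ) x = c • cochainD ψ x := by
  induction x using bar_induction with
  | h0 => simp
  | h2 x y hx hy => simp only [map_add, hx, hy, smul_add]
  | h1 a x =>
    rw [cochainD_cons, cochainD_cons, LinearMap.smul_apply, LinearMap.smul_apply, smul_sub]
    exact congrArg (· - _) (map_zsmul (lactₗ k A M a) c (ψ x))

lemma cocycleClass_of_eq_zero {n : ℕ} (f : barMod k A (n + 1) ⟶ M)
    (hf : (barComplex k A).d (n + 1) n ≫ f = 0) (h : f = 0) : cocycleClass f hf = 0 := by
  subst h
  exact (barResolution k A).extMk_zero (n + 1) rfl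

/-- If `f` is the differential of `ψ` and `g` is a cocycle, then `f ⌣ g` is the differential of
`ψ ⌣ g`. -/
lemma cocycleClass_cupHom_eq_zero_left {p q : ℕ} (f : barMod k A (p + 1) ⟶ M)
    (g : barMod k A (q + 1) ⟶ N) (hf : (barComplex k A).d (p + 1) p ≫ f = 0)
    (hg : (barComplex k A).d (q + 1) q ≫ g = 0) (h : cocycleClass f hf = 0) :
    cocycleClass (cupHom μ f g) (cupHom_cocycle μ f g hf hg) = 0 := by
  cases p with
  | zero =>
    obtain rfl := (barResolution k A).extMk_zero_degree_eq_zero f hf h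
    exact cocycleClass_of_eq_zero _ _ (cupHom_zero_left μ (p := 0) g)
  | succ p =>
    obtain ⟨ψ, hψ, e⟩ := exists_cochain_of_cocycleClass_eq_zero f hf h
    refine cocycleClass_eq_zero_of_cochainD (m := q + p) rfl _ _
      (cochainCup μ (restrictOne g.hom) p ψ) (cochainCup_right μ _ (restrictOne_right _) _)
      fun x => ?_
    rw [cochainD_cup μ _ (cochainD_restrictOne g hg) _ hψ, ← e]
    exact restrictOne_cupHom μ f g x

/-- If `f` is a cocycle of degree `p` and `g` is the differential of `ψ`, then `f ⌣ g` is the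
differential of `(-1)ᵖ f ⌣ ψ`. -/
lemma cocycleClass_cupHom_eq_zero_right {p q : ℕ} (f : barMod k A (p + 1) ⟶ M)
    (g : barMod k A (q + 1) ⟶ N) (hf : (barComplex k A).d (p + 1) p ≫ f = 0)
    (hg : (barComplex k A).d (q + 1) q ≫ g = 0) (h : cocycleClass g hg = 0) :
    cocycleClass (cupHom μ f g) (cupHom_cocycle μ f g hf hg) = 0 := by
  cases q with
  | zero =>
    obtain rfl := (barResolution k A).extMk_zero_degree_eq_zero g hg h
    exact cocycleClass_of_eq_zero _ _ (cupHom_zero_right μ (q := 0) f)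
  | succ q =>
    obtain ⟨ψ, hψ, e⟩ := exists_cochain_of_cocycleClass_eq_zero g hg h
    refine cocycleClass_eq_zero_of_cochainD (m := q + p) (by lia) _ _
      ((-1 : ℤ) ^ p • cochainCup μ ψ p (restrictOne f.hom)) ?_ fun x => ?_
    · intro x a
      rw [LinearMap.smul_apply, LinearMap.smul_apply,
        cochainCup_right μ ψ hψ (restrictOne f.hom) x a]
      exact (smul_comm _ _ _)
    · refine (restrictOne_cupHom μ f g _).trans ?_
      have h1 : (-1 : ℤ) ^ p * (-1) ^ p = 1 := by
        rw [← mul_pow]; simp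
      rw [cochainD_zsmul, cochainD_cup_eq_add μ ψ _ (restrictOne_right _),
        cochainD_restrictOne f hf, map_zero, LinearMap.zero_apply, zero_add, ← mul_smul, h1,
        one_smul, e]

/-- The cup product can be computed on any representing cocycles. -/
lemma cup_cocycleClass {p q : ℕ} (f : barMod k A (p + 1) ⟶ M)
    (g : barMod k A (q + 1) ⟶ N) (hf : (barComplex k A).d (p + 1) p ≫ f = 0)
    (hg : (barComplex k A).d (q + 1) q ≫ g = 0) :
    cup μ (cocycleClass f hf) (cocycleClass g hg) =
      cocycleClass (cupHom μ f g) (cupHom_cocycle μ f g hf hg) := by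
  obtain ⟨hf', ef⟩ := (exists_cocycle (cocycleClass f hf)).choose_spec
  obtain ⟨hg', eg⟩ := (exists_cocycle (cocycleClass g hg)).choose_spec
  change cocycleClass (cupHom μ (exists_cocycle (cocycleClass f hf)).choose
    (exists_cocycle (cocycleClass g hg)).choose) (cupHom_cocycle μ _ _ hf' hg') = _
  generalize (exists_cocycle (cocycleClass f hf)).choose = f' at *
  generalize (exists_cocycle (cocycleClass g hg)).choose = g' at *
  rw [← sub_eq_zero, cocycleClass_sub] at ef eg
  -- replace first `f'` by `f` and then `g'` by `g`
  have h1 := cocycleClass_cupHom_eq_zero_left μ _ g' _ hg' ef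
  have h2 := cocycleClass_cupHom_eq_zero_right μ f _ hf _ eg
  simp only [cupHom_sub_left] at h1
  simp only [cupHom_sub_right] at h2
  rw [← cocycleClass_sub _ _ (cupHom_cocycle μ _ _ hf' hg') (cupHom_cocycle μ _ _ hf hg'),
    sub_eq_zero] at h1
  rw [← cocycleClass_sub _ _ (cupHom_cocycle μ _ _ hf hg') (cupHom_cocycle μ _ _ hf hg),
    sub_eq_zero] at h2
  exact h1.trans h2

end HomEpi

/-! ### The equivalences and the comparison isomorphism -/

namespace HomEpi

variable {k : Type v} [Field k] {A B : Type u} [Ring A] [Algebra k A] [Ring B] [Algebra k B]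
  (φ : A →ₐ[k] B)

/-- Comparison of Hochschild cohomology is compatible with cup products. -/
lemma extComparison_cup {M N L : ModuleCat.{u} (Env k B)} (μ : Pairing k B M N L) {p q : ℕ}
    (α : HH k B M p) (β : HH k B N q) :
    extComparison (X' := regular k B) (ModuleCat.restrictScalars (envMap φ).toRingHom)
        (regularHom φ) L (q + p) (cup μ α β) =
      cup (μ.res φ)
        (extComparison (X' := regular k B) (ModuleCat.restrictScalars (envMap φ).toRingHom)
          (regularHom φ) M p α)
        (extComparison (X' := regular k B) (ModuleCat.restrictScalars (envMap φ).toRingHom)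
          (regularHom φ) N q β) := by
  obtain ⟨f, hf, rfl⟩ := exists_cocycle α
  obtain ⟨g, hg, rfl⟩ := exists_cocycle β
  rw [cup_cocycleClass]
  refine (extComparison_cocycleClass φ _ _).trans ?_
  refine Eq.trans ?_ (congrArg₂ (cup (μ.res φ)) (extComparison_cocycleClass φ f hf)
    (extComparison_cocycleClass φ g hg)).symm
  rw [cup_cocycleClass]
  congr 1
  exact (cupHom_pullCocycle φ μ f g).symm

/-- The four characterizations of homological epimorphisms are equivalent. -/
theorem tfae_isHomologicalEpi (hB : TensorSquareIso φ.toRingHom) :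
    List.TFAE
      [IsHomologicalEpi φ.toRingHom,
       ∀ n : ℕ, 0 < n → ∀ M : ModuleCat.{u} B,
         IsZero (Tor n (rightMod φ.toRingHom) (leftMod φ.toRingHom M)),
       ∀ n : ℕ, 0 < n →
         IsZero (Tor n (rightMod φ.toRingHom) (leftMod φ.toRingHom (ModuleCat.of B B))),
       IsHomologicalEpi (envMap φ).toRingHom] := by
  simp only [isHomologicalEpi_iff_isExtAcyclicEpi]
  tfae_have 1 → 2 := fun h n hn M => by
    obtain ⟨m, rfl⟩ := Nat.exists_eq_succ_of_ne_zero hn.ne'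
    exact h.isZero_tor M m
  tfae_have 2 → 3 := fun h n hn => h n hn _
  tfae_have 3 → 1 := fun h => isExtAcyclicEpi_of_tor hB.full fun n => h (n + 1) n.succ_pos
  tfae_have 1 → 4 := fun h => h.envMap hB.full_op
  tfae_have 4 → 1 := fun h => .of_envMap h hB.full
  tfae_finish

instance : (ModuleCat.restrictScalars (envMap φ).toRingHom).Linear k where
  map_smul {M N} f c := by
    ext m
    exact congrArg (· • f.hom m) ((envMap φ).commutes c).symm

/-- Comparison of Hochschild cohomology as a linear equivalence. -/
noncomputable def hochschildEquiv (h : IsExtAcyclicEpi φ.toRingHom)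
    (hB : TensorSquareIso φ.toRingHom) (n : ℕ) (M : ModuleCat.{u} (Env k B)) :
    HH k B M n ≃ₗ[k] HH k A (resBimod φ M) n :=
  .ofBijective
    { toFun := extComparison (X' := regular k B)
        (ModuleCat.restrictScalars (envMap φ).toRingHom) (regularHom φ) M n
      map_add' := map_add _
      map_smul' := fun c x => by
        refine (extComparison_apply (X' := regular k B) _ (regularHom φ) _).trans ?_
        rw [Functor.mapExactFunctor_smul, Ext.comp_smul]
        rfl }
    (h.hochschild_bijective hB M n)

end HomEpi

theorem mainTheorem7 {k : Type v} [Field k] {A B : Type u} [Ring A] [Algebra k A]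
    [Ring B] [Algebra k B] (φ : A →ₐ[k] B) (hB : HomEpi.TensorSquareIso φ.toRingHom) :
    List.TFAE
      [HomEpi.IsHomologicalEpi φ.toRingHom,
       ∀ n : ℕ, 0 < n → ∀ M : ModuleCat.{u} B,
         Limits.IsZero (HomEpi.Tor n (HomEpi.rightMod φ.toRingHom) (HomEpi.leftMod φ.toRingHom M)),
       ∀ n : ℕ, 0 < n →
         Limits.IsZero (HomEpi.Tor n (HomEpi.rightMod φ.toRingHom)
           (HomEpi.leftMod φ.toRingHom (ModuleCat.of B B))),
       HomEpi.IsHomologicalEpi (HomEpi.envMap φ).toRingHom] ∧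
    (HomEpi.IsHomologicalEpi φ.toRingHom →
      ∃ η : ∀ (n : ℕ) (M : ModuleCat.{u} (HomEpi.Env k B)),
          HomEpi.HH k B M n ≃ₗ[k] HomEpi.HH k A (HomEpi.resBimod φ M) n,
        (∀ (n : ℕ) (M : ModuleCat.{u} (HomEpi.Env k B)) (x : HomEpi.HH k B M n),
          η n M x = (Abelian.Ext.mk₀ (HomEpi.regularHom φ)).comp
            (x.mapExactFunctor (ModuleCat.restrictScalars (HomEpi.envMap φ).toRingHom))
            (zero_add n)) ∧
        (∀ (n : ℕ) (M M' : ModuleCat.{u} (HomEpi.Env k B)) (f : M ⟶ M') (x : HomEpi.HH k B M n),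
          η n M' (x.comp (Abelian.Ext.mk₀ f) (add_zero n)) =
            (η n M x).comp (Abelian.Ext.mk₀
              ((ModuleCat.restrictScalars (HomEpi.envMap φ).toRingHom).map f)) (add_zero n)) ∧
        η 0 (HomEpi.regular k B) (Abelian.Ext.mk₀ (𝟙 (HomEpi.regular k B))) =
          Abelian.Ext.mk₀ (HomEpi.regularHom φ) ∧
        (∀ (p q : ℕ) (α : HomEpi.HH k B (HomEpi.regular k B) p)
            (β : HomEpi.HH k B (HomEpi.regular k B) q),
          η (q + p) (HomEpi.regular k B) (HomEpi.cup (HomEpi.mulPairing k B) α β) =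
            HomEpi.cup ((HomEpi.mulPairing k B).res φ)
              (η p (HomEpi.regular k B) α) (η q (HomEpi.regular k B) β))) := by
  refine ⟨HomEpi.tfae_isHomologicalEpi φ hB, fun h => ?_⟩
  rw [HomEpi.isHomologicalEpi_iff_isExtAcyclicEpi] at h
  refine ⟨HomEpi.hochschildEquiv φ h hB, fun n M x => rfl, fun n M M' f x => ?_, ?_,
    fun p q α β => HomEpi.extComparison_cup φ (HomEpi.mulPairing k B) α β⟩
  · refine (extComparison_comp (X' := HomEpi.regular k B) _ (HomEpi.regularHom φ) x
      (Abelian.Ext.mk₀ f) (add_zero n)).trans ?_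
    rw [Abelian.Ext.mapExactFunctor_mk₀]
    rfl
  · refine (extComparison_apply (X' := HomEpi.regular k B) _ (HomEpi.regularHom φ) _).trans ?_
    rw [Abelian.Ext.mapExactFunctor_mk₀, Abelian.Ext.mk₀_comp_mk₀,
      CategoryTheory.Functor.map_id]
    exact congrArg Abelian.Ext.mk₀ (Category.comp_id _)
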